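/- Consider Jacobi matrices $(Ju)_n=a_nu_{n+1}+a_{n-1}u_{n-1}+b_nu_n$ on $\ell^2(\mathbb Z)$ with bounded real coefficients, $a_n>0$. For $\operatorname{Im}z>0$ let $f_\pm(\cdot,z)$ be the nontrivial solutions (unique up to constant factors) of $a_nf(n+1)+a_{n-1}f(n-1)+b_nf(n)=zf(n)$, $n\in\mathbb Z$, that are square summable near $\pm\infty$, and let $m_\pm(z)=\mp\frac{f_\pm(1,z)}{a_0f_\pm(0,z)}$. Call $J$ reflectionless on $(-2,2)$ if $m_+(x)=-\overline{m_-(x)}$ for Lebesgue a.e. $x\in(-2,2)$, where $m_\pm(x)=\lim_{y\downarrow0}m_\pm(x+iy)$. The free Jacobi matrix is the one with $a_n=1$, $b_n=0$ for all $n$. (i) If $J$ is reflectionless on $(-2,2)$, then $a_n\ge1$ for all $n\in\mathbb Z$, and if $a_{n_0}=1$ for a single $n_0\in\mathbb Z$, then $J$ is the free Jacobi matrix. Now let $R\ge2$, let $r\in(0,1]$ be given by $r+1/r=R$, and let $\mathcal M_R$ be the set of all Jacobi matrices $J$ as above that are reflectionless on $(-2,2)$ and satisfy $\|J\|\le R$.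 (ii) If $J\in\mathcal M_R$ is not the free Jacobi matrix, then for all $n\in\mathbb Z$, $$a_n>1\qquad\text{and}\qquad r^2<\frac{a_{n+1}^2-1}{a_n^2-1}<\frac1{r^2}.$$ (iii) These bounds are sharp: if $R>2$, then for every $n\in\mathbb Z$ and every $c>r^2$ there is a $J\in\mathcal M_R$, not free, with $\frac{a_{n+1}^2-1}{a_n^2-1}<c$, and for every $n\in\mathbb Z$ and every $c<1/r^2$ there is a $J\in\mathcal M_R$, not free, with $\frac{a_{n+1}^2-1}{a_n^2-1}>c$. -/

import Mathlib

open Filter Topology MeasureTheory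

noncomputable section

/-- The Hilbert space `ℓ²(ℤ)` of complex sequences. -/
abbrev EllTwo : Type := lp (fun _ : ℤ => ℂ) 2

theorem memlp_two_comp_equiv (e : ℤ ≃ ℤ) (u : EllTwo) :
    Memℓp (fun n => u (e n)) 2 := by
  have h := lp.memℓp u
  rw [memℓp_gen_iff (by norm_num)] at h ⊢
  exact e.summable_iff.mpr h

theorem norm_sq_ellTwo (u : EllTwo) : ‖u‖ ^ 2 = ∑' n, ‖u n‖ ^ 2 := by
  have h := lp.norm_rpow_eq_tsum (p := 2) (by norm_num) u
  simpa using h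

theorem summable_sq_ellTwo (u : EllTwo) : Summable fun n => ‖u n‖ ^ 2 := by
  have h := lp.memℓp u
  rw [memℓp_gen_iff (by norm_num)] at h
  simpa using h

/-- The unitary operator `(S u)_n = u_{e n}` on `ℓ²(ℤ)` given by a permutation `e` of `ℤ`. -/
def permCLM (e : ℤ ≃ ℤ) : EllTwo →L[ℂ] EllTwo :=
  LinearMap.mkContinuous
    { toFun := fun u => ⟨fun n => u (e n), memlp_two_comp_equiv e u⟩
      map_add' := fun _ _ => rfl
      map_smul' := fun _ _ => rfl } 1 (by
    intro u
    rw [one_mul]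
    refine (sq_le_sq₀ (norm_nonneg _) (norm_nonneg _)).mp ?_
    rw [norm_sq_ellTwo, norm_sq_ellTwo]
    exact (e.tsum_eq (fun n => ‖u n‖ ^ 2)).le)

theorem memlp_two_mul (c : ℤ → ℝ) (hc : ∃ C, ∀ n, |c n| ≤ C) (u : EllTwo) :
    Memℓp (fun n => (c n : ℂ) * u n) 2 := by
  obtain ⟨C, hC⟩ := hc
  rw [memℓp_gen_iff (by norm_num)]
  have h : Summable fun n => C ^ 2 * ‖u n‖ ^ 2 := (summable_sq_ellTwo u).mul_left _
  refine Summable.of_nonneg_of_le (fun n => by positivity) (fun n => ?_) h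
  have h2 : |c n| ^ 2 ≤ C ^ 2 := pow_le_pow_left₀ (abs_nonneg _) (hC n) 2
  simp only [norm_mul, Complex.norm_real, Real.norm_eq_abs, ENNReal.toReal_ofNat,
    Real.rpow_ofNat, mul_pow]
  exact mul_le_mul_of_nonneg_right h2 (by positivity)

/-- The multiplication operator `(M u)_n = c_n u_n` on `ℓ²(ℤ)`, for a bounded real sequence `c`. -/
def mulCLM (c : ℤ → ℝ) (hc : ∃ C, ∀ n, |c n| ≤ C) : EllTwo →L[ℂ] EllTwo :=
  LinearMap.mkContinuousOfExistsBound
    { toFun := fun u => ⟨fun n => (c n : ℂ) * u n, memlp_two_mul c hc u⟩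
      map_add' := fun u v => by ext n; exact mul_add _ _ _
      map_smul' := fun k u => by ext n; simp [mul_left_comm] } (by
    obtain ⟨C, hC⟩ := hc
    have hC0 : 0 ≤ C := (abs_nonneg _).trans (hC 0)
    refine ⟨C, fun u => ?_⟩
    refine (sq_le_sq₀ (norm_nonneg _) (by positivity)).mp ?_
    rw [mul_pow, norm_sq_ellTwo, norm_sq_ellTwo, ← tsum_mul_left]
    refine Summable.tsum_le_tsum (fun n => ?_) (summable_sq_ellTwo _)
      ((summable_sq_ellTwo u).mul_left _)
    have h2 : |c n| ^ 2 ≤ C ^ 2 := pow_le_pow_left₀ (abs_nonneg _) (hC n) 2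
    have h3 : ‖(c n : ℂ) * u n‖ ^ 2 = |c n| ^ 2 * ‖u n‖ ^ 2 := by
      rw [norm_mul, mul_pow, Complex.norm_real, Real.norm_eq_abs]
    exact h3.trans_le (mul_le_mul_of_nonneg_right h2 (by positivity)))

/-- A bounded whole line Jacobi matrix, given by its coefficients: `a, b ∈ ℓ^∞(ℤ)` real with
`a_n > 0`. -/
structure JacobiMatrix where
  a : ℤ → ℝ
  b : ℤ → ℝ
  a_pos : ∀ n, 0 < a n
  a_bdd : ∃ C, ∀ n, |a n| ≤ C
  b_bdd : ∃ C, ∀ n, |b n| ≤ C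

namespace JacobiMatrix

/-- The bounded operator on `ℓ²(ℤ)` defined by `J`; see `op_apply`. -/
def op (J : JacobiMatrix) : EllTwo →L[ℂ] EllTwo :=
  mulCLM J.a J.a_bdd ∘L permCLM (Equiv.addRight 1)
    + permCLM (Equiv.subRight 1) ∘L mulCLM J.a J.a_bdd
    + mulCLM J.b J.b_bdd

theorem op_apply (J : JacobiMatrix) (u : EllTwo) (n : ℤ) :
    J.op u n = J.a n * u (n + 1) + J.a (n - 1) * u (n - 1) + J.b n * u n := rfl

/-- The free Jacobi matrix: `a_n = 1`, `b_n = 0` for all `n`. -/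
def IsFree (J : JacobiMatrix) : Prop := ∀ n, J.a n = 1 ∧ J.b n = 0

/-- `f` solves `a_n f(n+1) + a_{n-1} f(n-1) + b_n f(n) = z f(n)` for all `n ∈ ℤ`. -/
def IsSolution (J : JacobiMatrix) (z : ℂ) (f : ℤ → ℂ) : Prop :=
  ∀ n, J.a n * f (n + 1) + J.a (n - 1) * f (n - 1) + J.b n * f n = z * f n

/-- `f` is a nontrivial solution that is square summable near `+∞`. -/
def IsWeylPlus (J : JacobiMatrix) (z : ℂ) (f : ℤ → ℂ) : Prop :=
  f ≠ 0 ∧ J.IsSolution z f ∧ Summable fun n : ℕ => ‖f (n : ℤ)‖ ^ 2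

/-- `f` is a nontrivial solution that is square summable near `-∞`. -/
def IsWeylMinus (J : JacobiMatrix) (z : ℂ) (f : ℤ → ℂ) : Prop :=
  f ≠ 0 ∧ J.IsSolution z f ∧ Summable fun n : ℕ => ‖f (-(n : ℤ))‖ ^ 2

/-- A choice of the solution `f_+(·, z)`; for `Im z > 0` such solutions exist and are unique up to
a constant factor. -/
def fPlus (J : JacobiMatrix) (z : ℂ) : ℤ → ℂ := Classical.epsilon (J.IsWeylPlus z)

/-- A choice of the solution `f_-(·, z)`; for `Im z > 0` such solutions exist and are unique up to
a constant factor. -/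
def fMinus (J : JacobiMatrix) (z : ℂ) : ℤ → ℂ := Classical.epsilon (J.IsWeylMinus z)

/-- The half line function `m_+(z) = -f_+(1, z) / (a_0 f_+(0, z))`, for `Im z > 0`. -/
def mPlus (J : JacobiMatrix) (z : ℂ) : ℂ := -(J.fPlus z 1 / (J.a 0 * J.fPlus z 0))

/-- The half line function `m_-(z) = f_-(1, z) / (a_0 f_-(0, z))`, for `Im z > 0`. -/
def mMinus (J : JacobiMatrix) (z : ℂ) : ℂ := J.fMinus z 1 / (J.a 0 * J.fMinus z 0)

/-- `J` is reflectionless on `S`: `m_+(x) = -conj (m_-(x))` for Lebesgue almost every `x ∈ S`,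
where `m_±(x)` is the limit of `m_±(x + i y)` as `y ↓ 0`. -/
def IsReflectionlessOn (J : JacobiMatrix) (S : Set ℝ) : Prop :=
  ∀ᵐ x : ℝ, x ∈ S → ∃ mp mm : ℂ,
    Tendsto (fun y : ℝ => J.mPlus (x + y * Complex.I)) (𝓝[>] 0) (𝓝 mp) ∧
    Tendsto (fun y : ℝ => J.mMinus (x + y * Complex.I)) (𝓝[>] 0) (𝓝 mm) ∧
    mp = -(starRingEnd ℂ) mm

/-- The class of Jacobi matrices that are reflectionless on `(-2, 2)` and satisfy `‖J‖ ≤ R`. -/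
def marchenkoClass (R : ℝ) : Set JacobiMatrix :=
  {J | J.IsReflectionlessOn (Set.Ioo (-2) 2) ∧ ‖J.op‖ ≤ R}

end JacobiMatrix

end

/-!
On `(-2, 2)` the reflectionless condition lets `m₊` on the upper half plane and `-m₋` on the lower
one continue each other analytically. Uniformizing the slit plane by `z = -(λ + 1 / λ)` turns the
pair into one Herglotz function on `Im λ > 0`, whose measure lives on `r ≤ |t| ≤ 1 / r` because the
spectrum of `J` lies in `[-R, R]`. Expanding at `0` and `∞` shows that `1 - 1 / a₀²` and
`(a₋₁² - 1) / a₀²` are the integrals of `(1 + t²) / t²` and `1 + t²`, so their ratio lies between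
`r²` and `1 / r²`. Equality would concentrate the measure on `|t| = r` or `|t| = 1 / r`,
against the sign of the Green function outside the spectrum. The bounds are sharp for one soliton,
that is, for Darboux transforms of the free matrix by the positive solutions `r⁻ⁿ + t rⁿ`.
-/

section Gluing

open Complex Set

variable {h : ℂ → ℂ} {a b C : ℝ}

theorem isOpen_im_ne_zero : IsOpen {z : ℂ | z.im ≠ 0} :=
  isOpen_ne_fun continuous_im continuous_const

theorem integral_boundary_rect_eq_zero_of_im_ne_zero {U : Set ℂ} {f : ℂ → ℂ}
    (hc : ContinuousOn f U) (hd : ∀ z ∈ U, z.im ≠ 0 → DifferentiableAt ℂ f z) {z w : ℂ}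
    (hzw : Rectangle z w ⊆ U) (h0 : 0 ∉ Ioo (min z.im w.im) (max z.im w.im)) :
    wedgeIntegral z w f + wedgeIntegral w z f = 0 := by
  have := integral_boundary_rect_eq_zero_of_continuousOn_of_differentiableOn f z w
    (hc.mono hzw) fun p hp => ?_
  · rw [wedgeIntegral_add_wedgeIntegral_eq]
    exact this
  · refine (hd p (hzw ⟨?_, ?_⟩) fun hp0 => h0 (hp0 ▸ hp.2)).differentiableWithinAt
    exacts [Ioo_subset_Icc_self hp.1, Ioo_subset_Icc_self hp.2]

theorem differentiableOn_of_continuousOn_of_im_ne_zero {U : Set ℂ} (hU : IsOpen U) {f : ℂ → ℂ}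
    (hc : ContinuousOn f U) (hd : ∀ z ∈ U, z.im ≠ 0 → DifferentiableAt ℂ f z) :
    DifferentiableOn ℂ f U := by
  refine (isConservativeOn_and_continuousOn_iff_isDifferentiableOn hU).1 ⟨fun z w hzw => ?_, hc⟩
  rw [← add_eq_zero_iff_eq_neg]
  -- A rectangle that the real axis crosses is cut along it.
  by_cases h0 : 0 ∈ Ioo (min z.im w.im) (max z.im w.im)
  swap
  · exact integral_boundary_rect_eq_zero_of_im_ne_zero hc hd hzw h0
  have h0' : (0 : ℝ) ∈ uIcc z.im w.im := Ioo_subset_Icc_self h0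
  have hlow : Rectangle z (w.re : ℂ) ⊆ U := (Subset.trans (by
    refine reProdIm_subset_iff.2 (Set.prod_mono ?_ ?_)
    · simp
    · exact uIcc_subset_uIcc left_mem_uIcc (by simpa using h0')) hzw)
  have hup : Rectangle (z.re : ℂ) w ⊆ U := (Subset.trans (by
    refine reProdIm_subset_iff.2 (Set.prod_mono ?_ ?_)
    · simp
    · exact uIcc_subset_uIcc (by simpa using h0') right_mem_uIcc) hzw)
  have e1 := integral_boundary_rect_eq_zero_of_im_ne_zero hc hd hlow (by simpa using le_of_lt)
  have e2 := integral_boundary_rect_eq_zero_of_im_ne_zero hc hd hup (by simpa using le_of_lt)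
  have hvert : ∀ x ∈ uIcc z.re w.re,
      IntervalIntegrable (fun y : ℝ => f (x + y * I)) volume z.im w.im := fun x hx =>
    (hc.comp (t := U) (by fun_prop) fun y hy =>
      hzw ⟨by simpa using hx, by simpa using hy⟩).intervalIntegrable
  have split : ∀ x ∈ uIcc z.re w.re, (∫ y in z.im..0, f (x + y * I)) +
      (∫ y in (0 : ℝ)..w.im, f (x + y * I)) = ∫ y in z.im..w.im, f (x + y * I) := fun x hx =>
    intervalIntegral.integral_add_adjacent_intervals
      ((hvert x hx).mono_set (uIcc_subset_uIcc left_mem_uIcc h0'))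
      ((hvert x hx).mono_set (uIcc_subset_uIcc h0' right_mem_uIcc))
  have el := split z.re left_mem_uIcc
  have er := split w.re right_mem_uIcc
  rw [wedgeIntegral_add_wedgeIntegral_eq] at e1 e2 ⊢
  simp only [ofReal_re, ofReal_im, ofReal_zero, smul_eq_mul] at e1 e2 ⊢
  linear_combination e1 + e2 - I * er + I * el

theorem tendsto_mul_const_nhdsGT_nhdsNE {y : ℝ} (hy : y ≠ 0) :
    Tendsto (fun s : ℝ => s * y) (𝓝[>] 0) (𝓝[≠] 0) :=
  tendsto_nhdsWithin_iff.2
    ⟨((continuous_mul_const y).tendsto' _ _ (zero_mul y)).mono_left nhdsWithin_le_nhds,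
      eventually_mem_nhdsWithin.mono fun _ hs => mul_ne_zero (ne_of_gt hs) hy⟩

theorem intervalIntegrable_vertical (hd : ∀ z : ℂ, z.im ≠ 0 → DifferentiableAt ℂ h z)
    (hb : ∀ z, ‖h z‖ ≤ C) (x u v : ℝ) :
    IntervalIntegrable (fun y : ℝ => h (x + y * I)) volume u v := by
  refine intervalIntegrable_const (c := C).mono_fun' (AEStronglyMeasurable.restrict ?_)
    (ae_of_all _ fun y => hb _)
  have hcont : ContinuousOn (fun y : ℝ => h (x + y * I)) {0}ᶜ := fun y hy =>
    (ContinuousAt.comp (f := fun y : ℝ => (x + y * I : ℂ))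
      (hd _ (by simpa using hy)).continuousAt (by fun_prop)).continuousWithinAt
  have := hcont.aestronglyMeasurable (μ := volume) (measurableSet_singleton (0 : ℝ)).compl
  rwa [Measure.restrict_eq_self_of_ae_mem (by simp [ae_iff])] at this

theorem continuous_horizontal (hd : ∀ z : ℂ, z.im ≠ 0 → DifferentiableAt ℂ h z)
    {y : ℝ} (hy : y ≠ 0) : Continuous fun x : ℝ => h (x + y * I) :=
  continuous_iff_continuousAt.2 fun x =>
    ContinuousAt.comp (f := fun x : ℝ => (x + y * I : ℂ))
      (hd _ (by simpa using hy)).continuousAt (by fun_prop)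

theorem intervalIntegrable_real (hd : ∀ z : ℂ, z.im ≠ 0 → DifferentiableAt ℂ h z)
    (hb : ∀ z, ‖h z‖ ≤ C)
    (hl : ∀ᵐ x : ℝ, x ∈ Ioo a b → Tendsto (fun y : ℝ => h (x + y * I)) (𝓝[≠] 0) (𝓝 (h x)))
    {u v : ℝ} (hu : u ∈ Ioo a b) (hv : v ∈ Ioo a b) :
    IntervalIntegrable (fun x : ℝ => h x) volume u v := by
  refine intervalIntegrable_const (c := C).mono_fun' ?_ (ae_of_all _ fun y => hb _)
  refine aestronglyMeasurable_of_tendsto_ae atTop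
    (f := fun (n : ℕ) (x : ℝ) => h (x + (1 / ((n : ℝ) + 1) : ℝ) * I))
    (fun n => (continuous_horizontal hd (by positivity)).aestronglyMeasurable) ?_
  rw [ae_restrict_iff' measurableSet_uIoc]
  filter_upwards [hl] with x hx hxm
  refine (hx (ordConnected_Ioo.uIcc_subset hu hv (uIoc_subset_uIcc hxm))).comp
    (tendsto_nhdsWithin_iff.2 ⟨tendsto_one_div_add_atTop_nhds_zero_nat, .of_forall fun n => ?_⟩)
  have : (0 : ℝ) < 1 / ((n : ℝ) + 1) := by positivity
  exact this.ne'

theorem tendsto_horizontal_integral (hd : ∀ z : ℂ, z.im ≠ 0 → DifferentiableAt ℂ h z)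
    (hb : ∀ z, ‖h z‖ ≤ C)
    (hl : ∀ᵐ x : ℝ, x ∈ Ioo a b → Tendsto (fun y : ℝ => h (x + y * I)) (𝓝[≠] 0) (𝓝 (h x)))
    {u v : ℝ} (hu : u ∈ Ioo a b) (hv : v ∈ Ioo a b) :
    Tendsto (fun y : ℝ => ∫ x in u..v, h (x + y * I)) (𝓝[≠] 0) (𝓝 (∫ x in u..v, h x)) := by
  refine intervalIntegral.tendsto_integral_filter_of_dominated_convergence (fun _ => C) ?_
    (.of_forall fun y => ae_of_all _ fun x _ => hb _) intervalIntegrable_const ?_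
  · filter_upwards [self_mem_nhdsWithin] with y hy
    exact (continuous_horizontal hd hy).aestronglyMeasurable
  · filter_upwards [hl] with x hx hxm
    exact hx (ordConnected_Ioo.uIcc_subset hu hv (uIoc_subset_uIcc hxm))

theorem continuous_vertical_integral (hd : ∀ z : ℂ, z.im ≠ 0 → DifferentiableAt ℂ h z)
    (hb : ∀ z, ‖h z‖ ≤ C) (x y : ℝ) :
    Continuous fun c : ℝ => ∫ t in c..y, h (x + t * I) := by
  have hsymm : (fun c : ℝ => ∫ t in c..y, h (x + t * I)) = fun c => -∫ t in y..c, h (x + t * I) :=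
    funext fun c => intervalIntegral.integral_symm _ _
  rw [hsymm]
  exact (intervalIntegral.continuous_primitive
    (fun p q => intervalIntegrable_vertical hd hb x p q) y).neg

theorem integral_boundary_rect_real_eq_zero
    (hd : ∀ z : ℂ, z.im ≠ 0 → DifferentiableAt ℂ h z)
    (hb : ∀ z, ‖h z‖ ≤ C)
    (hl : ∀ᵐ x : ℝ, x ∈ Ioo a b → Tendsto (fun y : ℝ => h (x + y * I)) (𝓝[≠] 0) (𝓝 (h x)))
    {u v : ℝ} (hu : u ∈ Ioo a b) (hv : v ∈ Ioo a b) (y : ℝ) :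
    (∫ x in u..v, h x) - (∫ x in u..v, h (x + y * I))
      + I * (∫ t in (0:ℝ)..y, h (v + t * I)) - I * (∫ t in (0:ℝ)..y, h (u + t * I)) = 0 := by
  rcases eq_or_ne y 0 with rfl | hy
  · simp
  have hcauchy : ∀ s : ℝ, 0 < s →
      (∫ x in u..v, h (x + (s * y : ℝ) * I)) - (∫ x in u..v, h (x + y * I))
      + I * (∫ t in (s * y)..y, h (v + t * I)) - I * (∫ t in (s * y)..y, h (u + t * I)) = 0 := by
    intro s hs
    have := integral_boundary_rect_eq_zero_of_differentiableOn h (u + (s * y : ℝ) * I) (v + y * I)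
      fun z hz => (hd z ?_).differentiableWithinAt
    · simpa [smul_eq_mul] using this
    · have hz_im : z.im ∈ uIcc (s * y) y := by simpa using hz.2
      rcases hy.lt_or_gt with hy | hy
      · exact (hz_im.2.trans_lt (max_lt (mul_neg_of_pos_of_neg hs hy) hy)).ne
      · exact ((lt_min (mul_pos hs hy) hy).trans_le hz_im.1).ne'
  have hscale := tendsto_mul_const_nhdsGT_nhdsNE hy
  have hhor := (tendsto_horizontal_integral hd hb hl hu hv).comp hscale
  have hvert : ∀ x : ℝ, Tendsto (fun s : ℝ => ∫ t in (s * y)..y, h (x + t * I)) (𝓝[>] 0)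
      (𝓝 (∫ t in (0:ℝ)..y, h (x + t * I))) := fun x =>
    ((continuous_vertical_integral hd hb x y).tendsto 0).comp
      (hscale.mono_right nhdsWithin_le_nhds)
  refine tendsto_nhds_unique (((hhor.sub_const (∫ x in u..v, h (x + y * I))).add
    ((hvert v).const_mul I)).sub ((hvert u).const_mul I)) (tendsto_const_nhds.congr' ?_)
  filter_upwards [self_mem_nhdsWithin] with s hs using (hcauchy s hs).symm

theorem norm_wedgeIntegral_le (hb : ∀ z, ‖h z‖ ≤ C) (z w : ℂ) :
    ‖wedgeIntegral z w h‖ ≤ 2 * C * ‖w - z‖ := by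
  have hC : 0 ≤ C := (norm_nonneg _).trans (hb 0)
  have hre : ‖∫ x in z.re..w.re, h (x + z.im * I)‖ ≤ C * |w.re - z.re| :=
    intervalIntegral.norm_integral_le_of_norm_le_const fun x _ => hb _
  have him : ‖I • ∫ y in z.im..w.im, h (w.re + y * I)‖ ≤ C * |w.im - z.im| := by
    rw [norm_smul, norm_I, one_mul]
    exact intervalIntegral.norm_integral_le_of_norm_le_const fun x _ => hb _
  have hwre := mul_le_mul_of_nonneg_left (abs_re_le_norm (w - z)) hC
  have hwim := mul_le_mul_of_nonneg_left (abs_im_le_norm (w - z)) hC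
  rw [sub_re] at hwre
  rw [sub_im] at hwim
  exact (norm_add_le _ _).trans (by linarith)

theorem hasDerivAt_of_sub_eq_wedgeIntegral {S : Set ℂ} (hS : IsOpen S) {Φ : ℂ → ℂ}
    (hd : ∀ z : ℂ, z.im ≠ 0 → DifferentiableAt ℂ h z)
    (hΦ : ∀ z ∈ S, ∀ w ∈ S, Φ w - Φ z = wedgeIntegral z w h) {z : ℂ} (hz : z ∈ S)
    (hz0 : z.im ≠ 0) : HasDerivAt Φ (h z) z := by
  obtain ⟨ε, hε, hball⟩ := Metric.isOpen_iff.1 isOpen_im_ne_zero z hz0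
  have hdiff : DifferentiableOn ℂ h (Metric.ball z ε) :=
    fun w hw => (hd w (hball hw)).differentiableWithinAt
  refine ((hdiff.isConservativeOn.hasDerivAt_wedgeIntegral hdiff.continuousOn
    (Metric.mem_ball_self hε)).const_add (Φ z)).congr_of_eventuallyEq ?_
  filter_upwards [hS.mem_nhds hz] with w hw
  rw [← hΦ z hz w hw, add_sub_cancel]

theorem exists_primitive_strip (hd : ∀ z : ℂ, z.im ≠ 0 → DifferentiableAt ℂ h z)
    (hb : ∀ z, ‖h z‖ ≤ C)
    (hl : ∀ᵐ x : ℝ, x ∈ Ioo a b → Tendsto (fun y : ℝ => h (x + y * I)) (𝓝[≠] 0) (𝓝 (h x))) :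
    ∃ Φ : ℂ → ℂ, DifferentiableOn ℂ Φ {z | z.re ∈ Ioo a b} ∧
      ∀ z : ℂ, z.re ∈ Ioo a b → z.im ≠ 0 → HasDerivAt Φ (h z) z := by
  rcases (Ioo a b).eq_empty_or_nonempty with hempty | ⟨x₀, hx₀⟩
  · exact ⟨0, by simp [hempty], by simp [hempty]⟩
  have hopen : IsOpen {z : ℂ | z.re ∈ Ioo a b} := isOpen_Ioo.preimage continuous_re
  set Φ : ℂ → ℂ := fun z => (∫ x in x₀..z.re, h x) + I * ∫ y in (0:ℝ)..z.im, h (z.re + y * I)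
    with hΦ
  have hwedge : ∀ z ∈ {z : ℂ | z.re ∈ Ioo a b}, ∀ w ∈ {z : ℂ | z.re ∈ Ioo a b},
      Φ w - Φ z = wedgeIntegral z w h := by
    intro z hz w hw
    have hrect := integral_boundary_rect_real_eq_zero hd hb hl hz hw z.im
    have hhor : (∫ x in x₀..w.re, h x) - (∫ x in x₀..z.re, h x) = ∫ x in z.re..w.re, h x :=
      intervalIntegral.integral_interval_sub_left
        (intervalIntegrable_real hd hb hl hx₀ hw) (intervalIntegrable_real hd hb hl hx₀ hz)
    have hvert : (∫ y in (0:ℝ)..w.im, h (w.re + y * I)) - (∫ y in (0:ℝ)..z.im, h (w.re + y * I))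
        = ∫ y in z.im..w.im, h (w.re + y * I) :=
      intervalIntegral.integral_interval_sub_left
        (intervalIntegrable_vertical hd hb _ _ _) (intervalIntegrable_vertical hd hb _ _ _)
    simp only [hΦ, wedgeIntegral, smul_eq_mul, ← hvert]
    linear_combination hrect + hhor
  have hderiv : ∀ z ∈ {z : ℂ | z.re ∈ Ioo a b}, z.im ≠ 0 → HasDerivAt Φ (h z) z :=
    fun z => hasDerivAt_of_sub_eq_wedgeIntegral hopen hd hwedge
  have hC : 0 ≤ C := (norm_nonneg _).trans (hb 0)
  have hlip : LipschitzOnWith ⟨2 * C, by positivity⟩ Φ {z | z.re ∈ Ioo a b} :=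
    LipschitzOnWith.of_dist_le_mul fun w hw z hz => by
      rw [dist_eq_norm, dist_eq_norm, hwedge z hz w hw]
      exact norm_wedgeIntegral_le hb z w
  exact ⟨Φ, differentiableOn_of_continuousOn_of_im_ne_zero hopen hlip.continuousOn
    fun z hz hz0 => (hderiv z hz hz0).differentiableAt, hderiv⟩

theorem exists_boundary_extension (hb : ∀ z : ℂ, z.im ≠ 0 → ‖h z‖ ≤ C)
    (hl : ∀ᵐ x : ℝ, x ∈ Ioo a b → ∃ l, Tendsto (fun y : ℝ => h (x + y * I)) (𝓝[≠] 0) (𝓝 l)) :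
    ∃ k : ℂ → ℂ, (∀ z : ℂ, z.im ≠ 0 → k z = h z) ∧ (∀ z, ‖k z‖ ≤ C) ∧
      ∀ᵐ x : ℝ, x ∈ Ioo a b → Tendsto (fun y : ℝ => k (x + y * I)) (𝓝[≠] 0) (𝓝 (k x)) := by
  classical
  set k : ℂ → ℂ := fun z => if z.im ≠ 0 then h z else
    if hz : ∃ l, Tendsto (fun y : ℝ => h (z.re + y * I)) (𝓝[≠] 0) (𝓝 l) then hz.choose else 0
    with hk
  have hkh : ∀ z : ℂ, z.im ≠ 0 → k z = h z := fun z hz => if_pos hz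
  have hlim : ∀ x : ℝ, (∃ l, Tendsto (fun y : ℝ => h (x + y * I)) (𝓝[≠] 0) (𝓝 l)) →
      Tendsto (fun y : ℝ => h (x + y * I)) (𝓝[≠] 0) (𝓝 (k x)) := by
    intro x hx
    simpa [hk, hx] using hx.choose_spec
  refine ⟨k, hkh, fun z => ?_, ?_⟩
  · by_cases hz : z.im = 0
    · obtain ⟨x, rfl⟩ : ∃ x : ℝ, (x : ℂ) = z := ⟨z.re, Complex.ext rfl hz.symm⟩
      by_cases hx : ∃ l, Tendsto (fun y : ℝ => h (x + y * I)) (𝓝[≠] 0) (𝓝 l)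
      · refine le_of_tendsto (hlim x hx).norm ?_
        filter_upwards [self_mem_nhdsWithin] with y hy
        exact hb _ (by simpa using hy)
      · simpa [hk, hx] using (norm_nonneg _).trans (hb I (by simp))
    · exact (hkh z hz).symm ▸ hb z hz
  · filter_upwards [hl] with x hx hxm
    refine (hlim x (hx hxm)).congr' ?_
    filter_upwards [self_mem_nhdsWithin] with y hy
    exact (hkh _ (by simpa using hy)).symm

-- The primitive of `h` is continuous across the interval, hence holomorphic there by Morera's
-- theorem, and its derivative continues `h`.
theorem exists_holomorphic_gluing
    (hd : ∀ z : ℂ, z.im ≠ 0 → DifferentiableAt ℂ h z)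
    (hb : ∀ z : ℂ, z.im ≠ 0 → ‖h z‖ ≤ C)
    (hl : ∀ᵐ x : ℝ, x ∈ Ioo a b → ∃ l, Tendsto (fun y : ℝ => h (x + y * I)) (𝓝[≠] 0) (𝓝 l)) :
    ∃ E : ℂ → ℂ, (∀ z : ℂ, z.im ≠ 0 → E z = h z) ∧
      ∀ z : ℂ, (z.im ≠ 0 ∨ z.re ∈ Ioo a b) → DifferentiableAt ℂ E z := by
  classical
  obtain ⟨k, hkh, hkb, hkl⟩ := exists_boundary_extension hb hl
  have hkd : ∀ z : ℂ, z.im ≠ 0 → DifferentiableAt ℂ k z := fun z hz =>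
    (hd z hz).congr_of_eventuallyEq ((isOpen_im_ne_zero.eventually_mem hz).mono hkh)
  obtain ⟨Φ, hΦ, hΦ'⟩ := exists_primitive_strip hkd hkb hkl
  set E : ℂ → ℂ := fun z => if z.im = 0 then deriv Φ z else h z
  have hEh : ∀ z : ℂ, z.im ≠ 0 → E z = h z := fun z hz => if_neg hz
  refine ⟨E, hEh, fun z hz => ?_⟩
  by_cases hz0 : z.im = 0
  · have hopen : IsOpen {z : ℂ | z.re ∈ Ioo a b} := isOpen_Ioo.preimage continuous_re
    have hzr : z.re ∈ Ioo a b := hz.resolve_left (not_not.2 hz0)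
    refine ((hΦ.deriv hopen).differentiableAt (hopen.mem_nhds hzr)).congr_of_eventuallyEq ?_
    filter_upwards [hopen.mem_nhds hzr] with w hw
    by_cases hw0 : w.im = 0
    · exact if_pos hw0
    · rw [hEh w hw0, (hΦ' w hw hw0).deriv, hkh w hw0]
  · exact (hd z hz0).congr_of_eventuallyEq ((isOpen_im_ne_zero.eventually_mem hz0).mono hEh)

end Gluing

noncomputable section Herglotz

open Complex Set InnerProductSpace

theorem poissonKernel_mul_left {c w z : ℂ} (hc : c ≠ 0) :
    poissonKernel 0 (c * w) (c * z) = poissonKernel 0 w z := by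
  have hc' : ‖c‖ ^ 2 ≠ 0 := pow_ne_zero _ (norm_ne_zero_iff.2 hc)
  simp only [poissonKernel_def, sub_zero, ← mul_sub, norm_mul, mul_pow]
  exact mul_div_mul_left _ _ hc'

theorem continuous_poissonKernel_circleMap {w : ℂ} (hw : ‖w‖ < 1) :
    Continuous fun θ => poissonKernel 0 w (circleMap 0 1 θ) := by
  simp only [poissonKernel_def, sub_zero]
  refine Continuous.div (by fun_prop) (by fun_prop) fun θ => ?_
  refine pow_ne_zero _ (norm_ne_zero_iff.2 (sub_ne_zero.2 fun h => ?_))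
  simp [← h] at hw

theorem exists_norm_poissonKernel_circleMap_le {w : ℂ} (hw : ‖w‖ < 1) :
    ∃ C, ∀ θ, ‖poissonKernel 0 w (circleMap 0 1 θ)‖ ≤ C := by
  have hper : Function.Periodic (fun θ => poissonKernel 0 w (circleMap 0 1 θ)) (2 * Real.pi) :=
    (periodic_circleMap 0 1).comp (poissonKernel 0 w)
  obtain ⟨C, hC⟩ := (hper.isBounded_of_continuous (by positivity)
    (continuous_poissonKernel_circleMap hw)).exists_norm_le
  exact ⟨C, fun θ => hC _ (mem_range_self θ)⟩

theorem exists_measure_integral_poissonKernel_of_closedBall {u : ℂ → ℝ} {ρ : ℝ} (hρ : 0 < ρ)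
    (hu : HarmonicOnNhd u (Metric.closedBall 0 ρ)) (hu0 : ∀ z ∈ Metric.closedBall 0 ρ, 0 ≤ u z) :
    ∃ m : FiniteMeasure ℝ, m (Icc 0 (2 * Real.pi))ᶜ = 0 ∧ ∀ w : ℂ, ‖w‖ < 1 →
      ∫ θ, poissonKernel 0 w (circleMap 0 1 θ) ∂m = u (ρ * w) := by
  have hcircle : ∀ θ, circleMap 0 ρ θ ∈ Metric.closedBall (0 : ℂ) ρ := fun θ =>
    circleMap_mem_closedBall 0 hρ.le θ
  set d : ℝ → ℝ := fun θ => (2 * Real.pi)⁻¹ * u (circleMap 0 ρ θ) with hd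
  have hd0 : ∀ θ, 0 ≤ d θ := fun θ => mul_nonneg (by positivity) (hu0 _ (hcircle θ))
  have hdc : Continuous d := continuous_const.mul <| continuous_iff_continuousAt.2 fun θ =>
    ((hu _ (hcircle θ)).1.continuousAt).comp (continuous_circleMap 0 ρ).continuousAt
  set m : Measure ℝ :=
    (volume.restrict (Ioc 0 (2 * Real.pi))).withDensity fun θ => ENNReal.ofReal (d θ) with hm
  have hmfin : IsFiniteMeasure m :=
    isFiniteMeasure_withDensity_ofReal (hdc.intervalIntegrable 0 (2 * Real.pi)).1.2
  have hsupp : m (Icc 0 (2 * Real.pi))ᶜ = 0 := by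
    refine withDensity_absolutelyContinuous _ _ ?_
    rw [Measure.restrict_apply measurableSet_Icc.compl, inter_comm, ← sdiff_eq,
      sdiff_eq_empty.2 Ioc_subset_Icc_self, measure_empty]
  refine ⟨⟨m, hmfin⟩, (FiniteMeasure.null_iff_toMeasure_null _ _).2 hsupp, fun w hw => ?_⟩
  have hρw : (ρ : ℂ) * w ∈ Metric.ball 0 ρ := by
    simpa [abs_of_pos hρ] using mul_lt_of_lt_one_right hρ hw
  have hscale : ∀ θ, circleMap 0 ρ θ = ρ * circleMap 0 1 θ := fun θ => by simp [circleMap]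
  rw [← hu.circleAverage_poissonKernel_smul hρw, Real.circleAverage_def,
    intervalIntegral.integral_of_le (by positivity), FiniteMeasure.toMeasure_mk, hm,
    integral_withDensity_eq_integral_toReal_smul (by fun_prop) (by simp), ← integral_smul]
  refine integral_congr_ae (ae_of_all _ fun θ => ?_)
  simp only [Pi.smul_apply', smul_eq_mul, ENNReal.toReal_ofReal (hd0 θ)]
  simp only [hd, hscale, poissonKernel_mul_left (ofReal_ne_zero.2 hρ.ne')]
  ring

theorem exists_finiteMeasure_integral_eq_of_tendsto {ι X : Type*} [MeasurableSpace X]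
    [TopologicalSpace X] [T2Space X] [BorelSpace X] {K : Set X} (hK : IsCompact K)
    {l : Filter ι} [l.NeBot] {m : ι → FiniteMeasure X} {C : NNReal} (hm : ∀ i, (m i).mass ≤ C)
    (hmK : ∀ i, m i Kᶜ = 0) :
    ∃ μ : FiniteMeasure X, ∀ (φ : BoundedContinuousFunction X ℝ) (L : ℝ),
      Tendsto (fun i => ∫ x, φ x ∂(m i)) l (𝓝 L) → ∫ x, φ x ∂μ = L := by
  have hmem : ∀ᶠ i in Ultrafilter.of l, m i ∈ {μ : FiniteMeasure X | μ.mass ≤ C ∧ μ Kᶜ = 0} :=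
    Eventually.of_forall fun i => ⟨hm i, hmK i⟩
  obtain ⟨μ, -, hμ⟩ := (isCompact_setOfPred_finiteMeasure_le_of_isCompact C
    hK).ultrafilter_le_nhds ((Ultrafilter.of l).map m) (le_principal_iff.2 hmem)
  have hlim : Tendsto m (Ultrafilter.of l) (𝓝 μ) := hμ
  rw [FiniteMeasure.tendsto_iff_forall_integral_tendsto] at hlim
  exact ⟨μ, fun φ L hL => tendsto_nhds_unique (hlim φ) (hL.mono_left (Ultrafilter.of_le l))⟩

theorem exists_measure_integral_poissonKernel {u : ℂ → ℝ}
    (hu : HarmonicOnNhd u (Metric.ball 0 1)) (hu0 : ∀ w ∈ Metric.ball 0 1, 0 ≤ u w) :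
    ∃ μ : FiniteMeasure ℝ, ∀ w : ℂ, ‖w‖ < 1 →
      u w = ∫ θ, poissonKernel 0 w (circleMap 0 1 θ) ∂μ := by
  obtain ⟨ρ, -, hρ, hρt⟩ := exists_seq_strictMono_tendsto' (zero_lt_one (α := ℝ))
  have hsub : ∀ n, Metric.closedBall (0 : ℂ) (ρ n) ⊆ Metric.ball 0 1 := fun n =>
    Metric.closedBall_subset_ball (hρ n).2
  choose m hm hmu using fun n => exists_measure_integral_poissonKernel_of_closedBall (hρ n).1
    (hu.mono (hsub n)) fun z hz => hu0 z (hsub n hz)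
  have hmass : ∀ n, (m n).mass ≤ Real.toNNReal (u 0) := fun n => by
    have h0 := hmu n 0 (by simp)
    simp only [poissonKernel_def, sub_zero, norm_circleMap_zero, norm_zero, abs_one, integral_const,
      mul_zero, smul_eq_mul] at h0
    rw [← NNReal.coe_le_coe, Real.coe_toNNReal _ (hu0 0 (by simp)), ← h0]
    norm_num
  obtain ⟨μ, hμ⟩ := exists_finiteMeasure_integral_eq_of_tendsto isCompact_Icc (l := atTop) hmass hm
  refine ⟨μ, fun w hw => ?_⟩
  obtain ⟨C, hC⟩ := exists_norm_poissonKernel_circleMap_le hw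
  refine (hμ (.ofNormedAddCommGroup _ (continuous_poissonKernel_circleMap hw) C hC) _ ?_).symm
  simp only [BoundedContinuousFunction.coe_ofNormedAddCommGroup, hmu _ w hw]
  have hw' : w ∈ Metric.ball (0 : ℂ) 1 := by simpa using hw
  refine (hu w hw').1.continuousAt.tendsto.comp ?_
  simpa using ((continuous_ofReal.tendsto 1).comp hρt).mul_const w

/-- The Cayley transform of the upper half plane onto the unit disc. -/
def cayley (z : ℂ) : ℂ := (z - I) / (z + I)

/-- The inverse of the Cayley transform. -/
def cayleyInv (w : ℂ) : ℂ := I * (1 + w) / (1 - w)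

theorem add_I_ne_zero_of_im_pos {z : ℂ} (hz : 0 < z.im) : z + I ≠ 0 := fun h => by
  have him := congrArg Complex.im h
  rw [add_im, I_im, zero_im] at him
  linarith

theorem one_sub_norm_cayley_sq {z : ℂ} (hz : z + I ≠ 0) :
    1 - ‖cayley z‖ ^ 2 = 4 * z.im / ‖z + I‖ ^ 2 := by
  have hn : ‖z + I‖ ^ 2 ≠ 0 := pow_ne_zero _ (norm_ne_zero_iff.2 hz)
  rw [cayley, norm_div, div_pow, eq_div_iff hn, sub_mul, div_mul_cancel₀ _ hn, one_mul,
    Complex.sq_norm, Complex.sq_norm, normSq_apply, normSq_apply]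
  simp only [add_re, add_im, sub_re, sub_im, I_re, I_im]
  ring

theorem norm_cayley_lt_one {z : ℂ} (hz : 0 < z.im) : ‖cayley z‖ < 1 := by
  have hne := add_I_ne_zero_of_im_pos hz
  have hpos : 0 < 1 - ‖cayley z‖ ^ 2 := by
    rw [one_sub_norm_cayley_sq hne]
    have := norm_pos_iff.2 hne
    positivity
  nlinarith [norm_nonneg (cayley z)]

theorem one_sub_ne_zero_of_norm_lt_one {w : ℂ} (hw : ‖w‖ < 1) : 1 - w ≠ 0 := fun h => by
  rw [← sub_eq_zero.1 h, norm_one] at hw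
  exact lt_irrefl _ hw

theorem cayleyInv_cayley {z : ℂ} (hz : z + I ≠ 0) : cayleyInv (cayley z) = z := by
  have hsub : 1 - cayley z = 2 * I / (z + I) := by
    rw [cayley, eq_div_iff hz, sub_mul, div_mul_cancel₀ _ hz]; ring
  have hadd : 1 + cayley z = 2 * z / (z + I) := by
    rw [cayley, eq_div_iff hz, add_mul, div_mul_cancel₀ _ hz]; ring
  rw [cayleyInv, hsub, hadd]
  field_simp [I_ne_zero]

theorem im_cayleyInv_pos {w : ℂ} (hw : ‖w‖ < 1) : 0 < (cayleyInv w).im := by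
  have hden : 0 < normSq (1 - w) := normSq_pos.2 (one_sub_ne_zero_of_norm_lt_one hw)
  have hw2 : normSq w < 1 := by
    rw [← Complex.sq_norm]; nlinarith [norm_nonneg w]
  have him : (cayleyInv w).im = (1 - normSq w) / normSq (1 - w) := by
    simp only [cayleyInv, div_im, normSq_apply, mul_re, mul_im, I_re, I_im, add_re, add_im, one_re,
      one_im, sub_re, sub_im]
    ring
  rw [him]
  exact div_pos (by linarith) hden

theorem differentiableAt_cayleyInv {w : ℂ} (hw : ‖w‖ < 1) : DifferentiableAt ℂ cayleyInv w :=
  DifferentiableAt.div (by fun_prop) (by fun_prop) (one_sub_ne_zero_of_norm_lt_one hw)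

theorem cos_add_mul_sin_ne_zero {z : ℂ} (hz : 0 < z.im) (θ : ℝ) :
    (Real.cos θ : ℂ) + z * Real.sin θ ≠ 0 := fun h => by
  have him := congrArg Complex.im h
  have hre := congrArg Complex.re h
  simp only [add_im, ofReal_im, mul_im, ofReal_re, zero_add, zero_im, mul_zero,
    add_re, mul_re, sub_zero, zero_re] at him hre
  have hsin : Real.sin θ = 0 := (mul_eq_zero.1 him).resolve_left hz.ne'
  have hcos : Real.cos θ = 0 := by simpa [hsin] using hre
  simpa [hsin, hcos] using Real.sin_sq_add_cos_sq θ

theorem circleMap_two_mul_sub_cayley {z : ℂ} (hz : z + I ≠ 0) (θ : ℝ) :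
    circleMap 0 1 (2 * θ) - cayley z =
      2 * I * exp (θ * I) * ((Real.cos θ : ℂ) + z * Real.sin θ) / (z + I) := by
  have hsq : exp ((2 * θ : ℝ) * I) = exp (θ * I) ^ 2 := by
    rw [sq, ← exp_add]; push_cast; ring_nf
  have hexp : exp (θ * I) = Real.cos θ + Real.sin θ * I := by
    rw [exp_mul_I, ofReal_cos, ofReal_sin]
  have hone : (Real.sin θ : ℂ) ^ 2 + (Real.cos θ : ℂ) ^ 2 = 1 := by
    exact_mod_cast Real.sin_sq_add_cos_sq θ
  rw [cayley, circleMap, eq_div_iff hz, sub_mul, div_mul_cancel₀ _ hz, hsq, hexp]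
  simp only [ofReal_one, one_mul, zero_add]
  linear_combination (z - I) * hone
    + (-(Real.sin θ : ℂ) ^ 2 * z + (Real.sin θ : ℂ) ^ 2 * I) * I_sq

theorem poissonKernel_cayley {z : ℂ} (hz : 0 < z.im) (θ : ℝ) :
    poissonKernel 0 (cayley z) (circleMap 0 1 (2 * θ)) =
      z.im / ‖(Real.cos θ : ℂ) + z * Real.sin θ‖ ^ 2 := by
  have hne := add_I_ne_zero_of_im_pos hz
  have hden := norm_ne_zero_iff.2 (cos_add_mul_sin_ne_zero hz θ)
  have hn := norm_ne_zero_iff.2 hne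
  simp only [poissonKernel_def, sub_zero, circleMap_two_mul_sub_cayley hne, norm_circleMap_zero,
    abs_one, one_pow, one_sub_norm_cayley_sq hne, norm_div, norm_mul, norm_I,
    norm_exp_ofReal_mul_I, mul_one, RCLike.norm_ofNat]
  field_simp
  norm_num

theorem exists_cayley_measure {M : ℂ → ℂ} (hM : ∀ z : ℂ, 0 < z.im → DifferentiableAt ℂ M z)
    (hpos : ∀ z : ℂ, 0 < z.im → 0 ≤ (M z).im) :
    ∃ μ : FiniteMeasure ℝ, ∀ z : ℂ, 0 < z.im →
      (M z).im = ∫ θ, poissonKernel 0 (cayley z) (circleMap 0 1 θ) ∂μ := by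
  have hball : ∀ w ∈ Metric.ball (0 : ℂ) 1, ‖w‖ < 1 := fun w => by simp
  have hdiff : DifferentiableOn ℂ (M ∘ cayleyInv) (Metric.ball 0 1) := fun w hw =>
    ((hM _ (im_cayleyInv_pos (hball w hw))).comp w
      (differentiableAt_cayleyInv (hball w hw))).differentiableWithinAt
  obtain ⟨μ, hμ⟩ := exists_measure_integral_poissonKernel
    (fun w hw => (hdiff.analyticAt (Metric.isOpen_ball.mem_nhds hw)).harmonicAt_im)
    (fun w hw => hpos _ (im_cayleyInv_pos (hball w hw)))
  refine ⟨μ, fun z hz => ?_⟩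
  rw [← hμ _ (norm_cayley_lt_one hz), Function.comp_apply,
    cayleyInv_cayley (add_I_ne_zero_of_im_pos hz)]

theorem one_add_sq_div_le {z : ℂ} (hz : 0 < z.im) (t : ℝ) :
    ‖(1 + t ^ 2) / ‖(t : ℂ) - z‖ ^ 2‖ ≤ 2 + (1 + 2 * z.re ^ 2) / z.im ^ 2 := by
  have hnorm : ‖(t : ℂ) - z‖ ^ 2 = (t - z.re) ^ 2 + z.im ^ 2 := by
    rw [Complex.sq_norm, normSq_apply, sub_re, sub_im, ofReal_re, ofReal_im]; ring
  have hden : 0 < (t - z.re) ^ 2 + z.im ^ 2 := by positivity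
  rw [Real.norm_of_nonneg (by positivity), hnorm, div_le_iff₀ hden]
  have hexpand : (2 + (1 + 2 * z.re ^ 2) / z.im ^ 2) * ((t - z.re) ^ 2 + z.im ^ 2) =
    2 * (t - z.re) ^ 2 + 2 * z.im ^ 2 + (1 + 2 * z.re ^ 2)
      + (1 + 2 * z.re ^ 2) / z.im ^ 2 * (t - z.re) ^ 2 := by
    field_simp; ring
  have hrest : 0 ≤ (1 + 2 * z.re ^ 2) / z.im ^ 2 * (t - z.re) ^ 2 := by positivity
  rw [hexpand]
  nlinarith [sq_nonneg (t - 2 * z.re)]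

theorem measurable_herglotz_kernel (z : ℂ) :
    Measurable fun t : ℝ => (1 + t ^ 2) / ‖(t : ℂ) - z‖ ^ 2 := by
  fun_prop

theorem integrable_herglotz_kernel {z : ℂ} (hz : 0 < z.im) (ν : Measure ℝ) [IsFiniteMeasure ν] :
    Integrable (fun t : ℝ => (1 + t ^ 2) / ‖(t : ℂ) - z‖ ^ 2) ν :=
  Integrable.of_bound (measurable_herglotz_kernel z).aestronglyMeasurable _
    (ae_of_all _ (one_add_sq_div_le hz))

theorem poissonKernel_cayley_of_sin_eq_zero {z : ℂ} (hz : 0 < z.im) {θ : ℝ}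
    (hsin : Real.sin θ = 0) :
    poissonKernel 0 (cayley z) (circleMap 0 1 (2 * θ)) = z.im := by
  have hcos : Real.cos θ ^ 2 = 1 := by
    simpa [hsin] using Real.sin_sq_add_cos_sq θ
  rw [poissonKernel_cayley hz, hsin, ofReal_zero, mul_zero, add_zero, Complex.norm_real,
    Real.norm_eq_abs, sq_abs, hcos, div_one]

theorem poissonKernel_cayley_of_sin_ne_zero {z : ℂ} (hz : 0 < z.im) {θ : ℝ}
    (hsin : Real.sin θ ≠ 0) :
    poissonKernel 0 (cayley z) (circleMap 0 1 (2 * θ)) =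
      z.im * ((1 + (-Real.cot θ) ^ 2) / ‖((-Real.cot θ : ℝ) : ℂ) - z‖ ^ 2) := by
  have hsinC : (Real.sin θ : ℂ) ≠ 0 := ofReal_ne_zero.2 hsin
  have hden := norm_ne_zero_iff.2 (cos_add_mul_sin_ne_zero hz θ)
  have hsub : ((-Real.cot θ : ℝ) : ℂ) - z =
      -((Real.cos θ : ℂ) + z * Real.sin θ) / (Real.sin θ : ℂ) := by
    rw [Real.cot_eq_cos_div_sin, ofReal_neg, ofReal_div]
    field_simp
    ring
  have hadd : 1 + (-Real.cot θ) ^ 2 = 1 / Real.sin θ ^ 2 := by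
    have := Real.sin_sq_add_cos_sq θ
    rw [Real.cot_eq_cos_div_sin]
    field_simp
    linarith
  rw [poissonKernel_cayley hz, hsub, hadd, norm_div, norm_neg, Complex.norm_real, Real.norm_eq_abs,
    div_pow, sq_abs]
  field_simp

/-- `(B, ν)` is the Herglotz representation of `M`. With this normalization the weight `1 + t²`
turns the usual Herglotz measure into the finite measure `ν`; only `Im M` is represented, which
determines `M` up to a real constant. -/
structure IsHerglotzRep (M : ℂ → ℂ) (B : ℝ) (ν : Measure ℝ) : Prop where
  isFiniteMeasure : IsFiniteMeasure ν
  nonneg : 0 ≤ B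
  im_eq : ∀ z : ℂ, 0 < z.im →
    (M z).im = z.im * (B + ∫ t : ℝ, (1 + t ^ 2) / ‖(t : ℂ) - z‖ ^ 2 ∂ν)

-- The map `θ ↦ -cot (θ / 2)` carries the circle minus the point `1` to the real line; the mass of
-- the point `1`, which corresponds to `∞`, becomes the linear term `B`.
theorem exists_herglotz_measure {M : ℂ → ℂ} (hM : ∀ z : ℂ, 0 < z.im → DifferentiableAt ℂ M z)
    (hpos : ∀ z : ℂ, 0 < z.im → 0 ≤ (M z).im) :
    ∃ (B : ℝ) (ν : Measure ℝ), IsHerglotzRep M B ν := by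
  obtain ⟨μ, hμ⟩ := exists_cayley_measure hM hpos
  set A : Set ℝ := {θ | Real.sin (θ / 2) = 0}
  have hA : MeasurableSet A := (isClosed_eq (by fun_prop) continuous_const).measurableSet
  set τ : ℝ → ℝ := fun θ => -Real.cot (θ / 2)
  have hτ : Measurable τ := by
    simp only [τ, Real.cot_eq_cos_div_sin]
    fun_prop
  refine ⟨(μ : Measure ℝ).real A, ((μ : Measure ℝ).restrict Aᶜ).map τ, inferInstance,
    measureReal_nonneg, fun z hz => ?_⟩
  have hw := norm_cayley_lt_one hz
  obtain ⟨C, hC⟩ := exists_norm_poissonKernel_circleMap_le hw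
  have hint : Integrable (fun θ => poissonKernel 0 (cayley z) (circleMap 0 1 θ)) μ :=
    .of_bound (continuous_poissonKernel_circleMap hw).aestronglyMeasurable C (ae_of_all _ hC)
  rw [hμ z hz, ← integral_add_compl hA hint, mul_add]
  have hhalf : ∀ θ : ℝ, 2 * (θ / 2) = θ := fun θ => by ring
  congr 1
  · have hconst : ∀ θ ∈ A, poissonKernel 0 (cayley z) (circleMap 0 1 θ) = z.im := fun θ hθ => by
      simpa only [hhalf] using poissonKernel_cayley_of_sin_eq_zero hz hθ
    rw [setIntegral_congr_fun hA hconst, setIntegral_const, smul_eq_mul, mul_comm]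
  · rw [integral_map hτ.aemeasurable (measurable_herglotz_kernel z).aestronglyMeasurable,
      ← integral_const_mul]
    refine setIntegral_congr_fun hA.compl fun θ hθ => ?_
    simpa only [hhalf] using poissonKernel_cayley_of_sin_ne_zero hz hθ

end Herglotz

section HerglotzMoments

open Complex Set

/-- The part of the punctured real line outside `r ≤ |t| ≤ 1 / r`. -/
def gapSet (r : ℝ) : Set ℝ := {t | t ≠ 0 ∧ (|t| < r ∨ 1 / r < |t|)}

theorem mem_gapSet_of_mem_Ioo {r x : ℝ} (hx : x ∈ Ioo 0 r) : x ∈ gapSet r :=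
  ⟨hx.1.ne', .inl ((abs_of_pos hx.1).trans_lt hx.2)⟩

theorem one_div_mem_gapSet {r x : ℝ} (hx : x ∈ Ioo 0 r) : 1 / x ∈ gapSet r :=
  have hx₀ := one_div_pos.2 hx.1
  ⟨hx₀.ne', .inr ((one_div_lt_one_div_of_lt hx.1 hx.2).trans_eq (abs_of_pos hx₀).symm)⟩

theorem neg_mem_gapSet {r t : ℝ} (ht : t ∈ gapSet r) : -t ∈ gapSet r :=
  ⟨neg_ne_zero.2 ht.1, by simpa only [abs_neg] using ht.2⟩

theorem measure_Ioc_eq_zero_of_le_sq {ν : Measure ℝ} [IsFiniteMeasure ν] {a b C : ℝ}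
    (hν : ∀ s ∈ Ioo a b, ∀ t ∈ Ioo a b, s < t → ν.real (Ioc s t) ≤ C * (t - s) ^ 2)
    {s t : ℝ} (hs : s ∈ Ioo a b) (ht : t ∈ Ioo a b) : ν (Ioc s t) = 0 := by
  rcases le_total t s with hts | hst
  · rw [Ioc_eq_empty_of_le hts, measure_empty]
  set g : ℝ → ℝ := fun t => ν.real (Iic t)
  have hg : ∀ {s t : ℝ}, s ≤ t → g t - g s = ν.real (Ioc s t) := fun {s t} hst => by
    simp only [g]
    rw [← Iic_union_Ioc_eq_Iic hst, measureReal_union (Iic_disjoint_Ioc le_rfl) measurableSet_Ioc]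
    ring
  have hquad : ∀ s ∈ Ioo a b, ∀ t ∈ Ioo a b, |g t - g s| ≤ C * (t - s) ^ 2 := by
    intro s hs t ht
    rcases lt_trichotomy s t with hst | rfl | hts
    · rw [hg hst.le, abs_of_nonneg measureReal_nonneg]
      exact hν s hs t ht hst
    · simp
    · rw [abs_sub_comm, hg hts.le, abs_of_nonneg measureReal_nonneg, ← neg_sub s t, neg_sq]
      exact hν t ht s hs hts
  have hderiv : ∀ s ∈ Ioo a b, HasDerivAt g 0 s := fun s hs => by
    rw [hasDerivAt_iff_isLittleO]
    have hbig : (fun t => g t - g s - (t - s) • (0 : ℝ)) =O[𝓝 s] fun t => (t - s) ^ 2 := by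
      refine Asymptotics.IsBigO.of_bound C ?_
      filter_upwards [isOpen_Ioo.mem_nhds hs] with t ht
      simpa using hquad s hs t ht
    exact hbig.trans_isLittleO (by simpa using Asymptotics.isLittleO_pow_sub_sub s one_lt_two)
  have hconst : g t = g s := isOpen_Ioo.is_const_of_deriv_eq_zero isPreconnected_Ioo
    (fun s hs => (hderiv s hs).differentiableAt.differentiableWithinAt)
    (fun s hs => (hderiv s hs).deriv) ht hs
  rw [← measureReal_eq_zero_iff, ← hg hst, hconst, sub_self]

theorem norm_ofReal_sub_sq (s t ε : ℝ) :
    ‖(s : ℂ) - (t + ε * I)‖ ^ 2 = (s - t) ^ 2 + ε ^ 2 := by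
  rw [Complex.sq_norm, normSq_apply]
  simp
  ring

theorem norm_ofReal_sub_mul_I_sq (t y : ℝ) : ‖(t : ℂ) - y * I‖ ^ 2 = t ^ 2 + y ^ 2 := by
  simpa using norm_ofReal_sub_sq t 0 y

namespace IsHerglotzRep

variable {M : ℂ → ℂ} {B : ℝ} {ν : Measure ℝ}

theorem measureReal_Icc_le (h : IsHerglotzRep M B ν) {C t ε : ℝ} (hε : 0 < ε)
    (hC : (M (t + ε * I)).im ≤ C * ε) : ν.real (Icc (t - ε) (t + ε)) ≤ 2 * C * ε ^ 2 := by
  have := h.isFiniteMeasure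
  have hz : 0 < ((t : ℂ) + ε * I).im := by simpa using hε
  have hint := integrable_herglotz_kernel hz ν
  have him : ((t : ℂ) + ε * I).im = ε := by simp
  have hle : B + ∫ s : ℝ, (1 + s ^ 2) / ‖(s : ℂ) - (t + ε * I)‖ ^ 2 ∂ν ≤ C := by
    rw [h.im_eq _ hz, him, mul_comm C] at hC
    exact le_of_mul_le_mul_left hC hε
  have hmass : ∫ _ in Icc (t - ε) (t + ε), (1 / (2 * ε ^ 2)) ∂ν ≤
      ∫ s : ℝ, (1 + s ^ 2) / ‖(s : ℂ) - (t + ε * I)‖ ^ 2 ∂ν := by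
    refine (setIntegral_mono_on (integrable_const _) hint.integrableOn measurableSet_Icc
      fun s hs => ?_).trans (setIntegral_le_integral hint (ae_of_all _ fun s => by
        simp only [Pi.zero_apply]; positivity))
    have hst : (s - t) ^ 2 ≤ ε ^ 2 := sq_le_sq' (by linarith [hs.1]) (by linarith [hs.2])
    rw [norm_ofReal_sub_sq]
    apply div_le_div₀ <;> nlinarith [sq_nonneg s, sq_nonneg (s - t), sq_pos_of_pos hε]
  rw [setIntegral_const, smul_eq_mul] at hmass
  have hC' : ν.real (Icc (t - ε) (t + ε)) * (1 / (2 * ε ^ 2)) ≤ C := by linarith [h.nonneg]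
  rw [mul_one_div, div_le_iff₀ (by positivity)] at hC'
  linarith

theorem measure_Ioc_eq_zero (h : IsHerglotzRep M B ν) {t₀ C δ : ℝ} (hδ : 0 < δ)
    (hC : ∀ t : ℝ, |t - t₀| < δ → ∀ ε : ℝ, 0 < ε → ε < δ → (M (t + ε * I)).im ≤ C * ε) :
    ν (Ioc (t₀ - δ / 2) (t₀ + δ / 2)) = 0 := by
  have := h.isFiniteMeasure
  refine measure_Ioc_eq_zero_of_le_sq (a := t₀ - δ) (b := t₀ + δ) (C := C / 2)
    (fun s hs t ht hst => ?_) ⟨by linarith, by linarith⟩ ⟨by linarith, by linarith⟩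
  have hmid : |(s + t) / 2 - t₀| < δ :=
    abs_lt.2 ⟨by linarith [hs.1, ht.1], by linarith [hs.2, ht.2]⟩
  have hhalf : 0 < (t - s) / 2 := by linarith
  have hle := h.measureReal_Icc_le hhalf
    (hC _ hmid _ hhalf (by linarith [hs.1, ht.2]))
  have hsub : Ioc s t ⊆ Icc ((s + t) / 2 - (t - s) / 2) ((s + t) / 2 + (t - s) / 2) :=
    fun x hx => ⟨by linarith [hx.1], by linarith [hx.2]⟩
  calc ν.real (Ioc s t) ≤ _ := measureReal_mono hsub
    _ ≤ _ := hle
    _ = C / 2 * (t - s) ^ 2 := by ring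

theorem im_mul_I_div (h : IsHerglotzRep M B ν) {y : ℝ} (hy : 0 < y) :
    (M (y * I)).im / y = B + ∫ t : ℝ, (1 + t ^ 2) / (t ^ 2 + y ^ 2) ∂ν := by
  have him : ((y : ℂ) * I).im = y := by simp
  rw [h.im_eq _ (by rwa [him]), him, mul_div_cancel_left₀ _ hy.ne']
  simp only [norm_ofReal_sub_mul_I_sq]

theorem measure_zero_eq_zero (h : IsHerglotzRep M B ν) {c : ℝ}
    (hc : Tendsto (fun y : ℝ => (M (y * I)).im / y) (𝓝[>] 0) (𝓝 c)) : ν {0} = 0 := by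
  have := h.isFiniteMeasure
  have hle : ∀ᶠ y : ℝ in 𝓝[>] 0, ν.real {0} ≤ y ^ 2 * ((M (y * I)).im / y) := by
    filter_upwards [self_mem_nhdsWithin] with y hy
    have hy : 0 < y := hy
    have hint : Integrable (fun t : ℝ => (1 + t ^ 2) / (t ^ 2 + y ^ 2)) ν := by
      simpa only [norm_ofReal_sub_mul_I_sq] using
        integrable_herglotz_kernel (z := y * I) (by simpa using hy) ν
    have hatom := setIntegral_le_integral (s := {0}) hint
      (ae_of_all _ fun s => by simp only [Pi.zero_apply]; positivity)
    have hval : ∫ t in ({0} : Set ℝ), (1 + t ^ 2) / (t ^ 2 + y ^ 2) ∂ν = ν.real {0} / y ^ 2 := by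
      rw [integral_singleton, smul_eq_mul]
      ring
    rw [hval, div_le_iff₀ (by positivity)] at hatom
    rw [h.im_mul_I_div hy]
    nlinarith [mul_nonneg h.nonneg (sq_nonneg y)]
  have hlim : Tendsto (fun y : ℝ => y ^ 2 * ((M (y * I)).im / y)) (𝓝[>] 0) (𝓝 (0 ^ 2 * c)) :=
    (((continuous_pow 2).tendsto 0).mono_left nhdsWithin_le_nhds).mul hc
  rw [← measureReal_eq_zero_iff]
  exact le_antisymm (by simpa using ge_of_tendsto hlim hle) measureReal_nonneg

theorem ae_mem_annulus (h : IsHerglotzRep M B ν) {r c : ℝ}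
    (hgap : ∀ t₀ ∈ gapSet r, ∃ C δ : ℝ, 0 < δ ∧
      ∀ t : ℝ, |t - t₀| < δ → ∀ ε : ℝ, 0 < ε → ε < δ → (M (t + ε * I)).im ≤ C * ε)
    (hc : Tendsto (fun y : ℝ => (M (y * I)).im / y) (𝓝[>] 0) (𝓝 c)) :
    ∀ᵐ t ∂ν, r ≤ |t| ∧ |t| ≤ 1 / r := by
  have hnull : ν (gapSet r) = 0 := measure_null_of_locally_null _ fun t₀ ht₀ => by
    obtain ⟨C, δ, hδ, hC⟩ := hgap t₀ ht₀
    exact ⟨_, mem_nhdsWithin_of_mem_nhds (Ioc_mem_nhds (by linarith) (by linarith)),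
      h.measure_Ioc_eq_zero hδ hC⟩
  filter_upwards [measure_eq_zero_iff_ae_notMem.1 hnull,
    measure_eq_zero_iff_ae_notMem.1 (h.measure_zero_eq_zero hc)] with t ht ht0
  have ht0 : t ≠ 0 := ht0
  simpa [gapSet, ht0] using ht

theorem tendsto_im_div_atTop (h : IsHerglotzRep M B ν) :
    Tendsto (fun y : ℝ => (M (y * I)).im / y) atTop (𝓝 B) := by
  have := h.isFiniteMeasure
  have hlim : Tendsto (fun y : ℝ => B + ∫ t : ℝ, (1 + t ^ 2) / (t ^ 2 + y ^ 2) ∂ν) atTop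
      (𝓝 (B + ∫ _ : ℝ, (0 : ℝ) ∂ν)) := by
    refine tendsto_const_nhds.add (tendsto_integral_filter_of_dominated_convergence (fun _ => 1)
      (.of_forall fun y => Measurable.aestronglyMeasurable (by fun_prop)) ?_
      (integrable_const 1) (ae_of_all _ fun t => tendsto_const_nhds.div_atTop
        (tendsto_atTop_add_const_left _ _ (tendsto_pow_atTop two_ne_zero))))
    filter_upwards [eventually_ge_atTop 1] with y hy
    refine ae_of_all _ fun t => ?_
    rw [Real.norm_of_nonneg (by positivity), div_le_one (by positivity)]
    nlinarith
  rw [integral_zero, add_zero] at hlim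
  refine hlim.congr' ?_
  filter_upwards [eventually_gt_atTop 0] with y hy
  rw [h.im_mul_I_div hy]

theorem tendsto_mul_im_sub_atTop (h : IsHerglotzRep M B ν)
    (hint : Integrable (fun t : ℝ => 1 + t ^ 2) ν) :
    Tendsto (fun y : ℝ => y * ((M (y * I)).im - B * y)) atTop (𝓝 (∫ t : ℝ, (1 + t ^ 2) ∂ν)) := by
  have hpt : ∀ t : ℝ, Tendsto (fun y : ℝ => (1 + t ^ 2) * (y ^ 2 / (t ^ 2 + y ^ 2))) atTop
      (𝓝 (1 + t ^ 2)) := fun t => by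
    have hsub : Tendsto (fun y : ℝ => (1 + t ^ 2) * (1 - t ^ 2 / (t ^ 2 + y ^ 2))) atTop
        (𝓝 ((1 + t ^ 2) * (1 - 0))) :=
      (tendsto_const_nhds.div_atTop (tendsto_atTop_add_const_left _ _
        (tendsto_pow_atTop two_ne_zero))).const_sub _ |>.const_mul _
    rw [sub_zero, mul_one] at hsub
    refine hsub.congr' ?_
    filter_upwards [eventually_gt_atTop 0] with y hy
    have : t ^ 2 + y ^ 2 ≠ 0 := by positivity
    field_simp
    ring
  have hlim : Tendsto (fun y : ℝ => ∫ t : ℝ, (1 + t ^ 2) * (y ^ 2 / (t ^ 2 + y ^ 2)) ∂ν) atTop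
      (𝓝 (∫ t : ℝ, (1 + t ^ 2) ∂ν)) := by
    refine tendsto_integral_filter_of_dominated_convergence (fun t => 1 + t ^ 2)
      (.of_forall fun y => Measurable.aestronglyMeasurable (by fun_prop)) ?_ hint
      (ae_of_all _ hpt)
    refine .of_forall fun y => ae_of_all _ fun t => ?_
    rw [Real.norm_of_nonneg (by positivity)]
    exact mul_le_of_le_one_right (by positivity)
      (div_le_one_of_le₀ (by nlinarith) (by positivity))
  refine hlim.congr' ?_
  filter_upwards [eventually_gt_atTop 0] with y hy
  rw [(div_eq_iff hy.ne').1 (h.im_mul_I_div hy), add_mul, add_sub_cancel_left, mul_comm, mul_assoc,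
    ← integral_mul_const]
  congr 1
  funext t
  ring

theorem tendsto_im_div_zero (h : IsHerglotzRep M B ν) {r : ℝ} (hr : 0 < r)
    (hν : ∀ᵐ t ∂ν, r ≤ |t|) (hint : Integrable (fun t : ℝ => 1 + t ^ 2) ν) :
    Tendsto (fun y : ℝ => (M (y * I)).im / y) (𝓝[>] 0)
      (𝓝 (B + ∫ t : ℝ, (1 + t ^ 2) / t ^ 2 ∂ν)) := by
  have hlim : Tendsto (fun y : ℝ => B + ∫ t : ℝ, (1 + t ^ 2) / (t ^ 2 + y ^ 2) ∂ν) (𝓝[>] 0)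
      (𝓝 (B + ∫ t : ℝ, (1 + t ^ 2) / t ^ 2 ∂ν)) := by
    refine tendsto_const_nhds.add (tendsto_integral_filter_of_dominated_convergence
      (fun t => (1 + t ^ 2) / r ^ 2)
      (.of_forall fun y => Measurable.aestronglyMeasurable (by fun_prop)) ?_
      (hint.div_const _) ?_)
    · refine .of_forall fun y => ?_
      filter_upwards [hν] with t ht
      have hrt : r ^ 2 ≤ t ^ 2 := by rw [← sq_abs t]; gcongr
      rw [Real.norm_of_nonneg (by positivity)]
      gcongr
      nlinarith [sq_nonneg y]
    · filter_upwards [hν] with t ht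
      have ht0 : t ^ 2 ≠ 0 := pow_ne_zero _ (abs_pos.1 (hr.trans_le ht))
      have hden : Tendsto (fun y : ℝ => t ^ 2 + y ^ 2) (𝓝[>] 0) (𝓝 (t ^ 2)) := by
        have := tendsto_const_nhds (x := t ^ 2).add ((continuous_pow (M := ℝ) 2).tendsto 0)
        rw [zero_pow two_ne_zero, add_zero] at this
        exact this.mono_left nhdsWithin_le_nhds
      exact tendsto_const_nhds.div hden ht0
  refine hlim.congr' ?_
  filter_upwards [self_mem_nhdsWithin] with y hy
  rw [h.im_mul_I_div hy]

end IsHerglotzRep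

end HerglotzMoments

section MomentRatio

open Complex Set

theorem exists_eq_real_const_of_im_eq_zero {F : ℂ → ℂ}
    (hF : ∀ z : ℂ, 0 < z.im → DifferentiableAt ℂ F z) (him : ∀ z : ℂ, 0 < z.im → (F z).im = 0) :
    ∃ c : ℝ, ∀ z : ℂ, 0 < z.im → F z = c := by
  set U : Set ℂ := {z | 0 < z.im}
  have hUo : IsOpen U := isOpen_lt continuous_const continuous_im
  have hd : DifferentiableOn ℂ F U := fun z hz => (hF z hz).differentiableWithinAt
  rcases (hd.analyticOnNhd hUo).is_constant_or_isOpen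
    (convex_halfSpace_im_gt 0).isPreconnected with ⟨w, hw⟩ | hopen
  · have hI : I ∈ U := by simp [U]
    have hwim : w.im = 0 := by rw [← hw I hI]; exact him I hI
    exact ⟨w.re, fun z hz => (hw z hz).trans (Complex.ext (by simp) (by simp [hwim]))⟩
  · exfalso
    have hFI : F I ∈ F '' U := ⟨I, by simp [U], rfl⟩
    obtain ⟨ε, hε, hball⟩ := Metric.isOpen_iff.1 (hopen U Subset.rfl hUo) _ hFI
    obtain ⟨w, hw, hwF⟩ : F I + (ε / 2 : ℝ) * I ∈ F '' U := by
      apply hball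
      rw [Metric.mem_ball, dist_eq_norm, add_sub_cancel_left, norm_mul, norm_I, mul_one,
        Complex.norm_real, Real.norm_of_nonneg (by positivity)]
      linarith
    have him_eq := congrArg Complex.im hwF
    rw [him w hw, add_im, him I (by simp)] at him_eq
    simp at him_eq
    linarith

theorem integral_eq_of_ae_abs_eq {ν : Measure ℝ} [IsFiniteMeasure ν] {q : ℝ} (hq : 0 < q)
    (hν : ∀ᵐ t ∂ν, |t| = q) (φ : ℝ → ℝ) :
    ∫ t, φ t ∂ν = ν.real {q} * φ q + ν.real {-q} * φ (-q) := by
  have hrestrict : ν.restrict ({q} ∪ {-q}) = ν := by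
    apply Measure.restrict_eq_self_of_ae_mem
    filter_upwards [hν] with t ht
    simpa [or_comm] using (abs_eq hq.le).1 ht
  have hint : ∀ x : ℝ, IntegrableOn φ {x} ν := fun x => by
    rw [integrableOn_singleton_iff]
    exact .inr (measure_lt_top _ _)
  conv_lhs => rw [← hrestrict]
  rw [setIntegral_union (by simp; linarith) (measurableSet_singleton _) (hint _) (hint _),
    integral_singleton, integral_singleton, smul_eq_mul, smul_eq_mul]

theorem integral_lt_integral_of_ae_le {α : Type*} [MeasurableSpace α] {μ : Measure α}
    {f g : α → ℝ} (hf : Integrable f μ) (hg : Integrable g μ) (hle : f ≤ᵐ[μ] g)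
    (hne : ¬ f =ᵐ[μ] g) : ∫ x, f x ∂μ < ∫ x, g x ∂μ :=
  lt_of_le_of_ne (integral_mono_ae hf hg hle) fun h =>
    hne ((integral_eq_iff_of_ae_le hf hg hle).1 h)

section Annulus

variable {ν : Measure ℝ} {r q : ℝ}

theorem integrable_one_add_sq_div_sq (hr : 0 < r) (hν : ∀ᵐ t ∂ν, r ≤ |t|)
    (hint : Integrable (fun t : ℝ => 1 + t ^ 2) ν) :
    Integrable (fun t : ℝ => (1 + t ^ 2) / t ^ 2) ν := by
  refine (hint.div_const (r ^ 2)).mono' (Measurable.aestronglyMeasurable (by fun_prop)) ?_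
  filter_upwards [hν] with t ht
  rw [Real.norm_of_nonneg (by positivity), ← sq_abs t]
  gcongr

theorem sq_mul_integral_lt_integral (hr : 0 < r) (hν : ∀ᵐ t ∂ν, r ≤ |t|)
    (hint : Integrable (fun t : ℝ => 1 + t ^ 2) ν) (hne : ¬ ∀ᵐ t ∂ν, |t| = r) :
    r ^ 2 * ∫ t, (1 + t ^ 2) / t ^ 2 ∂ν < ∫ t, (1 + t ^ 2) ∂ν := by
  rw [← integral_const_mul]
  refine integral_lt_integral_of_ae_le ((integrable_one_add_sq_div_sq hr hν hint).const_mul _)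
    hint ?_ fun heq => hne ?_
  · filter_upwards [hν] with t ht
    have : 0 < |t| := hr.trans_le ht
    rw [← sq_abs t, ← mul_div_assoc, div_le_iff₀ (by positivity), mul_comm]
    gcongr
  · filter_upwards [hν, heq] with t ht hteq
    have ht0 : 0 < |t| := hr.trans_le ht
    rw [← sq_abs t, ← mul_div_assoc, div_eq_iff (by positivity), mul_comm,
      mul_right_inj' (by positivity)] at hteq
    exact ((sq_eq_sq₀ hr.le ht0.le).1 hteq).symm

theorem integral_lt_sq_mul_integral (hr : 0 < r) (hν : ∀ᵐ t ∂ν, r ≤ |t| ∧ |t| ≤ q)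
    (hint : Integrable (fun t : ℝ => 1 + t ^ 2) ν) (hne : ¬ ∀ᵐ t ∂ν, |t| = q) :
    ∫ t, (1 + t ^ 2) ∂ν < q ^ 2 * ∫ t, (1 + t ^ 2) / t ^ 2 ∂ν := by
  rw [← integral_const_mul]
  refine integral_lt_integral_of_ae_le hint ((integrable_one_add_sq_div_sq hr
    (hν.mono fun t ht => ht.1) hint).const_mul _) ?_ fun heq => hne ?_
  · filter_upwards [hν] with t ht
    have : 0 < |t| := hr.trans_le ht.1
    rw [← sq_abs t, ← mul_div_assoc, le_div_iff₀ (by positivity), mul_comm]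
    gcongr
    exact ht.2
  · filter_upwards [hν, heq] with t ht hteq
    have ht0 : 0 < |t| := hr.trans_le ht.1
    rw [← sq_abs t, ← mul_div_assoc, eq_div_iff (by positivity), mul_comm,
      mul_left_inj' (by positivity)] at hteq
    exact (sq_eq_sq₀ ht0.le (ht0.le.trans ht.2)).1 hteq

end Annulus

section TwoPoles

variable {r q B g₁ g₂ : ℝ}

theorem residue_nonpos (hr : 0 < r) (hr1 : r ≤ 1) (hq : q = r ∨ q = 1 / r)
    (h : ∀ x ∈ Ioo 0 r, B * x + g₁ / (q - x) - g₂ / (q + x) ≤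
      B * (1 / x) + g₁ / (q - 1 / x) - g₂ / (q + 1 / x)) : g₁ ≤ 0 := by
  by_contra! hg
  have hq0 : 0 < q := by rcases hq with rfl | rfl <;> positivity
  have hpos : ∀ x ∈ Ioo 0 r, 0 < q - x ∧ 0 < 1 / x - q := fun x hx => by
    have hrq : r ≤ 1 / r := by rw [le_div_iff₀ hr]; nlinarith
    have := one_div_lt_one_div_of_lt hx.1 hx.2
    rcases hq with rfl | rfl <;> constructor <;> linarith [hx.2]
  obtain ⟨d, hd, hdr, hdpos, hdle⟩ : ∃ d : ℝ → ℝ, ContinuousAt d r ∧ d r = 0 ∧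
      (∀ x ∈ Ioo 0 r, 0 < d x) ∧
      ∀ x ∈ Ioo 0 r, g₁ / d x ≤ g₁ / (q - x) + g₁ / (1 / x - q) := by
    rcases hq with hq | hq
    · refine ⟨fun x => q - x, by fun_prop, by simp [hq], fun x hx => (hpos x hx).1,
        fun x hx => le_add_of_nonneg_right (div_nonneg hg.le (hpos x hx).2.le)⟩
    · refine ⟨fun x => 1 / x - q, by fun_prop (disch := exact hr.ne'), by simp [hq],
        fun x hx => (hpos x hx).2,
        fun x hx => le_add_of_nonneg_left (div_nonneg hg.le (hpos x hx).1.le)⟩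
  have hreg : ContinuousAt
      (fun x => d x * (B * (1 / x) - B * x + g₂ / (q + x) - g₂ / (q + 1 / x))) r := by
    have : q + r ≠ 0 := by positivity
    have : q + 1 / r ≠ 0 := by positivity
    fun_prop (disch := first | exact hr.ne' | assumption)
  have hlim := hreg.tendsto.mono_left (nhdsWithin_le_nhds (s := Iio r))
  rw [hdr, zero_mul] at hlim
  refine hg.not_ge (ge_of_tendsto hlim ?_)
  filter_upwards [Ioo_mem_nhdsLT hr] with x hx
  have hneg : g₁ / (q - 1 / x) = -(g₁ / (1 / x - q)) := by rw [← neg_sub, div_neg]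
  rw [← div_le_iff₀' (hdpos x hx)]
  linarith [h x hx, hdle x hx]

theorem eq_of_tendsto_two_poles {M : ℂ → ℂ} {c t : ℝ} {w : ℂ}
    (hM : ∀ z : ℂ, 0 < z.im → M z = c + (B * z + g₁ / (q - z) - g₂ / (q + z)))
    (h₁ : q - t ≠ 0) (h₂ : q + t ≠ 0)
    (hw : Tendsto (fun y : ℝ => M (t + y * I)) (𝓝[>] 0) (𝓝 w)) :
    w = (c + (B * t + g₁ / (q - t) - g₂ / (q + t)) : ℝ) := by
  have hcont : ContinuousAt
      (fun y : ℝ => (c + (B * (t + y * I) + g₁ / (q - (t + y * I)) - g₂ / (q + (t + y * I))) : ℂ))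
      0 := by
    have : (q : ℂ) - (t + (0 : ℝ) * I) ≠ 0 := by simpa using mod_cast h₁
    have : (q : ℂ) + (t + (0 : ℝ) * I) ≠ 0 := by simpa using mod_cast h₂
    fun_prop (disch := assumption)
  refine (tendsto_nhds_unique hw
    ((hcont.tendsto.mono_left nhdsWithin_le_nhds).congr' ?_)).trans (by push_cast; simp)
  filter_upwards [self_mem_nhdsWithin] with y hy
  exact (hM _ (by simpa using hy)).symm

end TwoPoles

namespace IsHerglotzRep

variable {M : ℂ → ℂ} {B r q : ℝ} {ν : Measure ℝ}

theorem exists_eq_of_ae_abs_eq (h : IsHerglotzRep M B ν)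
    (hM : ∀ z : ℂ, 0 < z.im → DifferentiableAt ℂ M z) (hq : 0 < q) (hν : ∀ᵐ t ∂ν, |t| = q) :
    ∃ c : ℝ, ∀ z : ℂ, 0 < z.im → M z = c + (B * z +
      ((1 + q ^ 2) * ν.real {q} : ℝ) / (q - z) - ((1 + q ^ 2) * ν.real {-q} : ℝ) / (q + z)) := by
  have := h.isFiniteMeasure
  set g₁ : ℝ := (1 + q ^ 2) * ν.real {q} with hg₁
  set g₂ : ℝ := (1 + q ^ 2) * ν.real {-q} with hg₂
  set Q : ℂ → ℂ := fun z => B * z + g₁ / (q - z) - g₂ / (q + z) with hQ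
  have hne : ∀ z : ℂ, 0 < z.im → (q : ℂ) - z ≠ 0 ∧ (q : ℂ) + z ≠ 0 := fun z hz =>
    ⟨fun h0 => hz.ne' (by simpa using congrArg Complex.im h0),
      fun h0 => hz.ne' (by simpa using congrArg Complex.im h0)⟩
  have hQd : ∀ z : ℂ, 0 < z.im → DifferentiableAt ℂ Q z := fun z hz => by
    obtain ⟨hsub, hadd⟩ := hne z hz
    fun_prop (disch := assumption)
  have him : ∀ z : ℂ, 0 < z.im → (M z - Q z).im = 0 := fun z hz => by
    have hsub := normSq_pos.2 (hne z hz).1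
    have hadd := normSq_pos.2 (hne z hz).2
    have hneg : ‖((-q : ℝ) : ℂ) - z‖ ^ 2 = normSq (q + z) := by
      rw [Complex.sq_norm, ← normSq_neg]
      congr 1
      push_cast
      ring
    have hQim : (Q z).im = B * z.im + g₁ * z.im / normSq (q - z) + g₂ * z.im / normSq (q + z) := by
      simp [hQ, div_im]
      ring
    rw [sub_im, hQim, h.im_eq z hz, integral_eq_of_ae_abs_eq hq hν, hneg, Complex.sq_norm, hg₁, hg₂]
    field_simp
    ring
  obtain ⟨c, hc⟩ := exists_eq_real_const_of_im_eq_zero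
    (fun z hz => (hM z hz).sub (hQd z hz)) him
  exact ⟨c, fun z hz => sub_eq_iff_eq_add.1 (hc z hz)⟩

theorem measure_eq_zero_of_ae_abs_eq (h : IsHerglotzRep M B ν) {N : ℝ → ℝ} (hr : 0 < r)
    (hr1 : r ≤ 1) (hq : q = r ∨ q = 1 / r) (hM : ∀ z : ℂ, 0 < z.im → DifferentiableAt ℂ M z)
    (hN : ∀ t ∈ gapSet r, Tendsto (fun y : ℝ => M (t + y * I)) (𝓝[>] 0) (𝓝 (N t)))
    (hN₁ : ∀ x ∈ Ioo 0 r, N x ≤ N (1 / x)) (hN₂ : ∀ x ∈ Ioo 0 r, N (-(1 / x)) ≤ N (-x))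
    (hν : ∀ᵐ t ∂ν, |t| = q) : ν = 0 := by
  have := h.isFiniteMeasure
  have hq0 : 0 < q := by rcases hq with rfl | rfl <;> positivity
  have hrq : r ≤ q ∧ q ≤ 1 / r := by
    have : r ≤ 1 / r := by rw [le_div_iff₀ hr]; nlinarith
    rcases hq with rfl | rfl <;> constructor <;> linarith
  obtain ⟨c, hc⟩ := h.exists_eq_of_ae_abs_eq hM hq0 hν
  set g₁ : ℝ := (1 + q ^ 2) * ν.real {q}
  set g₂ : ℝ := (1 + q ^ 2) * ν.real {-q}
  have hNeq : ∀ t ∈ gapSet r, N t = c + (B * t + g₁ / (q - t) - g₂ / (q + t)) := fun t ht => by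
    have htq : |t| ≠ q := by
      rcases ht.2 with hlt | hgt
      exacts [(hlt.trans_le hrq.1).ne, (hrq.2.trans_lt hgt).ne']
    refine ofReal_injective (eq_of_tendsto_two_poles hc (fun h0 => htq ?_) (fun h0 => htq ?_)
      (hN t ht))
    · rw [← sub_eq_zero.1 h0, abs_of_pos hq0]
    · rw [eq_neg_of_add_eq_zero_right h0, abs_neg, abs_of_pos hq0]
  have hg₁_nonpos : g₁ ≤ 0 := residue_nonpos (B := B) (g₂ := g₂) hr hr1 hq fun x hx => by
    linarith [hN₁ x hx, hNeq x (mem_gapSet_of_mem_Ioo hx), hNeq _ (one_div_mem_gapSet hx)]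
  have hg₂_nonpos : g₂ ≤ 0 := residue_nonpos (B := B) (g₂ := g₁) hr hr1 hq fun x hx => by
    have hneg := hNeq _ (neg_mem_gapSet (mem_gapSet_of_mem_Ioo hx))
    have hneg_inv := hNeq _ (neg_mem_gapSet (one_div_mem_gapSet hx))
    rw [sub_neg_eq_add, ← sub_eq_add_neg] at hneg hneg_inv
    linarith [hN₂ x hx]
  have hmass : ∀ x : ℝ, (1 + q ^ 2) * ν.real {x} ≤ 0 → ν.real {x} = 0 := fun x hx =>
    le_antisymm (nonpos_of_mul_nonpos_right hx (by positivity)) measureReal_nonneg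
  have huniv := integral_eq_of_ae_abs_eq hq0 hν fun _ => 1
  rw [hmass _ hg₁_nonpos, hmass _ hg₂_nonpos, integral_const] at huniv
  simpa [measureReal_eq_zero_iff] using huniv

end IsHerglotzRep

theorem tendsto_div_atTop_of_tendsto_mul_sub {f : ℝ → ℝ} {B s : ℝ}
    (h : Tendsto (fun y : ℝ => y * (f y - B * y)) atTop (𝓝 s)) :
    Tendsto (fun y : ℝ => f y / y) atTop (𝓝 B) := by
  have hdiv := (h.div_atTop (tendsto_pow_atTop (α := ℝ) two_ne_zero)).add_const B
  rw [zero_add] at hdiv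
  refine hdiv.congr' ?_
  filter_upwards [eventually_gt_atTop 0] with y hy
  field_simp
  ring

theorem integrable_one_add_sq_of_ae_abs_le {ν : Measure ℝ} [IsFiniteMeasure ν] {K : ℝ}
    (h : ∀ᵐ t ∂ν, |t| ≤ K) : Integrable (fun t : ℝ => 1 + t ^ 2) ν := by
  refine .of_bound (by fun_prop) (1 + K ^ 2) ?_
  filter_upwards [h] with t ht
  rw [Real.norm_of_nonneg (by positivity), ← sq_abs t]
  gcongr

theorem herglotz_moment_ratio {M : ℂ → ℂ} {N : ℝ → ℝ} {r B s : ℝ} (hr : 0 < r) (hr1 : r ≤ 1)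
    (hM : ∀ z : ℂ, 0 < z.im → DifferentiableAt ℂ M z)
    (hpos : ∀ z : ℂ, 0 < z.im → 0 ≤ (M z).im)
    (hgap : ∀ t₀ ∈ gapSet r, ∃ C δ : ℝ, 0 < δ ∧
      ∀ t : ℝ, |t - t₀| < δ → ∀ ε : ℝ, 0 < ε → ε < δ → (M (t + ε * I)).im ≤ C * ε)
    (hzero : Tendsto (fun y : ℝ => (M (y * I)).im / y) (𝓝[>] 0) (𝓝 1))
    (hmoment : Tendsto (fun y : ℝ => y * ((M (y * I)).im - B * y)) atTop (𝓝 s))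
    (hN : ∀ t ∈ gapSet r, Tendsto (fun y : ℝ => M (t + y * I)) (𝓝[>] 0) (𝓝 (N t)))
    (hN₁ : ∀ x ∈ Ioo 0 r, N x ≤ N (1 / x)) (hN₂ : ∀ x ∈ Ioo 0 r, N (-(1 / x)) ≤ N (-x)) :
    (B = 1 ∧ s = 0 ∧ ∃ c : ℝ, ∀ z : ℂ, 0 < z.im → M z = z + c) ∨
      (B < 1 ∧ r ^ 2 * (1 - B) < s ∧ s < (1 - B) / r ^ 2) := by
  obtain ⟨B', ν, h⟩ := exists_herglotz_measure hM hpos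
  obtain rfl := tendsto_nhds_unique h.tendsto_im_div_atTop
    (tendsto_div_atTop_of_tendsto_mul_sub hmoment)
  have := h.isFiniteMeasure
  have hsupp := h.ae_mem_annulus hgap hzero
  have hlow : ∀ᵐ t ∂ν, r ≤ |t| := hsupp.mono fun t ht => ht.1
  have hint := integrable_one_add_sq_of_ae_abs_le (hsupp.mono fun t ht => ht.2)
  obtain rfl := tendsto_nhds_unique (h.tendsto_mul_im_sub_atTop hint) hmoment
  have hB : B' + ∫ t, (1 + t ^ 2) / t ^ 2 ∂ν = 1 :=
    tendsto_nhds_unique (h.tendsto_im_div_zero hr hlow hint) hzero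
  by_cases hν : ν = 0
  · left
    subst hν
    rw [integral_zero_measure, add_zero] at hB
    obtain ⟨c, hc⟩ := exists_eq_real_const_of_im_eq_zero (F := fun z => M z - z)
      (fun z hz => (hM z hz).sub differentiableAt_fun_id)
      (fun z hz => by rw [sub_im, h.im_eq z hz, hB, integral_zero_measure]; ring)
    exact ⟨hB, integral_zero_measure _, c, fun z hz => by rw [← hc z hz]; ring⟩
  · right
    have hne : ∀ q : ℝ, (q = r ∨ q = 1 / r) → ¬ ∀ᵐ t ∂ν, |t| = q := fun q hq hae =>
      hν (h.measure_eq_zero_of_ae_abs_eq hr hr1 hq hM hN hN₁ hN₂ hae)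
    have hlower := sq_mul_integral_lt_integral hr hlow hint (hne r (.inl rfl))
    have hupper := integral_lt_sq_mul_integral hr hsupp hint (hne (1 / r) (.inr rfl))
    rw [one_div_pow, one_div_mul_eq_div] at hupper
    rw [← eq_sub_iff_add_eq'] at hB
    rw [hB] at hlower hupper
    have hmul_pos : 0 < 1 - B' := by
      have : 0 ≤ ∫ t : ℝ, (1 + t ^ 2) ∂ν := integral_nonneg fun t => by positivity
      exact (div_pos_iff_of_pos_right (by positivity)).1 (this.trans_lt hupper)
    exact ⟨sub_pos.1 hmul_pos, hlower, hupper⟩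

end MomentRatio

noncomputable section Green

open Complex Set

theorem permCLM_apply (e : ℤ ≃ ℤ) (u : EllTwo) (n : ℤ) : permCLM e u n = u (e n) := rfl

theorem norm_permCLM_le (e : ℤ ≃ ℤ) : ‖permCLM e‖ ≤ 1 :=
  LinearMap.mkContinuous_norm_le _ zero_le_one _

theorem mulCLM_apply (c : ℤ → ℝ) (hc : ∃ C, ∀ n, |c n| ≤ C) (u : EllTwo) (n : ℤ) :
    mulCLM c hc u n = c n * u n := rfl

theorem inner_ellTwo (u v : EllTwo) : inner ℂ u v = ∑' n, v n * (starRingEnd ℂ) (u n) := by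
  rw [lp.inner_eq_tsum]
  simp

theorem inner_permCLM_left (e : ℤ ≃ ℤ) (u v : EllTwo) :
    inner ℂ (permCLM e u) v = inner ℂ u (permCLM e.symm v) := by
  rw [inner_ellTwo, inner_ellTwo,
    ← e.tsum_eq fun n => permCLM e.symm v n * (starRingEnd ℂ) (u n)]
  simp [permCLM_apply]

theorem inner_mulCLM_left (c : ℤ → ℝ) (hc : ∃ C, ∀ n, |c n| ≤ C) (u v : EllTwo) :
    inner ℂ (mulCLM c hc u) v = inner ℂ u (mulCLM c hc v) := by
  simp only [inner_ellTwo, mulCLM_apply, map_mul, conj_ofReal]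
  exact tsum_congr fun n => by ring

/-- The unit vector `δ_0` of `ℓ²(ℤ)`. -/
def deltaZero : EllTwo := lp.single 2 0 (1 : ℂ)

theorem deltaZero_apply (n : ℤ) : deltaZero n = if n = 0 then 1 else 0 := by
  rw [deltaZero, lp.single_apply, Pi.single_apply]

theorem deltaZero_ne_zero : deltaZero ≠ 0 := fun h => by
  simpa [deltaZero_apply] using congrArg (fun u : EllTwo => u 0) h

/-- The restriction of `u ∈ ℓ²(ℤ)` to `S`, extended by zero. -/
def truncate (S : Set ℤ) : EllTwo →L[ℂ] EllTwo :=
  mulCLM (S.indicator 1) ⟨1, fun n => by by_cases hn : n ∈ S <;> simp [hn]⟩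

theorem truncate_apply_of_mem {S : Set ℤ} {n : ℤ} (hn : n ∈ S) (u : EllTwo) :
    truncate S u n = u n := by
  simp [truncate, mulCLM_apply, hn]

theorem truncate_apply_of_notMem {S : Set ℤ} {n : ℤ} (hn : n ∉ S) (u : EllTwo) :
    truncate S u n = 0 := by
  simp [truncate, mulCLM_apply, hn]

theorem im_div_pos {w g : ℂ} (h : 0 < (w * (starRingEnd ℂ) g).im) : 0 < (w / g).im := by
  have hg : g ≠ 0 := by rintro rfl; simp at h
  have hdiv : w / g = w * (starRingEnd ℂ) g / (normSq g : ℝ) := by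
    rw [normSq_eq_conj_mul_self, mul_comm, mul_div_mul_left]
    simpa using hg
  rw [hdiv, div_ofReal_im]
  exact div_pos h (normSq_pos.2 hg)

namespace JacobiMatrix

variable (J : JacobiMatrix)

theorem isSelfAdjoint_op : IsSelfAdjoint J.op := by
  rw [ContinuousLinearMap.isSelfAdjoint_iff_isSymmetric]
  intro u v
  have hadd : (Equiv.addRight (1 : ℤ)).symm = Equiv.subRight 1 := by
    ext n; simp [sub_eq_add_neg]
  have hsub : (Equiv.subRight (1 : ℤ)).symm = Equiv.addRight 1 := by
    ext n; simp
  simp only [op, ContinuousLinearMap.coe_coe, add_apply, ContinuousLinearMap.comp_apply,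
    inner_add_left, inner_add_right, inner_mulCLM_left, inner_permCLM_left, hadd, hsub]
  ring

theorem exists_inner_op_eq_real (u : EllTwo) :
    ∃ c : ℝ, inner ℂ u (J.op u) = c ∧ |c| ≤ ‖J.op‖ * ‖u‖ ^ 2 := by
  have hsymm := ContinuousLinearMap.isSelfAdjoint_iff_isSymmetric.1 J.isSelfAdjoint_op
  refine ⟨(inner ℂ (J.op u) u : ℂ).re,
    (hsymm u u).symm.trans (hsymm.coe_re_inner_apply_self u).symm, ?_⟩
  calc |(inner ℂ (J.op u) u : ℂ).re| ≤ ‖(inner ℂ (J.op u) u : ℂ)‖ := abs_re_le_norm _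
    _ ≤ ‖J.op u‖ * ‖u‖ := norm_inner_le_norm _ _
    _ ≤ ‖J.op‖ * ‖u‖ * ‖u‖ := by gcongr; exact J.op.le_opNorm u
    _ = ‖J.op‖ * ‖u‖ ^ 2 := by ring

theorem exists_inner_op_sub_smul_eq (u : EllTwo) (z : ℂ) :
    ∃ c : ℝ, inner ℂ u (J.op u - z • u) = c - z * (‖u‖ ^ 2 : ℝ) ∧ |c| ≤ ‖J.op‖ * ‖u‖ ^ 2 := by
  obtain ⟨c, hc, hbound⟩ := J.exists_inner_op_eq_real u
  refine ⟨c, ?_, hbound⟩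
  rw [inner_sub_right, hc, inner_smul_right, inner_self_eq_norm_sq_to_K]
  push_cast
  rfl

variable {J}

theorem a_ne_zero (n : ℤ) : (J.a n : ℂ) ≠ 0 := by
  exact_mod_cast (J.a_pos n).ne'

theorem im_op_sub_mul_conj_neg {z : ℂ} (hz : 0 < z.im) {v : EllTwo} (hv : v ≠ 0) {m : ℤ}
    (h : ∀ n ≠ m, v n ≠ 0 → J.op v n = z * v n) :
    ((J.op v m - z * v m) * (starRingEnd ℂ) (v m)).im < 0 := by
  obtain ⟨c, hc, -⟩ := J.exists_inner_op_sub_smul_eq v z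
  have hcoe : ∀ n, (J.op v - z • v) n = J.op v n - z * v n := fun _ => rfl
  have hsum : inner ℂ v (J.op v - z • v) =
      (J.op v m - z * v m) * (starRingEnd ℂ) (v m) := by
    rw [inner_ellTwo, tsum_eq_single m fun n hn => ?_, hcoe]
    by_cases hvn : v n = 0
    · rw [hvn, map_zero, mul_zero]
    · rw [hcoe, h n hn hvn, sub_self, zero_mul]
  rw [← hsum, hc, sub_im, ofReal_im, im_mul_ofReal, zero_sub, neg_lt_zero]
  have := norm_pos_iff.2 hv
  positivity

variable (J)

/-- The part of the resolvent set of `J` that consists of the nonreal numbers and of those of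
modulus greater than `‖J‖`. -/
def regularSet : Set ℂ := {z | z.im ≠ 0 ∨ ‖J.op‖ < ‖z‖}

theorem isOpen_regularSet : IsOpen J.regularSet :=
  (isOpen_ne_fun continuous_im continuous_const).union (isOpen_lt continuous_const continuous_norm)

/-- The vector `(J - z)⁻¹ δ_0`. -/
def green (z : ℂ) : EllTwo := -(resolvent J.op z deltaZero)

variable {J} {z : ℂ}

theorem mem_regularSet_of_im_pos (hz : 0 < z.im) : z ∈ J.regularSet := .inl hz.ne'

theorem conj_mem_regularSet (hz : z ∈ J.regularSet) : (starRingEnd ℂ) z ∈ J.regularSet := by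
  simpa [regularSet] using hz

theorem mem_resolventSet_of_mem_regularSet (hz : z ∈ J.regularSet) : z ∈ resolventSet ℂ J.op := by
  rcases hz with him | hnorm
  · by_contra hspec
    exact him (J.isSelfAdjoint_op.im_eq_zero_of_mem_spectrum hspec)
  · have := nontrivial_of_ne _ _ deltaZero_ne_zero
    exact spectrum.mem_resolventSet_of_norm_lt hnorm

theorem op_green (hz : z ∈ J.regularSet) : J.op (J.green z) - z • J.green z = deltaZero := by
  have hmul : (algebraMap ℂ (EllTwo →L[ℂ] EllTwo) z - J.op) * resolvent J.op z = 1 :=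
    Ring.mul_inverse_cancel _ (mem_resolventSet_of_mem_regularSet hz)
  rw [Algebra.algebraMap_eq_smul_one] at hmul
  rw [green, map_neg, smul_neg, sub_neg_eq_add, neg_add_eq_sub]
  exact DFunLike.congr_fun hmul deltaZero

theorem eq_green_of_op_eq (hz : z ∈ J.regularSet) {u : EllTwo}
    (hu : J.op u - z • u = deltaZero) : u = J.green z := by
  have hmul : resolvent J.op z * (algebraMap ℂ (EllTwo →L[ℂ] EllTwo) z - J.op) = 1 :=
    Ring.inverse_mul_cancel _ (mem_resolventSet_of_mem_regularSet hz)
  rw [Algebra.algebraMap_eq_smul_one] at hmul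
  rw [green, ← hu, ← map_neg, neg_sub]
  exact (DFunLike.congr_fun hmul u).symm

theorem green_apply_eq (hz : z ∈ J.regularSet) (n : ℤ) :
    J.a n * J.green z (n + 1) + J.a (n - 1) * J.green z (n - 1) + J.b n * J.green z n
      = z * J.green z n + if n = 0 then 1 else 0 := by
  have h : J.op (J.green z) n - z * J.green z n = deltaZero n :=
    congrArg (fun u : EllTwo => u n) (op_green hz)
  rw [← deltaZero_apply, ← h, op_apply]
  ring

theorem green_apply_one (hz : z ∈ J.regularSet) :
    J.a 1 * J.green z 2 + J.a 0 * J.green z 0 + J.b 1 * J.green z 1 = z * J.green z 1 :=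
  (green_apply_eq hz 1).trans (by simp)

theorem green_apply_zero (hz : z ∈ J.regularSet) :
    J.a 0 * J.green z 1 + J.a (-1) * J.green z (-1) + J.b 0 * J.green z 0
      = z * J.green z 0 + 1 :=
  (green_apply_eq hz 0).trans (by simp)

theorem green_conj (hz : z ∈ J.regularSet) (n : ℤ) :
    J.green ((starRingEnd ℂ) z) n = (starRingEnd ℂ) (J.green z n) := by
  have hstar : (star (J.green z) : EllTwo) = J.green ((starRingEnd ℂ) z) := by
    apply eq_green_of_op_eq (conj_mem_regularSet hz)
    ext m
    have hm := congrArg (starRingEnd ℂ) (green_apply_eq hz m)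
    simp only [map_add, map_mul, conj_ofReal, apply_ite (starRingEnd ℂ), map_one, map_zero] at hm
    simp only [lp.coeFn_sub, lp.coeFn_smul, Pi.sub_apply, Pi.smul_apply, smul_eq_mul,
      deltaZero_apply, op_apply, lp.star_apply, ← starRingEnd_apply]
    rw [hm, add_sub_cancel_left]
  rw [← hstar, lp.star_apply, starRingEnd_apply]

theorem differentiableAt_green (hz : z ∈ J.regularSet) (n : ℤ) :
    DifferentiableAt ℂ (fun w => J.green w n) z := by
  have hres := (spectrum.hasDerivAt_resolvent_const_left
    (mem_resolventSet_of_mem_regularSet hz)).differentiableAt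
  have hgreen : DifferentiableAt ℂ J.green z :=
    (hres.clm_apply (differentiableAt_const deltaZero)).neg
  exact (lp.evalCLM ℂ (fun _ : ℤ => ℂ) 2 n).differentiableAt.comp z hgreen

theorem green_ne_zero (hz : z ∈ J.regularSet) : J.green z ≠ 0 := fun h =>
  deltaZero_ne_zero (by rw [← op_green hz, h, map_zero, smul_zero, sub_zero])

theorem exists_conj_green_zero_eq (hz : z ∈ J.regularSet) :
    ∃ c : ℝ, (starRingEnd ℂ) (J.green z 0) = c - z * (‖J.green z‖ ^ 2 : ℝ) ∧
      |c| ≤ ‖J.op‖ * ‖J.green z‖ ^ 2 := by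
  obtain ⟨c, hc, hbound⟩ := J.exists_inner_op_sub_smul_eq (J.green z) z
  refine ⟨c, ?_, hbound⟩
  rw [← hc, op_green hz, inner_ellTwo, tsum_eq_single 0 fun n hn => by simp [deltaZero_apply, hn]]
  simp [deltaZero_apply]

theorem green_zero_ne_zero (hz : z ∈ J.regularSet) : J.green z 0 ≠ 0 := by
  intro h
  obtain ⟨c, hc, hbound⟩ := exists_conj_green_zero_eq hz
  have hpos : 0 < ‖J.green z‖ ^ 2 := by
    have := norm_pos_iff.2 (green_ne_zero hz)
    positivity
  rw [h, map_zero, eq_comm, sub_eq_zero] at hc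
  rcases hz with him | hnorm
  · have him_eq := congrArg Complex.im hc
    rw [ofReal_im, im_mul_ofReal] at him_eq
    exact mul_ne_zero him hpos.ne' him_eq.symm
  · have hnorm_eq := congrArg norm hc
    rw [norm_mul, norm_real, norm_real, Real.norm_eq_abs, Real.norm_of_nonneg hpos.le] at hnorm_eq
    nlinarith

theorem exists_green_real {x : ℝ} (hx : ‖J.op‖ < |x|) :
    ∃ g : ℝ, J.green x 0 = g ∧ g * x < 0 := by
  have hz : (x : ℂ) ∈ J.regularSet := .inr (by simpa using hx)
  obtain ⟨c, hc, hbound⟩ := exists_conj_green_zero_eq hz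
  have hpos : 0 < ‖J.green x‖ ^ 2 := by
    have := norm_pos_iff.2 (green_ne_zero hz)
    positivity
  refine ⟨c - x * ‖J.green x‖ ^ 2, ?_, ?_⟩
  · rw [← conj_conj (J.green x 0), hc]
    simp
  · have hcx : c * x < |x| * ‖J.green x‖ ^ 2 * |x| := by
      refine (le_abs_self _).trans_lt ?_
      rw [abs_mul]
      have hx0 : 0 < |x| := (norm_nonneg _).trans_lt hx
      gcongr
      exact hbound.trans_lt (by gcongr)
    nlinarith [abs_mul_abs_self x]

variable (J)

/-- The function `-G_1 / (a_0 G_0)`, where `G = (J - z)⁻¹ δ_0`. It agrees with `m_+` for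
`Im z > 0` and continues it to `regularSet`. -/
def mPlusExt (z : ℂ) : ℂ := -(J.green z 1 / (J.a 0 * J.green z 0))

/-- The function `(a_0 G_1 - 1) / (a_0² G_0)`, where `G = (J - z)⁻¹ δ_0`. It agrees with `m_-` for
`Im z > 0` and continues it to `regularSet`. -/
def mMinusExt (z : ℂ) : ℂ := (J.a 0 * J.green z 1 - 1) / (J.a 0 ^ 2 * J.green z 0)

variable {J}

theorem differentiableAt_mPlusExt (hz : z ∈ J.regularSet) :
    DifferentiableAt ℂ J.mPlusExt z :=
  ((differentiableAt_green hz 1).div ((differentiableAt_green hz 0).const_mul _)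
    (mul_ne_zero (a_ne_zero 0) (green_zero_ne_zero hz))).neg

theorem differentiableAt_mMinusExt (hz : z ∈ J.regularSet) :
    DifferentiableAt ℂ J.mMinusExt z :=
  (((differentiableAt_green hz 1).const_mul _).sub_const 1).div
    ((differentiableAt_green hz 0).const_mul _)
    (mul_ne_zero (pow_ne_zero _ (a_ne_zero 0)) (green_zero_ne_zero hz))

theorem mPlusExt_conj (hz : z ∈ J.regularSet) :
    J.mPlusExt ((starRingEnd ℂ) z) = (starRingEnd ℂ) (J.mPlusExt z) := by
  simp [mPlusExt, green_conj hz]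

theorem mMinusExt_conj (hz : z ∈ J.regularSet) :
    J.mMinusExt ((starRingEnd ℂ) z) = (starRingEnd ℂ) (J.mMinusExt z) := by
  simp [mMinusExt, green_conj hz]

theorem mPlusExt_add_mMinusExt (hz : z ∈ J.regularSet) :
    J.mPlusExt z + J.mMinusExt z = -1 / (J.a 0 ^ 2 * J.green z 0) := by
  have ha := a_ne_zero (J := J) 0
  have hG := green_zero_ne_zero hz
  rw [mPlusExt, mMinusExt]
  field_simp
  ring

theorem im_mPlusExt_pos (hz : 0 < z.im) : 0 < (J.mPlusExt z).im := by
  have hreg := mem_regularSet_of_im_pos (J := J) hz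
  have heq := green_apply_one hreg
  set v := truncate (Ici 1) (J.green z)
  have hv_mem : ∀ n, 1 ≤ n → v n = J.green z n := fun n hn =>
    truncate_apply_of_mem (mem_Ici.2 hn) _
  have hv_notMem : ∀ n, n < 1 → v n = 0 := fun n hn =>
    truncate_apply_of_notMem (notMem_Ici.2 hn) _
  have hv : v ≠ 0 := fun hv => by
    have hzero : ∀ n, 1 ≤ n → J.green z n = 0 := fun n hn => by simp [← hv_mem n hn, hv]
    rw [hzero 1 le_rfl, hzero 2 one_le_two] at heq
    exact mul_ne_zero (a_ne_zero 0) (green_zero_ne_zero hreg) (by simpa using heq)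
  have hJv : J.op v 1 - z * v 1 = -(J.a 0 * J.green z 0) := by
    rw [op_apply, hv_mem 1 le_rfl, hv_mem (1 + 1) (by norm_num), hv_notMem (1 - 1) (by norm_num),
      one_add_one_eq_two]
    linear_combination heq
  have hneg := im_op_sub_mul_conj_neg (m := 1) hz hv fun n hn hvn => by
    have h1n : 1 ≤ n := not_lt.1 fun h => hvn (hv_notMem n h)
    rw [op_apply, hv_mem n h1n, hv_mem (n + 1) (by lia), hv_mem (n - 1) (by lia),
      green_apply_eq hreg, if_neg (by lia), add_zero]
  rw [hJv, hv_mem 1 le_rfl] at hneg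
  rw [mPlusExt, ← neg_div]
  apply im_div_pos
  simp only [map_mul, conj_ofReal, mul_im, neg_im, neg_re, mul_re, ofReal_re, ofReal_im, conj_re,
    conj_im] at hneg ⊢
  linarith

theorem im_mMinusExt_pos (hz : 0 < z.im) : 0 < (J.mMinusExt z).im := by
  have hreg := mem_regularSet_of_im_pos (J := J) hz
  have heq := green_apply_zero hreg
  set v := truncate (Iic 0) (J.green z)
  have hv_mem : ∀ n, n ≤ 0 → v n = J.green z n := fun n hn =>
    truncate_apply_of_mem (mem_Iic.2 hn) _
  have hv_notMem : ∀ n, 0 < n → v n = 0 := fun n hn =>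
    truncate_apply_of_notMem (notMem_Iic.2 hn) _
  have hv : v ≠ 0 := fun hv =>
    green_zero_ne_zero hreg (by simp [← hv_mem 0 le_rfl, hv])
  have hJv : J.op v 0 - z * v 0 = 1 - J.a 0 * J.green z 1 := by
    rw [op_apply, hv_mem 0 le_rfl, hv_mem (0 - 1) (by norm_num), hv_notMem (0 + 1) (by norm_num),
      zero_sub]
    linear_combination heq
  have hneg := im_op_sub_mul_conj_neg (m := 0) hz hv fun n hn hvn => by
    have hn0 : n ≤ 0 := not_lt.1 fun h => hvn (hv_notMem n h)
    rw [op_apply, hv_mem n hn0, hv_mem (n + 1) (by lia), hv_mem (n - 1) (by lia),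
      green_apply_eq hreg, if_neg hn, add_zero]
  rw [hJv, hv_mem 0 le_rfl] at hneg
  rw [mMinusExt, ← div_div, div_right_comm, ← ofReal_pow, div_ofReal_im]
  refine div_pos (im_div_pos ?_) (pow_pos (J.a_pos 0) 2)
  rwa [← neg_sub, neg_mul, neg_im, neg_pos]

end JacobiMatrix

end Green

noncomputable section WeylSolutions

open Complex

theorem exists_orbit_int {X : Type*} (T : ℤ → X ≃ X) (x₀ : X) :
    ∃ F : ℤ → X, F 0 = x₀ ∧ ∀ n, F (n + 1) = T n (F n) := by
  let F : ℤ → X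
    | .ofNat n => Nat.rec x₀ (fun k x => T k x) n
    | .negSucc n => Nat.rec ((T (-1)).symm x₀) (fun k x => (T (.negSucc (k + 1))).symm x) n
  refine ⟨F, rfl, ?_⟩
  rintro (n | _ | n)
  · rfl
  · exact ((T (-1)).apply_symm_apply x₀).symm
  · exact ((T (.negSucc (n + 1))).apply_symm_apply (F (.negSucc n))).symm

theorem tendsto_zero_of_summable_norm_sq {E : Type*} [SeminormedAddGroup E] {f : ℕ → E}
    (h : Summable fun n => ‖f n‖ ^ 2) : Tendsto f atTop (𝓝 0) := by
  rw [tendsto_zero_iff_norm_tendsto_zero]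
  simpa [Function.comp_def] using (Real.continuous_sqrt.tendsto 0).comp h.tendsto_atTop_zero

namespace JacobiMatrix

section Solutions

variable (J : JacobiMatrix)

/-- The transfer map `(f(n), f(n + 1)) ↦ (f(n + 1), f(n + 2))` for solutions `f`. -/
def transfer (z : ℂ) (n : ℤ) : ℂ × ℂ ≃ ℂ × ℂ where
  toFun p := (p.2, ((z - J.b (n + 1)) * p.2 - J.a n * p.1) / J.a (n + 1))
  invFun p := (((z - J.b (n + 1)) * p.1 - J.a (n + 1) * p.2) / J.a n, p.1)
  left_inv p := by
    have := a_ne_zero (J := J) n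
    have := a_ne_zero (J := J) (n + 1)
    ext
    · field
    · rfl
  right_inv p := by
    have := a_ne_zero (J := J) n
    have := a_ne_zero (J := J) (n + 1)
    ext
    · rfl
    · field

theorem exists_isSolution (z α β : ℂ) : ∃ f : ℤ → ℂ, J.IsSolution z f ∧ f 0 = α ∧ f 1 = β := by
  obtain ⟨F, hF₀, hF⟩ := exists_orbit_int (J.transfer z) (α, β)
  have hsnd : ∀ n, (F (n + 1)).1 = (F n).2 := fun n => by rw [hF]; rfl
  refine ⟨fun n => (F n).1, fun n => ?_, by simp [hF₀], by simpa [hF₀] using hsnd 0⟩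
  have hn := congrArg Prod.snd (hF (n - 1))
  have hprev := hsnd (n - 1)
  have := a_ne_zero (J := J) n
  simp only [transfer, Equiv.coe_fn_mk, sub_add_cancel] at hn hprev
  rw [← hprev, eq_div_iff this] at hn
  linear_combination hn + J.a n * hsnd n

/-- The Wronskian of two functions on `ℤ`; it is constant if both solve the same equation. -/
def wronskian (f g : ℤ → ℂ) (n : ℤ) : ℂ := J.a n * (f n * g (n + 1) - f (n + 1) * g n)

variable {J} {z : ℂ} {f g : ℤ → ℂ}

theorem IsSolution.eq_of_nonneg (hf : J.IsSolution z f)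
    (hg : ∀ n : ℤ, 1 ≤ n → J.a n * g (n + 1) + J.a (n - 1) * g (n - 1) + J.b n * g n = z * g n)
    (hzero : f 0 = g 0) (hone : f 1 = g 1) (n : ℕ) : f n = g n ∧ f (n + 1) = g (n + 1) := by
  induction n with
  | zero => exact ⟨by simpa using hzero, by simpa using hone⟩
  | succ n ih =>
    push_cast
    refine ⟨ih.2, mul_left_cancel₀ (a_ne_zero (J := J) (n + 1)) ?_⟩
    have hfn := hf (n + 1)
    have hgn := hg (n + 1) (by lia)
    rw [add_sub_cancel_right] at hfn hgn
    rw [ih.1, ih.2] at hfn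
    linear_combination hfn - hgn

theorem IsSolution.eq_of_nonpos (hf : J.IsSolution z f)
    (hg : ∀ n : ℤ, n < 0 → J.a n * g (n + 1) + J.a (n - 1) * g (n - 1) + J.b n * g n = z * g n)
    (hzero : f 0 = g 0) (hneg_one : f (-1) = g (-1)) (n : ℕ) :
    f (-n) = g (-n) ∧ f (-n - 1) = g (-n - 1) := by
  induction n with
  | zero => exact ⟨by simpa using hzero, by simpa using hneg_one⟩
  | succ n ih =>
    push_cast
    rw [neg_add']
    refine ⟨ih.2, mul_left_cancel₀ (a_ne_zero (J := J) (-n - 1 - 1)) ?_⟩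
    have hfn := hf (-n - 1)
    have hgn := hg (-n - 1) (by lia)
    rw [sub_add_cancel] at hfn hgn
    rw [ih.1, ih.2] at hfn
    linear_combination hfn - hgn

theorem IsSolution.eq_zero (hf : J.IsSolution z f) (hzero : f 0 = 0) (hone : f 1 = 0) :
    f = 0 := by
  have hneg_one : f (-1) = 0 := by
    have := hf 0
    rw [zero_add, zero_sub, hzero, hone] at this
    simpa [(J.a_pos (-1)).ne'] using this
  funext n
  obtain ⟨k, rfl | rfl⟩ := n.eq_nat_or_neg
  · exact (hf.eq_of_nonneg (g := 0) (by simp) hzero hone k).1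
  · exact (hf.eq_of_nonpos (g := 0) (by simp) hzero hneg_one k).1

theorem wronskian_eq (hf : J.IsSolution z f) (hg : J.IsSolution z g) (n : ℤ) :
    J.wronskian f g n = J.wronskian f g 0 := by
  have hstep : ∀ n, J.wronskian f g n = J.wronskian f g (n - 1) := fun n => by
    simp only [wronskian, sub_add_cancel]
    linear_combination f n * hg n - g n * hf n
  induction n with
  | zero => rfl
  | succ i ih => rw [hstep, add_sub_cancel_right, ih]
  | pred i ih => rw [← hstep, ih]

theorem mul_eq_mul_of_tendsto_zero {α : Type*} {l : Filter α} [l.NeBot] {e : α → ℤ}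
    (hf : J.IsSolution z f) (hg : J.IsSolution z g)
    (hfe : Tendsto (fun n => f (e n)) l (𝓝 0)) (hge : Tendsto (fun n => g (e n)) l (𝓝 0))
    (hfe' : Tendsto (fun n => f (e n + 1)) l (𝓝 0))
    (hge' : Tendsto (fun n => g (e n + 1)) l (𝓝 0)) : f 0 * g 1 = f 1 * g 0 := by
  obtain ⟨C, hC⟩ := J.a_bdd
  have hbracket : Tendsto (fun n => f (e n) * g (e n + 1) - f (e n + 1) * g (e n)) l (𝓝 0) := by
    simpa using (hfe.mul hge').sub (hfe'.mul hge)
  have hwronskian : Tendsto (fun n => J.wronskian f g (e n)) l (𝓝 0) := by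
    rw [tendsto_zero_iff_norm_tendsto_zero] at hbracket ⊢
    refine squeeze_zero (fun n => norm_nonneg _) (fun n => ?_)
      (by simpa using hbracket.const_mul C)
    rw [wronskian, norm_mul, norm_real, Real.norm_eq_abs]
    gcongr
    exact hC _
  simp only [wronskian_eq hf hg] at hwronskian
  have hzero := tendsto_nhds_unique tendsto_const_nhds hwronskian
  rw [wronskian, zero_add] at hzero
  exact sub_eq_zero.1 ((mul_eq_zero.1 hzero).resolve_left (a_ne_zero 0))

theorem div_eq_div_of_mul_eq_mul (hf : f ≠ 0) (hg : g ≠ 0) (hfs : J.IsSolution z f)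
    (hgs : J.IsSolution z g) (h : f 0 * g 1 = f 1 * g 0) : f 1 / f 0 = g 1 / g 0 := by
  by_cases hf₀ : f 0 = 0
  · have hf₁ : f 1 ≠ 0 := fun hf₁ => hf (hfs.eq_zero hf₀ hf₁)
    rw [hf₀, zero_mul] at h
    rw [hf₀, (mul_eq_zero.1 h.symm).resolve_left hf₁, div_zero, div_zero]
  · have hg₀ : g 0 ≠ 0 := fun hg₀ => by
      rw [hg₀, mul_zero] at h
      exact hg (hgs.eq_zero hg₀ ((mul_eq_zero.1 h).resolve_left hf₀))
    rw [div_eq_div_iff hf₀ hg₀]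
    linear_combination -h

end Solutions

section WeylFunctions

variable {J : JacobiMatrix} {z : ℂ} {f g : ℤ → ℂ}

theorem IsWeylPlus.div_eq_div (hf : J.IsWeylPlus z f) (hg : J.IsWeylPlus z g) :
    f 1 / f 0 = g 1 / g 0 := by
  have hf_lim := tendsto_zero_of_summable_norm_sq hf.2.2
  have hg_lim := tendsto_zero_of_summable_norm_sq hg.2.2
  refine div_eq_div_of_mul_eq_mul hf.1 hg.1 hf.2.1 hg.2.1
    (mul_eq_mul_of_tendsto_zero hf.2.1 hg.2.1 hf_lim hg_lim ?_ ?_)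
  · exact_mod_cast hf_lim.comp (tendsto_add_atTop_nat 1)
  · exact_mod_cast hg_lim.comp (tendsto_add_atTop_nat 1)

theorem IsWeylMinus.div_eq_div (hf : J.IsWeylMinus z f) (hg : J.IsWeylMinus z g) :
    f 1 / f 0 = g 1 / g 0 := by
  have hf_lim := tendsto_zero_of_summable_norm_sq hf.2.2
  have hg_lim := tendsto_zero_of_summable_norm_sq hg.2.2
  refine div_eq_div_of_mul_eq_mul hf.1 hg.1 hf.2.1 hg.2.1
    (mul_eq_mul_of_tendsto_zero (e := fun n : ℕ => -((n + 1 : ℕ) : ℤ)) hf.2.1 hg.2.1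
      (hf_lim.comp (tendsto_add_atTop_nat 1)) (hg_lim.comp (tendsto_add_atTop_nat 1)) ?_ ?_)
  · simpa using hf_lim
  · simpa using hg_lim

theorem mPlus_eq (hf : J.IsWeylPlus z f) : J.mPlus z = -(f 1 / (J.a 0 * f 0)) := by
  have h : J.IsWeylPlus z (J.fPlus z) := Classical.epsilon_spec (p := J.IsWeylPlus z) ⟨f, hf⟩
  rw [mPlus, mul_comm, ← div_div, h.div_eq_div hf, div_div, mul_comm]

theorem mMinus_eq (hf : J.IsWeylMinus z f) : J.mMinus z = f 1 / (J.a 0 * f 0) := by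
  have h : J.IsWeylMinus z (J.fMinus z) := Classical.epsilon_spec (p := J.IsWeylMinus z) ⟨f, hf⟩
  rw [mMinus, mul_comm, ← div_div, h.div_eq_div hf, div_div, mul_comm]

theorem exists_isWeylPlus (hz : z ∈ J.regularSet) :
    ∃ f, J.IsWeylPlus z f ∧ f 0 = J.green z 0 ∧ f 1 = J.green z 1 := by
  obtain ⟨f, hf, hzero, hone⟩ := J.exists_isSolution z (J.green z 0) (J.green z 1)
  refine ⟨f, ⟨fun h => green_zero_ne_zero hz (by simp [← hzero, h]), hf, ?_⟩, hzero, hone⟩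
  have heq : ∀ n : ℕ, f n = J.green z n := fun n =>
    (hf.eq_of_nonneg (fun n hn => (green_apply_eq hz n).trans
      (by rw [if_neg (by lia), add_zero])) hzero hone n).1
  simp only [heq]
  exact (summable_sq_ellTwo (J.green z)).comp_injective Nat.cast_injective

theorem exists_isWeylMinus (hz : z ∈ J.regularSet) :
    ∃ f, J.IsWeylMinus z f ∧ f 0 = J.green z 0 ∧ J.a 0 * f 1 = J.a 0 * J.green z 1 - 1 := by
  obtain ⟨f, hf, hzero, hone⟩ := J.exists_isSolution z (J.green z 0)
    ((J.a 0 * J.green z 1 - 1) / J.a 0)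
  replace hone : J.a 0 * f 1 = J.a 0 * J.green z 1 - 1 := by
    rw [hone, mul_div_cancel₀ _ (a_ne_zero 0)]
  have hneg_one : f (-1) = J.green z (-1) := by
    have hf₀ := hf 0
    rw [zero_add, zero_sub, hzero] at hf₀
    refine mul_left_cancel₀ (a_ne_zero (J := J) (-1)) ?_
    linear_combination hf₀ - green_apply_zero hz - hone
  refine ⟨f, ⟨fun h => green_zero_ne_zero hz (by simp [← hzero, h]), hf, ?_⟩, hzero, hone⟩
  have heq : ∀ n : ℕ, f (-n) = J.green z (-n) := fun n =>
    (hf.eq_of_nonpos (fun n hn => (green_apply_eq hz n).trans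
      (by rw [if_neg hn.ne, add_zero])) hzero hneg_one n).1
  simp only [heq]
  exact (summable_sq_ellTwo (J.green z)).comp_injective
    (neg_injective.comp Nat.cast_injective)

theorem mPlus_eq_mPlusExt (hz : z ∈ J.regularSet) : J.mPlus z = J.mPlusExt z := by
  obtain ⟨f, hf, hzero, hone⟩ := exists_isWeylPlus hz
  rw [mPlus_eq hf, hzero, hone, mPlusExt]

theorem mMinus_eq_mMinusExt (hz : z ∈ J.regularSet) : J.mMinus z = J.mMinusExt z := by
  obtain ⟨f, hf, hzero, hone⟩ := exists_isWeylMinus hz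
  rw [mMinus_eq hf, hzero, mMinusExt, ← hone, sq, mul_assoc, mul_div_mul_left _ _ (a_ne_zero 0)]

end WeylFunctions

section Asymptotics

variable {J : JacobiMatrix} {z : ℂ}

theorem norm_green_le (hz : ‖J.op‖ < ‖z‖) : ‖J.green z‖ ≤ 1 / (‖z‖ - ‖J.op‖) := by
  rw [le_div_iff₀ (sub_pos.2 hz)]
  have hsmul : z • J.green z = J.op (J.green z) - deltaZero := by
    rw [← op_green (.inr hz), sub_sub_cancel]
  have hnorm : ‖z‖ * ‖J.green z‖ ≤ ‖J.op‖ * ‖J.green z‖ + 1 := by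
    rw [← norm_smul, hsmul]
    refine (norm_sub_le _ _).trans (add_le_add (J.op.le_opNorm _) ?_)
    rw [deltaZero, lp.norm_single (by norm_num), norm_one]
  linarith

theorem tendsto_green_apply (n : ℤ) :
    Tendsto (fun y : ℝ => J.green (y * I) n) atTop (𝓝 0) := by
  have hbound : Tendsto (fun y : ℝ => 1 / (y - ‖J.op‖)) atTop (𝓝 0) :=
    tendsto_const_nhds.div_atTop (tendsto_atTop_add_const_right _ _ tendsto_id)
  rw [tendsto_zero_iff_norm_tendsto_zero]
  refine squeeze_zero' (.of_forall fun y => norm_nonneg _) ?_ hbound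
  filter_upwards [eventually_gt_atTop ‖J.op‖] with y hy
  have hnorm : ‖(y * I : ℂ)‖ = y := by simp [abs_of_pos ((norm_nonneg _).trans_lt hy)]
  have hgreen := norm_green_le (J := J) (z := y * I) (by rwa [hnorm])
  rw [hnorm] at hgreen
  exact (lp.norm_apply_le_norm (by norm_num) _ n).trans hgreen

theorem eventually_mul_I_mem_regularSet : ∀ᶠ y : ℝ in atTop, (y * I : ℂ) ∈ J.regularSet := by
  filter_upwards [eventually_gt_atTop 0] with y hy
  exact mem_regularSet_of_im_pos (by simpa using hy)

theorem tendsto_mul_green_apply (n : ℤ) :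
    Tendsto (fun y : ℝ => y * I * J.green (y * I) n) atTop (𝓝 (if n = 0 then -1 else 0)) := by
  have hlim := ((((tendsto_green_apply (J := J) (n + 1)).const_mul (J.a n : ℂ)).add
    ((tendsto_green_apply (J := J) (n - 1)).const_mul (J.a (n - 1) : ℂ))).add
    ((tendsto_green_apply (J := J) n).const_mul (J.b n : ℂ))).sub_const (if n = 0 then 1 else 0)
  have hval : (J.a n * 0 + J.a (n - 1) * 0 + J.b n * 0 - if n = 0 then 1 else 0 : ℂ) =
      if n = 0 then -1 else 0 := by split_ifs <;> simp
  rw [hval] at hlim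
  refine hlim.congr' ?_
  filter_upwards [eventually_mul_I_mem_regularSet] with y hy
  rw [green_apply_eq hy, add_sub_cancel_right]

theorem tendsto_sq_mul_green_apply {n : ℤ} (hn : n ≠ 0) :
    Tendsto (fun y : ℝ => (y * I) ^ 2 * J.green (y * I) n) atTop
      (𝓝 (J.a n * (if n + 1 = 0 then -1 else 0) + J.a (n - 1) * if n - 1 = 0 then -1 else 0)) := by
  have hlim := (((tendsto_mul_green_apply (J := J) (n + 1)).const_mul (J.a n : ℂ)).add
    ((tendsto_mul_green_apply (J := J) (n - 1)).const_mul (J.a (n - 1) : ℂ))).add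
    ((tendsto_mul_green_apply (J := J) n).const_mul (J.b n : ℂ))
  rw [if_neg hn, mul_zero, add_zero] at hlim
  refine hlim.congr' ?_
  filter_upwards [eventually_mul_I_mem_regularSet] with y hy
  have heq := green_apply_eq hy n
  rw [if_neg hn] at heq
  linear_combination (y * I) * heq

theorem tendsto_mul_mPlusExt :
    Tendsto (fun y : ℝ => y * I * J.mPlusExt (y * I)) atTop (𝓝 (-1)) := by
  have ha := a_ne_zero (J := J) 0
  have hlim := ((tendsto_sq_mul_green_apply (J := J) one_ne_zero).div
    ((tendsto_mul_green_apply (J := J) 0).const_mul (J.a 0 : ℂ)) (by simpa using ha)).neg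
  simp only [Int.reduceAdd, OfNat.ofNat_ne_zero, if_false, mul_zero, zero_add, sub_self, if_true,
    div_self (mul_ne_zero ha (neg_ne_zero.2 one_ne_zero))] at hlim
  refine hlim.congr' ?_
  filter_upwards [eventually_mul_I_mem_regularSet, eventually_gt_atTop 0] with y hy hy0
  have hg := green_zero_ne_zero hy
  have hy' : (y : ℂ) ≠ 0 := by exact_mod_cast hy0.ne'
  simp only [mPlusExt, Pi.div_apply]
  field_simp

theorem tendsto_mul_mMinusExt_sub :
    Tendsto (fun y : ℝ => y * I * (J.a 0 ^ 2 * J.mMinusExt (y * I) - y * I + J.b 0)) atTop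
      (𝓝 (-(J.a (-1) : ℂ) ^ 2)) := by
  have ha := a_ne_zero (J := J) 0
  have hlim := ((tendsto_sq_mul_green_apply (J := J) (n := -1) (by norm_num)).div
    (tendsto_mul_green_apply (J := J) 0) (by simp)).const_mul (-(J.a (-1) : ℂ))
  have hval : -(J.a (-1) : ℂ) * ((J.a (-1) * (if (-1 : ℤ) + 1 = 0 then -1 else 0) +
      J.a (-1 - 1) * if (-1 : ℤ) - 1 = 0 then -1 else 0) / if (0 : ℤ) = 0 then -1 else 0) =
      -(J.a (-1) : ℂ) ^ 2 := by norm_num [sq]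
  rw [hval] at hlim
  refine hlim.congr' ?_
  filter_upwards [eventually_mul_I_mem_regularSet, eventually_gt_atTop 0] with y hy hy0
  have hg := green_zero_ne_zero hy
  have hy' : (y : ℂ) ≠ 0 := by exact_mod_cast hy0.ne'
  have hgreen : J.a 0 * J.green (y * I) 1 - 1 =
      (y * I - J.b 0) * J.green (y * I) 0 - J.a (-1) * J.green (y * I) (-1) := by
    linear_combination green_apply_zero hy
  simp only [mMinusExt, Pi.div_apply, hgreen]
  field_simp
  ring

end Asymptotics

end JacobiMatrix

end WeylSolutions

noncomputable section Reflectionless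

open Complex Set

theorem differentiableAt_cayley {z : ℂ} (hz : z + I ≠ 0) : DifferentiableAt ℂ cayley z := by
  unfold cayley
  fun_prop (disch := exact hz)

theorem dense_im_ne_zero : Dense {z : ℂ | z.im ≠ 0} :=
  (dense_compl_singleton (0 : ℝ)).preimage isOpenMap_im

theorem norm_lt_of_dense {U S : Set ℂ} {E : ℂ → ℂ} {C : ℝ} (hU : IsOpen U) (hS : Dense S)
    (hd : DifferentiableOn ℂ E U) (hlt : ∀ z ∈ S ∩ U, ‖E z‖ < C) : ∀ z ∈ U, ‖E z‖ < C := by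
  have hfreq : ∀ z, ∃ᶠ w in 𝓝 z, w ∈ S := fun z => mem_closure_iff_frequently.1 (hS z)
  have hdz : ∀ z ∈ U, DifferentiableAt ℂ E z := fun z hz => hd.differentiableAt (hU.mem_nhds hz)
  have hev : ∀ z ∈ U, ∀ᶠ w in 𝓝 z, w ∈ U := fun z hz => hU.mem_nhds hz
  have hle : ∀ z ∈ U, ‖E z‖ ≤ C := fun z hz => by
    by_contra! hgt
    obtain ⟨w, hwS, hwU, hw⟩ := ((hfreq z).and_eventually ((hev z hz).and
      ((hdz z hz).continuousAt.norm.eventually (lt_mem_nhds hgt)))).exists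
    exact (hlt w ⟨hwS, hwU⟩).not_gt hw
  intro z hz
  refine (hle z hz).lt_of_ne fun heq => ?_
  have hmax : IsLocalMax (norm ∘ E) z := by
    filter_upwards [hev z hz] with w hw
    simpa only [Function.comp_apply, heq] using hle w hw
  have hconst := Complex.eventually_eq_of_isLocalMax_norm
    (by filter_upwards [hev z hz] using hdz) hmax
  obtain ⟨w, hwS, hwU, hw⟩ :=
    ((hfreq z).and_eventually ((hev z hz).and hconst)).exists
  exact (hlt w ⟨hwS, hwU⟩).ne (by rw [hw, heq])

theorem exists_holomorphic_gluing_of_im_pos {h : ℂ → ℂ} {α β : ℝ}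
    (hd : ∀ z : ℂ, z.im ≠ 0 → DifferentiableAt ℂ h z) (hpos : ∀ z : ℂ, z.im ≠ 0 → 0 < (h z).im)
    (hlim : ∀ᵐ x : ℝ, x ∈ Ioo α β →
      ∃ l, Tendsto (fun y : ℝ => h (x + y * I)) (𝓝[≠] 0) (𝓝 l)) :
    ∃ F : ℂ → ℂ, (∀ z : ℂ, z.im ≠ 0 → F z = h z) ∧
      ∀ z : ℂ, (z.im ≠ 0 ∨ z.re ∈ Ioo α β) → DifferentiableAt ℂ F z ∧ 0 < (F z).im := by
  have hne : ∀ {w : ℂ}, 0 ≤ w.im → w + I ≠ 0 := fun {w} hw h0 => by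
    have := congrArg Complex.im h0
    simp only [add_im, I_im, zero_im] at this
    linarith
  have hne' : ∀ z : ℂ, z.im ≠ 0 → h z + I ≠ 0 := fun z hz => hne (hpos z hz).le
  obtain ⟨E, hEh, hEd⟩ := exists_holomorphic_gluing (h := fun z => cayley (h z)) (C := 1)
    (a := α) (b := β) (fun z hz => (differentiableAt_cayley (hne' z hz)).comp z (hd z hz))
    (fun z hz => (norm_cayley_lt_one (hpos z hz)).le) (by
      filter_upwards [hlim] with x hx hxm
      obtain ⟨l, hl⟩ := hx hxm
      have hl_im : 0 ≤ l.im := by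
        refine ge_of_tendsto ((continuous_im.tendsto l).comp hl) ?_
        filter_upwards [self_mem_nhdsWithin] with y hy
        exact (hpos _ (by simpa using hy)).le
      exact ⟨cayley l,
        (differentiableAt_cayley (hne hl_im)).continuousAt.tendsto.comp hl⟩)
  have hD : IsOpen {z : ℂ | z.im ≠ 0 ∨ z.re ∈ Ioo α β} :=
    isOpen_im_ne_zero.union (isOpen_Ioo.preimage continuous_re)
  have hElt := norm_lt_of_dense hD dense_im_ne_zero
    (fun z hz => (hEd z hz).differentiableWithinAt)
    (fun z hz => by rw [hEh z hz.1]; exact norm_cayley_lt_one (hpos z hz.1))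
  refine ⟨fun z => cayleyInv (E z), fun z hz => ?_, fun z hz =>
    ⟨(differentiableAt_cayleyInv (hElt z hz)).comp z (hEd z hz), im_cayleyInv_pos (hElt z hz)⟩⟩
  simp only [hEh z hz, cayleyInv_cayley (hne' z hz)]

theorem tendsto_add_mul_I (z : ℂ) : Tendsto (fun y : ℝ => z + y * I) (𝓝[>] 0) (𝓝 z) := by
  have hcont : Continuous fun y : ℝ => z + y * I := by fun_prop
  simpa using (hcont.tendsto 0).mono_left nhdsWithin_le_nhds

theorem summable_natCast_add {M : Type*} [AddCommGroup M] [TopologicalSpace M]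
    [IsTopologicalAddGroup M] {g : ℤ → M} (h : Summable fun n : ℕ => g n) (k : ℤ) :
    Summable fun n : ℕ => g (n + k) := by
  obtain ⟨j, rfl | rfl⟩ := k.eq_nat_or_neg
  · simpa using (summable_nat_add_iff j).2 h
  · exact (summable_nat_add_iff j).1 (by simpa using h)

namespace JacobiMatrix

variable {J : JacobiMatrix} {z : ℂ} {α β : ℝ}

section Extension

variable (J) in
/-- The function equal to `m_+` on the upper half plane and to the continuation of `-m_-` on the
lower half plane. -/
def weylGluing (z : ℂ) : ℂ := if 0 < z.im then J.mPlusExt z else -J.mMinusExt z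

theorem weylGluing_of_im_pos (hz : 0 < z.im) : J.weylGluing z = J.mPlusExt z := if_pos hz

theorem weylGluing_of_im_neg (hz : z.im < 0) : J.weylGluing z = -J.mMinusExt z :=
  if_neg hz.not_gt

theorem mMinusExt_eq_of_im_neg (hz : z.im < 0) :
    J.mMinusExt z = (starRingEnd ℂ) (J.mMinusExt ((starRingEnd ℂ) z)) := by
  rw [← mMinusExt_conj (.inl (by simpa using hz.ne)), conj_conj]

theorem im_weylGluing_pos (hz : z.im ≠ 0) : 0 < (J.weylGluing z).im := by
  rcases hz.lt_or_gt with hneg | hpos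
  · rw [weylGluing_of_im_neg hneg, mMinusExt_eq_of_im_neg hneg, neg_im, conj_im, neg_neg]
    exact im_mMinusExt_pos (by simpa using hneg)
  · rw [weylGluing_of_im_pos hpos]
    exact im_mPlusExt_pos hpos

theorem differentiableAt_weylGluing (hz : z.im ≠ 0) : DifferentiableAt ℂ J.weylGluing z := by
  rcases hz.lt_or_gt with hneg | hpos
  · refine (differentiableAt_mMinusExt (J := J) (.inl hz)).neg.congr_of_eventuallyEq ?_
    filter_upwards [(isOpen_lt continuous_im continuous_const).mem_nhds hneg] with w hw
    exact weylGluing_of_im_neg hw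
  · refine (differentiableAt_mPlusExt (J := J) (.inl hz)).congr_of_eventuallyEq ?_
    filter_upwards [(isOpen_lt continuous_const continuous_im).mem_nhds hpos] with w hw
    exact weylGluing_of_im_pos hw

theorem tendsto_weylGluing {x : ℝ} {p q : ℂ}
    (hp : Tendsto (fun y : ℝ => J.mPlus (x + y * I)) (𝓝[>] 0) (𝓝 p))
    (hq : Tendsto (fun y : ℝ => J.mMinus (x + y * I)) (𝓝[>] 0) (𝓝 q))
    (hpq : p = -(starRingEnd ℂ) q) :
    Tendsto (fun y : ℝ => J.weylGluing (x + y * I)) (𝓝[≠] 0) (𝓝 p) := by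
  have hupper : Tendsto (fun y : ℝ => J.weylGluing (x + y * I)) (𝓝[>] 0) (𝓝 p) := by
    refine hp.congr' ?_
    filter_upwards [self_mem_nhdsWithin] with y hy
    have hpos : 0 < (x + y * I : ℂ).im := by simpa using hy
    rw [weylGluing_of_im_pos hpos, mPlus_eq_mPlusExt (mem_regularSet_of_im_pos hpos)]
  have hlower : Tendsto (fun y : ℝ => J.weylGluing (x + y * I)) (𝓝[<] 0) (𝓝 p) := by
    have hneg : Tendsto (fun y : ℝ => -y) (𝓝[<] 0) (𝓝[>] 0) := by
      simpa using tendsto_neg_nhdsLT (a := (0 : ℝ))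
    have hconj := ((continuous_conj.tendsto q).comp (hq.comp hneg)).neg
    rw [← hpq] at hconj
    refine hconj.congr' ?_
    filter_upwards [self_mem_nhdsWithin] with y hy
    have hy : y < 0 := hy
    have heq : (x + (-y : ℝ) * I : ℂ) = (starRingEnd ℂ) (x + y * I) := by simp
    rw [weylGluing_of_im_neg (by simpa using hy), mMinusExt_eq_of_im_neg (by simpa using hy), ← heq,
      ← mMinus_eq_mMinusExt (mem_regularSet_of_im_pos (by simpa using hy))]
    rfl
  rw [← Iio_union_Ioi, nhdsWithin_union]
  exact hlower.sup hupper

theorem IsReflectionlessOn.exists_extension (hJ : J.IsReflectionlessOn (Ioo α β)) :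
    ∃ F : ℂ → ℂ, (∀ z : ℂ, (z.im ≠ 0 ∨ z.re ∈ Ioo α β) →
      DifferentiableAt ℂ F z ∧ 0 < (F z).im) ∧
      (∀ z : ℂ, 0 < z.im → F z = J.mPlusExt z) ∧ ∀ z : ℂ, z.im < 0 → F z = -J.mMinusExt z := by
  obtain ⟨F, hFeq, hF⟩ := exists_holomorphic_gluing_of_im_pos (α := α) (β := β)
    (fun z => differentiableAt_weylGluing (J := J)) (fun z => im_weylGluing_pos)
    (hJ.mono fun x hx hxm => by
      obtain ⟨p, q, hp, hq, hpq⟩ := hx hxm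
      exact ⟨p, tendsto_weylGluing hp hq hpq⟩)
  exact ⟨F, hF, fun z hz => (hFeq z hz.ne').trans (weylGluing_of_im_pos hz),
    fun z hz => (hFeq z hz.ne).trans (weylGluing_of_im_neg hz)⟩

theorem IsReflectionlessOn.exists_tendsto (hJ : J.IsReflectionlessOn (Ioo α β)) {x : ℝ}
    (hx : x ∈ Ioo α β) :
    ∃ w : ℂ, 0 < w.im ∧ Tendsto (fun y : ℝ => J.mPlus (x + y * I)) (𝓝[>] 0) (𝓝 w) ∧
      Tendsto (fun y : ℝ => J.mMinus (x + y * I)) (𝓝[>] 0) (𝓝 (-(starRingEnd ℂ) w)) := by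
  obtain ⟨F, hF, hF_upper, hF_lower⟩ := hJ.exists_extension
  obtain ⟨hFd, hFpos⟩ := hF x (.inr (by simpa using hx))
  have hlim := tendsto_add_mul_I x
  refine ⟨F x, hFpos, (hFd.continuousAt.tendsto.comp hlim).congr' ?_, ?_⟩
  · filter_upwards [self_mem_nhdsWithin] with y hy
    have hpos : 0 < (x + y * I : ℂ).im := by simpa using hy
    rw [mPlus_eq_mPlusExt (mem_regularSet_of_im_pos hpos), ← hF_upper _ hpos]
    rfl
  · have hconj : Tendsto (fun y : ℝ => (starRingEnd ℂ) (x + y * I : ℂ)) (𝓝[>] 0) (𝓝 x) := by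
      simpa [Function.comp_def] using (continuous_conj.tendsto (x : ℂ)).comp hlim
    refine ((continuous_conj.tendsto _).comp
      (hFd.continuousAt.tendsto.comp hconj)).neg.congr' ?_
    filter_upwards [self_mem_nhdsWithin] with y hy
    have hy : 0 < y := hy
    simp only [Function.comp_apply]
    rw [hF_lower _ (by simpa using hy), mMinusExt_eq_of_im_neg (by simpa using hy), conj_conj,
      map_neg, conj_conj, neg_neg,
      mMinus_eq_mMinusExt (mem_regularSet_of_im_pos (by simpa using hy))]

end Extension

section Shift

/-- The translate of `J` by `k`. -/
def shift (J : JacobiMatrix) (k : ℤ) : JacobiMatrix where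
  a n := J.a (n + k)
  b n := J.b (n + k)
  a_pos _ := J.a_pos _
  a_bdd := J.a_bdd.imp fun _ h _ => h _
  b_bdd := J.b_bdd.imp fun _ h _ => h _

variable (J) in
theorem shift_shift (k l : ℤ) : (J.shift k).shift l = J.shift (l + k) := by
  simp only [shift, add_assoc]

variable (J) in
theorem shift_zero : J.shift 0 = J := by
  simp [shift]

variable (J) in
theorem norm_op_shift_le (k : ℤ) : ‖(J.shift k).op‖ ≤ ‖J.op‖ := by
  have hconj : (J.shift k).op =
      permCLM (Equiv.addRight k) ∘L J.op ∘L permCLM (Equiv.subRight k) := by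
    ext u n
    simp only [ContinuousLinearMap.comp_apply, permCLM_apply, op_apply, Equiv.coe_addRight,
      Equiv.subRight_apply, shift]
    ring_nf
  rw [hconj]
  calc _ ≤ ‖permCLM (Equiv.addRight k)‖ * (‖J.op‖ * ‖permCLM (Equiv.subRight k)‖) := by
        grw [ContinuousLinearMap.opNorm_comp_le, ContinuousLinearMap.opNorm_comp_le]
    _ ≤ 1 * (‖J.op‖ * 1) := by gcongr <;> exact norm_permCLM_le _
    _ = ‖J.op‖ := by ring

variable {f : ℤ → ℂ}

theorem IsSolution.shift (hf : J.IsSolution z f) (k : ℤ) :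
    (J.shift k).IsSolution z fun n => f (n + k) := fun n => by
  simpa only [JacobiMatrix.shift, add_right_comm, sub_add_eq_add_sub] using hf (n + k)

theorem comp_add_ne_zero (hf : f ≠ 0) (k : ℤ) : (fun n => f (n + k)) ≠ 0 := fun h =>
  hf (funext fun n => by simpa using congrFun h (n - k))

theorem IsWeylPlus.shift (hf : J.IsWeylPlus z f) (k : ℤ) :
    (J.shift k).IsWeylPlus z fun n => f (n + k) :=
  ⟨comp_add_ne_zero hf.1 k, hf.2.1.shift k,
    summable_natCast_add (g := fun n => ‖f n‖ ^ 2) hf.2.2 k⟩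

theorem IsWeylMinus.shift (hf : J.IsWeylMinus z f) (k : ℤ) :
    (J.shift k).IsWeylMinus z fun n => f (n + k) := by
  refine ⟨comp_add_ne_zero hf.1 k, hf.2.1.shift k, ?_⟩
  simpa [add_comm] using summable_natCast_add (g := fun n => ‖f (-n)‖ ^ 2) hf.2.2 (-k)

theorem im_mPlus_pos (hz : 0 < z.im) : 0 < (J.mPlus z).im := by
  rw [mPlus_eq_mPlusExt (mem_regularSet_of_im_pos hz)]
  exact im_mPlusExt_pos hz

theorem im_mMinus_pos (hz : 0 < z.im) : 0 < (J.mMinus z).im := by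
  rw [mMinus_eq_mMinusExt (mem_regularSet_of_im_pos hz)]
  exact im_mMinusExt_pos hz

theorem mPlus_ne_zero (hz : 0 < z.im) : J.mPlus z ≠ 0 := fun h => by
  simpa [h] using im_mPlus_pos (J := J) hz

theorem mMinus_ne_zero (hz : 0 < z.im) : J.mMinus z ≠ 0 := fun h => by
  simpa [h] using im_mMinus_pos (J := J) hz

theorem mPlus_shift_one (hz : 0 < z.im) :
    (J.shift 1).mPlus z = -(z - J.b 1 + 1 / J.mPlus z) / J.a 1 ^ 2 := by
  obtain ⟨f, hf, -, -⟩ := exists_isWeylPlus (mem_regularSet_of_im_pos (J := J) hz)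
  have hm := mPlus_ne_zero (J := J) hz
  rw [mPlus_eq hf] at hm
  have : f 0 ≠ 0 := fun h => hm (by simp [h])
  have hf₁ : f 1 ≠ 0 := fun h => hm (by simp [h])
  have := a_ne_zero (J := J) 0
  have ha₁ := a_ne_zero (J := J) 1
  have heq : J.a 1 * f 2 + J.a 0 * f 0 + J.b 1 * f 1 = z * f 1 := by simpa using hf.2.1 1
  rw [mPlus_eq (hf.shift 1), mPlus_eq hf]
  simp only [JacobiMatrix.shift, zero_add, one_add_one_eq_two]
  field_simp
  linear_combination -heq

theorem mMinus_shift_one (hz : 0 < z.im) :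
    (J.shift 1).mMinus z = (z - J.b 1 - 1 / J.mMinus z) / J.a 1 ^ 2 := by
  obtain ⟨f, hf, -, -⟩ := exists_isWeylMinus (mem_regularSet_of_im_pos (J := J) hz)
  have hm := mMinus_ne_zero (J := J) hz
  rw [mMinus_eq hf] at hm
  have : f 0 ≠ 0 := fun h => hm (by simp [h])
  have hf₁ : f 1 ≠ 0 := fun h => hm (by simp [h])
  have := a_ne_zero (J := J) 0
  have ha₁ := a_ne_zero (J := J) 1
  have heq : J.a 1 * f 2 + J.a 0 * f 0 + J.b 1 * f 1 = z * f 1 := by simpa using hf.2.1 1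
  rw [mMinus_eq (hf.shift 1), mMinus_eq hf]
  simp only [JacobiMatrix.shift, zero_add, one_add_one_eq_two]
  field_simp
  linear_combination heq

theorem mPlus_shift_neg_one (hz : 0 < z.im) :
    (J.shift (-1)).mPlus z = -1 / (z - J.b 0 + J.a 0 ^ 2 * J.mPlus z) := by
  have hshift := mPlus_shift_one (J := J.shift (-1)) hz
  have ha : (J.shift (-1)).a 1 = J.a 0 := by simp [shift]
  have hb : (J.shift (-1)).b 1 = J.b 0 := by simp [shift]
  rw [shift_shift, add_neg_cancel, shift_zero, ha, hb] at hshift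
  rw [hshift, mul_div_cancel₀ _ (pow_ne_zero 2 (a_ne_zero 0))]
  simp only [neg_add, add_neg_cancel_left, neg_div_neg_eq, one_div_one_div]

theorem mMinus_shift_neg_one (hz : 0 < z.im) :
    (J.shift (-1)).mMinus z = 1 / (z - J.b 0 - J.a 0 ^ 2 * J.mMinus z) := by
  have hshift := mMinus_shift_one (J := J.shift (-1)) hz
  have ha : (J.shift (-1)).a 1 = J.a 0 := by simp [shift]
  have hb : (J.shift (-1)).b 1 = J.b 0 := by simp [shift]
  rw [shift_shift, add_neg_cancel, shift_zero, ha, hb] at hshift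
  rw [hshift, mul_div_cancel₀ _ (pow_ne_zero 2 (a_ne_zero 0))]
  simp

theorem IsReflectionlessOn.shift_one (hJ : J.IsReflectionlessOn (Ioo α β)) :
    (J.shift 1).IsReflectionlessOn (Ioo α β) := by
  refine ae_of_all _ fun x hx => ?_
  obtain ⟨w, hw, hp, hm⟩ := hJ.exists_tendsto hx
  have hw₀ : w ≠ 0 := by rintro rfl; simp at hw
  have hconj₀ : -(starRingEnd ℂ) w ≠ 0 := by simpa using hw₀
  refine ⟨-(x - J.b 1 + 1 / w) / J.a 1 ^ 2,
    (x - J.b 1 - 1 / (-(starRingEnd ℂ) w)) / J.a 1 ^ 2, ?_, ?_, ?_⟩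
  · refine ((((tendsto_add_mul_I x).sub_const _).add
      (tendsto_const_nhds.div hp hw₀)).neg.div_const _).congr' ?_
    filter_upwards [self_mem_nhdsWithin] with y hy
    exact (mPlus_shift_one (by simpa using hy)).symm
  · refine ((((tendsto_add_mul_I x).sub_const _).sub
      (tendsto_const_nhds.div hm hconj₀)).div_const _).congr' ?_
    filter_upwards [self_mem_nhdsWithin] with y hy
    exact (mMinus_shift_one (by simpa using hy)).symm
  · simp only [map_div₀, map_sub, map_pow, map_one, map_neg, conj_ofReal, conj_conj]
    ring

theorem IsReflectionlessOn.shift_neg_one (hJ : J.IsReflectionlessOn (Ioo α β)) :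
    (J.shift (-1)).IsReflectionlessOn (Ioo α β) := by
  refine ae_of_all _ fun x hx => ?_
  obtain ⟨w, hw, hp, hm⟩ := hJ.exists_tendsto hx
  have hp₀ : (x - J.b 0 + J.a 0 ^ 2 * w : ℂ) ≠ 0 := fun h => by
    have him := congrArg Complex.im h
    simp [← ofReal_pow, (J.a_pos 0).ne', hw.ne'] at him
  have hm₀ : (x - J.b 0 - J.a 0 ^ 2 * (-(starRingEnd ℂ) w) : ℂ) ≠ 0 := fun h => by
    have hconj := congrArg (starRingEnd ℂ) h
    exact hp₀ (by simpa using hconj)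
  refine ⟨-1 / (x - J.b 0 + J.a 0 ^ 2 * w),
    1 / (x - J.b 0 - J.a 0 ^ 2 * (-(starRingEnd ℂ) w)), ?_, ?_, by simp [neg_div]⟩
  · refine (tendsto_const_nhds.div (((tendsto_add_mul_I x).sub_const _).add
      (hp.const_mul _)) hp₀).congr' ?_
    filter_upwards [self_mem_nhdsWithin] with y hy
    exact (mPlus_shift_neg_one (by simpa using hy)).symm
  · refine (tendsto_const_nhds.div (((tendsto_add_mul_I x).sub_const _).sub
      (hm.const_mul _)) hm₀).congr' ?_
    filter_upwards [self_mem_nhdsWithin] with y hy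
    exact (mMinus_shift_neg_one (by simpa using hy)).symm

theorem IsReflectionlessOn.shift (hJ : J.IsReflectionlessOn (Ioo α β)) (k : ℤ) :
    (J.shift k).IsReflectionlessOn (Ioo α β) := by
  induction k with
  | zero => rwa [shift_zero]
  | succ i ih => rw [add_comm, ← shift_shift]; exact ih.shift_one
  | pred i ih => rw [sub_eq_add_neg, add_comm, ← shift_shift]; exact ih.shift_neg_one

end Shift

end JacobiMatrix

end Reflectionless

noncomputable section Joukowsky

open Complex Set

/-- The map `λ ↦ -λ - 1 / λ`, which maps the upper half plane conformally onto the complement of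
`(-∞, -2] ∪ [2, ∞)`. -/
def joukowsky (l : ℂ) : ℂ := -(l + l⁻¹)

theorem joukowsky_inv (l : ℂ) : joukowsky l⁻¹ = joukowsky l := by
  rw [joukowsky, joukowsky, inv_inv, add_comm]

theorem joukowsky_ofReal (t : ℝ) : joukowsky t = (-(t + 1 / t) : ℝ) := by
  simp [joukowsky]

theorem joukowsky_mul_I (y : ℝ) : joukowsky (y * I) = (1 / y - y : ℝ) * I := by
  rw [joukowsky, mul_inv, inv_I]
  push_cast
  ring

theorem differentiableAt_joukowsky {l : ℂ} (hl : l ≠ 0) : DifferentiableAt ℂ joukowsky l := by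
  unfold joukowsky
  fun_prop (disch := assumption)

theorem im_joukowsky (l : ℂ) : (joukowsky l).im = l.im * ((normSq l)⁻¹ - 1) := by
  rw [joukowsky, neg_im, add_im, inv_im]
  ring

theorem ne_zero_of_im_pos {l : ℂ} (hl : 0 < l.im) : l ≠ 0 := by
  rintro rfl
  simp at hl

theorem im_joukowsky_pos {l : ℂ} (hl : 0 < l.im) (hlt : ‖l‖ < 1) : 0 < (joukowsky l).im := by
  rw [im_joukowsky, normSq_eq_norm_sq]
  refine mul_pos hl (sub_pos.2 ((one_lt_inv₀ ?_).2 (pow_lt_one₀ (norm_nonneg l) hlt two_ne_zero)))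
  exact pow_pos (norm_pos_iff.2 (ne_zero_of_im_pos hl)) 2

theorem im_joukowsky_neg {l : ℂ} (hl : 0 < l.im) (hgt : 1 < ‖l‖) : (joukowsky l).im < 0 := by
  rw [im_joukowsky, normSq_eq_norm_sq]
  exact mul_neg_of_pos_of_neg hl (sub_neg.2 (inv_lt_one_of_one_lt₀ (one_lt_pow₀ hgt two_ne_zero)))

theorem joukowsky_mem_slit {l : ℂ} (hl : 0 < l.im) :
    (joukowsky l).im ≠ 0 ∨ (joukowsky l).re ∈ Ioo (-2 : ℝ) 2 := by
  rcases lt_trichotomy ‖l‖ 1 with hlt | heq | hgt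
  · exact .inl (im_joukowsky_pos hl hlt).ne'
  · right
    have hsq : normSq l = 1 := by rw [normSq_eq_norm_sq, heq, one_pow]
    have hre : (joukowsky l).re = -(2 * l.re) := by
      rw [joukowsky, neg_re, add_re, inv_re, hsq]
      ring
    rw [normSq_apply] at hsq
    rw [hre]
    constructor <;> nlinarith
  · exact .inl (im_joukowsky_neg hl hgt).ne

theorem add_one_div_lt {r x : ℝ} (hr1 : r ≤ 1) (hx : 0 < x) (hxr : x < r) :
    r + 1 / r < x + 1 / x := by
  have hr : 0 < r := hx.trans hxr
  have hdiff : x + 1 / x - (r + 1 / r) = (r - x) * (1 - x * r) / (x * r) := by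
    field_simp
    ring
  have : 0 < r - x := sub_pos.2 hxr
  have : 0 < 1 - x * r := by nlinarith
  exact sub_pos.1 (hdiff ▸ by positivity)

theorem isOpen_gapSet (r : ℝ) : IsOpen (gapSet r) :=
  isOpen_ne.inter ((isOpen_lt continuous_abs continuous_const).union
    (isOpen_lt continuous_const continuous_abs))

theorem norm_ofReal_ne_one_of_mem_gapSet {r t : ℝ} (hr : 0 < r) (hr1 : r ≤ 1)
    (ht : t ∈ gapSet r) : ‖(t : ℂ)‖ ≠ 1 := by
  rw [norm_real, Real.norm_eq_abs]
  rcases ht.2 with hlt | hgt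
  · exact (hlt.trans_le hr1).ne
  · exact (((one_le_div hr).2 hr1).trans_lt hgt).ne'

theorem add_one_div_lt_abs_of_mem_gapSet {r t : ℝ} (hr : 0 < r) (hr1 : r ≤ 1)
    (ht : t ∈ gapSet r) : r + 1 / r < |-(t + 1 / t)| := by
  have habs : |-(t + 1 / t)| = |t| + 1 / |t| := by
    rw [abs_neg]
    rcases ht.1.lt_or_gt with hneg | hpos
    · rw [abs_of_neg hneg, abs_of_neg (add_neg hneg (one_div_neg.2 hneg)),
        one_div_neg_eq_neg_one_div, neg_add]
    · rw [abs_of_pos hpos, abs_of_pos (by positivity)]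
  have ht₀ : 0 < |t| := abs_pos.2 ht.1
  rw [habs]
  rcases ht.2 with hlt | hgt
  · exact add_one_div_lt hr1 ht₀ hlt
  · have hinv := add_one_div_lt hr1 (one_div_pos.2 ht₀) ((one_div_lt hr ht₀).1 hgt)
    rwa [one_div_one_div, add_comm (1 / |t|)] at hinv

theorem exists_im_le_of_eventually_differentiableAt {M K : ℂ → ℂ} {t₀ : ℝ}
    (hd : ∀ᶠ z in 𝓝 (t₀ : ℂ), DifferentiableAt ℂ K z) (hreal : ∀ᶠ t : ℝ in 𝓝 t₀, (K t).im = 0)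
    (hM : ∀ᶠ z in 𝓝 (t₀ : ℂ), 0 < z.im → M z = K z) :
    ∃ C δ : ℝ, 0 < δ ∧ ∀ t : ℝ, |t - t₀| < δ → ∀ ε : ℝ, 0 < ε → ε < δ →
      (M (t + ε * I)).im ≤ C * ε := by
  have hK : ContDiffAt ℂ 1 K t₀ := (analyticAt_iff_eventually_differentiableAt.2 hd).contDiffAt
  obtain ⟨C, s, hs, hC⟩ := hK.exists_lipschitzOnWith
  have hreal_line : Tendsto (fun p : ℝ × ℝ => (p.1 : ℂ)) (𝓝 (t₀, 0)) (𝓝 t₀) :=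
    (continuous_ofReal.comp continuous_fst).tendsto' _ _ rfl
  have hoff_line : Tendsto (fun p : ℝ × ℝ => (p.1 + p.2 * I : ℂ)) (𝓝 (t₀, 0)) (𝓝 t₀) :=
    Continuous.tendsto' (by fun_prop) _ _ (by simp)
  obtain ⟨δ, hδ, hnear⟩ := Metric.eventually_nhds_iff.1 ((hreal_line.eventually_mem hs).and
    ((hoff_line.eventually (hM.and hs)).and ((continuous_fst.tendsto _).eventually hreal)))
  refine ⟨C, δ, hδ, fun t ht ε hε hεδ => ?_⟩
  obtain ⟨ht_mem, ⟨hMK, hmem⟩, htK⟩ := @hnear (t, ε) (by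
    rw [Prod.dist_eq, Real.dist_eq, Real.dist_eq, sub_zero, abs_of_pos hε]
    exact max_lt ht hεδ)
  calc (M (t + ε * I)).im = (K (t + ε * I) - K t).im := by
        rw [hMK (by simpa using hε), sub_im, htK, sub_zero]
    _ ≤ ‖K (t + ε * I) - K t‖ := im_le_norm _
    _ ≤ C * dist (t + ε * I : ℂ) t := by
        rw [← dist_eq_norm]
        exact hC.dist_le_mul _ hmem _ ht_mem
    _ = C * ε := by simp [dist_eq_norm, abs_of_pos hε]

theorem tendsto_sub_one_div_atTop : Tendsto (fun y : ℝ => y - 1 / y) atTop atTop := by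
  have hinv : Tendsto (fun y : ℝ => -(1 / y)) atTop (𝓝 (-0)) :=
    (tendsto_const_nhds.div_atTop tendsto_id).neg
  simpa only [sub_eq_add_neg, id] using tendsto_id.atTop_add hinv

theorem tendsto_one_div_sub_nhdsGT_zero : Tendsto (fun y : ℝ => 1 / y - y) (𝓝[>] 0) atTop := by
  simpa [Function.comp_def] using tendsto_sub_one_div_atTop.comp tendsto_inv_nhdsGT_zero

theorem sub_one_div_pos {y : ℝ} (hy : 1 < y) : 0 < y - 1 / y :=
  sub_pos.2 (((div_lt_one (zero_lt_one.trans hy)).2 hy).trans hy)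

namespace JacobiMatrix

variable {J : JacobiMatrix} {l : ℂ} {r : ℝ}

variable (J) in
/-- The function `m_+(-λ - 1/λ)` inside the unit disc, glued to the function `-m_-(-λ - 1/λ)`
outside of it. For a reflectionless `J` the two continue each other across the upper half of the
unit circle. -/
def uniformizedWeyl (l : ℂ) : ℂ :=
  if ‖l‖ < 1 then J.mPlusExt (joukowsky l) else -J.mMinusExt (joukowsky l)

theorem uniformizedWeyl_of_norm_lt_one (hl : ‖l‖ < 1) :
    J.uniformizedWeyl l = J.mPlusExt (joukowsky l) := if_pos hl

theorem uniformizedWeyl_of_one_lt_norm (hl : 1 < ‖l‖) :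
    J.uniformizedWeyl l = -J.mMinusExt (joukowsky l) := if_neg hl.not_gt

theorem joukowsky_mem_regularSet {t : ℝ} (hr : 0 < r) (hr1 : r ≤ 1) (hop : ‖J.op‖ ≤ r + 1 / r)
    (ht : t ∈ gapSet r) : joukowsky t ∈ J.regularSet := by
  refine .inr ?_
  rw [joukowsky_ofReal, norm_real]
  exact hop.trans_lt (add_one_div_lt_abs_of_mem_gapSet hr hr1 ht)

theorem differentiableAt_uniformizedWeyl (hl₀ : l ≠ 0) (hl₁ : ‖l‖ ≠ 1)
    (hreg : joukowsky l ∈ J.regularSet) : DifferentiableAt ℂ J.uniformizedWeyl l := by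
  have hj := differentiableAt_joukowsky hl₀
  rcases hl₁.lt_or_gt with hlt | hgt
  · refine ((differentiableAt_mPlusExt hreg).comp l hj).congr_of_eventuallyEq ?_
    filter_upwards [(isOpen_lt continuous_norm continuous_const).mem_nhds hlt] with w hw
    exact uniformizedWeyl_of_norm_lt_one hw
  · refine ((differentiableAt_mMinusExt hreg).comp l hj).neg.congr_of_eventuallyEq ?_
    filter_upwards [(isOpen_lt continuous_const continuous_norm).mem_nhds hgt] with w hw
    exact uniformizedWeyl_of_one_lt_norm hw

theorem im_uniformizedWeyl_ofReal {t : ℝ} (hreg : joukowsky t ∈ J.regularSet) :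
    (J.uniformizedWeyl t).im = 0 := by
  have hconj : (starRingEnd ℂ) (joukowsky t) = joukowsky t := by
    rw [joukowsky_ofReal, conj_ofReal]
  have hplus := mPlusExt_conj hreg
  have hminus := mMinusExt_conj hreg
  rw [hconj] at hplus hminus
  unfold uniformizedWeyl
  split_ifs
  · exact conj_eq_iff_im.1 hplus.symm
  · rw [neg_im, conj_eq_iff_im.1 hminus.symm, neg_zero]

-- The difference is `m_+ + m_- = -1 / (a_0² G_0)` at `-(x + 1/x)`, outside of the spectrum.
theorem re_uniformizedWeyl_sub_mul_neg {x : ℝ} (hr : 0 < r) (hr1 : r ≤ 1)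
    (hop : ‖J.op‖ ≤ r + 1 / r) (hx : x ≠ 0) (hxr : |x| < r) :
    ((J.uniformizedWeyl x).re - (J.uniformizedWeyl (1 / x : ℝ)).re) * (x + 1 / x) < 0 := by
  have hmem : x ∈ gapSet r := ⟨hx, .inl hxr⟩
  have hx_lt : ‖(x : ℂ)‖ < 1 := by simpa using hxr.trans_le hr1
  have hx_inv : 1 < ‖((1 / x : ℝ) : ℂ)‖ := by
    rw [one_div, ofReal_inv, norm_inv]
    exact (one_lt_inv₀ (by simpa using hx)).2 hx_lt
  obtain ⟨g, hg, hneg⟩ :=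
    exists_green_real (J := J) (hop.trans_lt (add_one_div_lt_abs_of_mem_gapSet hr hr1 hmem))
  have hsum := mPlusExt_add_mMinusExt (joukowsky_mem_regularSet hr hr1 hop hmem)
  rw [joukowsky_ofReal, hg, ← joukowsky_ofReal] at hsum
  have hdiff : (J.uniformizedWeyl x).re - (J.uniformizedWeyl (1 / x : ℝ)).re =
      -1 / (J.a 0 ^ 2 * g) := by
    rw [uniformizedWeyl_of_norm_lt_one hx_lt, uniformizedWeyl_of_one_lt_norm hx_inv, one_div,
      ofReal_inv, joukowsky_inv, ← sub_re, sub_neg_eq_add, hsum]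
    rw [← ofReal_re (-1 / (J.a 0 ^ 2 * g))]
    norm_num
  have hg₀ : g ≠ 0 := by
    rintro rfl
    simp at hneg
  have ha := J.a_pos 0
  calc _ = g * -(x + 1 / x) / (J.a 0 ^ 2 * g ^ 2) := by
        rw [hdiff]
        field_simp
    _ < 0 := div_neg_of_neg_of_pos hneg (by positivity)

theorem re_uniformizedWeyl_lt_of_pos {x : ℝ} (hr1 : r ≤ 1) (hop : ‖J.op‖ ≤ r + 1 / r)
    (hx : x ∈ Ioo 0 r) : (J.uniformizedWeyl x).re < (J.uniformizedWeyl (1 / x : ℝ)).re := by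
  obtain ⟨hx₀, hxr⟩ := hx
  have hneg := re_uniformizedWeyl_sub_mul_neg (hx₀.trans hxr) hr1 hop hx₀.ne'
    (by rwa [abs_of_pos hx₀])
  exact sub_neg.1 (neg_of_mul_neg_left hneg (by positivity))

theorem re_uniformizedWeyl_lt_of_neg {x : ℝ} (hr1 : r ≤ 1) (hop : ‖J.op‖ ≤ r + 1 / r)
    (hx : x ∈ Ioo 0 r) :
    (J.uniformizedWeyl (-(1 / x) : ℝ)).re < (J.uniformizedWeyl (-x : ℝ)).re := by
  obtain ⟨hx₀, hxr⟩ := hx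
  have hneg := re_uniformizedWeyl_sub_mul_neg (hx₀.trans hxr) hr1 hop (neg_ne_zero.2 hx₀.ne')
    (by rwa [abs_neg, abs_of_pos hx₀])
  rw [one_div_neg_eq_neg_one_div, ← neg_add, mul_neg, neg_neg_iff_pos] at hneg
  exact sub_pos.1 (pos_of_mul_pos_left hneg (by positivity))

theorem tendsto_uniformizedWeyl_div :
    Tendsto (fun y : ℝ => J.uniformizedWeyl (y * I) / y) (𝓝[>] 0) (𝓝 I) := by
  have hnum := (tendsto_mul_mPlusExt (J := J)).comp tendsto_one_div_sub_nhdsGT_zero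
  have hden : Tendsto (fun y : ℝ => (1 - y ^ 2 : ℂ) * I) (𝓝[>] 0) (𝓝 I) :=
    (Continuous.tendsto' (by fun_prop) _ _ (by simp)).mono_left nhdsWithin_le_nhds
  have hdiv := hnum.div hden I_ne_zero
  rw [neg_div, one_div, inv_I, neg_neg] at hdiv
  refine hdiv.congr' ?_
  filter_upwards [Ioo_mem_nhdsGT one_pos] with y ⟨hy₀, hy₁⟩
  have hy_ne : (y : ℂ) ≠ 0 := ofReal_ne_zero.2 hy₀.ne'
  have hsq_ne : (1 - y ^ 2 : ℂ) ≠ 0 := by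
    exact_mod_cast (sub_pos.2 (pow_lt_one₀ hy₀.le hy₁ two_ne_zero)).ne'
  rw [uniformizedWeyl_of_norm_lt_one (by simpa [abs_of_pos hy₀] using hy₁), joukowsky_mul_I]
  simp only [Pi.div_apply, Function.comp_apply]
  push_cast
  field_simp

theorem uniformizedWeyl_mul_I {y : ℝ} (hy : 1 < y) :
    J.uniformizedWeyl (y * I) = -(starRingEnd ℂ) (J.mMinusExt ((y - 1 / y : ℝ) * I)) := by
  have hreg : ((y - 1 / y : ℝ) * I : ℂ) ∈ J.regularSet :=
    mem_regularSet_of_im_pos (by rw [im_ofReal_mul, I_im, mul_one]; exact sub_one_div_pos hy)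
  have hconj : (1 / y - y : ℝ) * I = (starRingEnd ℂ) ((y - 1 / y : ℝ) * I) := by
    rw [map_mul, conj_ofReal, conj_I, mul_neg, ← neg_mul, ← ofReal_neg, neg_sub]
  rw [← mMinusExt_conj hreg, ← hconj, ← joukowsky_mul_I]
  exact uniformizedWeyl_of_one_lt_norm (by simpa [abs_of_pos (zero_lt_one.trans hy)] using hy)

theorem tendsto_mul_uniformizedWeyl_sub :
    Tendsto (fun y : ℝ => ((y - 1 / y : ℝ) * I) *
      (J.a 0 ^ 2 * J.uniformizedWeyl (y * I) - (y - 1 / y : ℝ) * I - J.b 0)) atTop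
      (𝓝 (-(J.a (-1) : ℂ) ^ 2)) := by
  have hconj := (continuous_conj.tendsto _).comp
    ((tendsto_mul_mMinusExt_sub (J := J)).comp tendsto_sub_one_div_atTop)
  rw [map_neg, map_pow, conj_ofReal] at hconj
  refine hconj.congr' ?_
  filter_upwards [eventually_gt_atTop 1] with y hy
  rw [uniformizedWeyl_mul_I hy]
  simp only [Function.comp_apply, map_mul, map_add, map_sub, map_pow, conj_ofReal, conj_I]
  ring

theorem tendsto_uniformizedWeyl_sub :
    Tendsto (fun y : ℝ => J.a 0 ^ 2 * J.uniformizedWeyl (y * I) - (y - 1 / y : ℝ) * I) atTop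
      (𝓝 (J.b 0)) := by
  have hcoe : Tendsto (fun y : ℝ => ((y - 1 / y : ℝ) : ℂ)⁻¹) atTop (𝓝 0) := by
    simpa [Function.comp_def] using (continuous_ofReal.tendsto 0).comp
      (tendsto_inv_atTop_zero.comp tendsto_sub_one_div_atTop)
  have hlim := ((tendsto_mul_uniformizedWeyl_sub (J := J)).mul
    (hcoe.mul_const I⁻¹)).add_const (J.b 0 : ℂ)
  rw [zero_mul, mul_zero, zero_add] at hlim
  refine hlim.congr' ?_
  filter_upwards [eventually_gt_atTop 1] with y hy
  have hne : ((y - 1 / y : ℝ) : ℂ) ≠ 0 := ofReal_ne_zero.2 (sub_one_div_pos hy).ne'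
  rw [← mul_inv, mul_right_comm, mul_inv_cancel₀ (mul_ne_zero hne I_ne_zero), one_mul,
    sub_add_cancel]

theorem tendsto_mul_im_uniformizedWeyl_sub :
    Tendsto (fun y : ℝ => y * ((J.uniformizedWeyl (y * I)).im - 1 / J.a 0 ^ 2 * y)) atTop
      (𝓝 ((J.a (-1) ^ 2 - 1) / J.a 0 ^ 2)) := by
  have ha := J.a_pos 0
  have hre := (continuous_re.tendsto _).comp (tendsto_mul_uniformizedWeyl_sub (J := J))
  have hratio : Tendsto (fun y : ℝ => (1 - 1 / y ^ 2)) atTop (𝓝 (1 - 0)) :=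
    tendsto_const_nhds.sub (tendsto_const_nhds.div_atTop (tendsto_pow_atTop two_ne_zero))
  have hlim := (((hre.div hratio (by norm_num)).neg.sub_const 1).div_const (J.a 0 ^ 2))
  have hval : (-((-(J.a (-1) : ℂ) ^ 2).re / (1 - 0)) - 1) / J.a 0 ^ 2 =
      (J.a (-1) ^ 2 - 1) / J.a 0 ^ 2 := by
    rw [neg_re, ← ofReal_pow, ofReal_re, sub_zero, div_one, neg_neg]
  rw [hval] at hlim
  refine hlim.congr' ?_
  filter_upwards [eventually_gt_atTop 1] with y hy
  have hy₀ : y ≠ 0 := by linarith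
  have hsq : y ^ 2 - 1 ≠ 0 := by nlinarith
  have hre_eq : (((y - 1 / y : ℝ) * I) *
      (J.a 0 ^ 2 * J.uniformizedWeyl (y * I) - (y - 1 / y : ℝ) * I - J.b 0)).re =
      -(y - 1 / y) * (J.a 0 ^ 2 * (J.uniformizedWeyl (y * I)).im - (y - 1 / y)) := by
    simp only [mul_re, sub_im, im_ofReal_mul, I_re, I_im, ofReal_re, ofReal_im, ← ofReal_pow]
    ring
  simp only [Pi.div_apply, Function.comp_apply, hre_eq]
  field_simp
  ring

theorem IsReflectionlessOn.exists_uniformization (hJ : J.IsReflectionlessOn (Ioo (-2) 2)) :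
    ∃ M : ℂ → ℂ, ∀ l : ℂ, 0 < l.im →
      DifferentiableAt ℂ M l ∧ 0 < (M l).im ∧ (‖l‖ ≠ 1 → M l = J.uniformizedWeyl l) := by
  obtain ⟨F, hF, hF_upper, hF_lower⟩ := hJ.exists_extension
  refine ⟨F ∘ joukowsky, fun l hl => ?_⟩
  obtain ⟨hFd, hFpos⟩ := hF _ (joukowsky_mem_slit hl)
  refine ⟨hFd.comp l (differentiableAt_joukowsky (ne_zero_of_im_pos hl)), hFpos, fun hne => ?_⟩
  rcases hne.lt_or_gt with hlt | hgt
  · rw [uniformizedWeyl_of_norm_lt_one hlt, ← hF_upper _ (im_joukowsky_pos hl hlt)]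
    rfl
  · rw [uniformizedWeyl_of_one_lt_norm hgt, ← hF_lower _ (im_joukowsky_neg hl hgt)]
    rfl

theorem b_zero_eq_zero_of_uniformizedWeyl_eq_add {c : ℂ} (ha : J.a 0 = 1)
    (hc : ∀ y : ℝ, 0 < y → y ≠ 1 → J.uniformizedWeyl (y * I) = y * I + c) : J.b 0 = 0 := by
  have hzero : Tendsto (fun y : ℝ => J.uniformizedWeyl (y * I)) (𝓝[>] 0) (𝓝 0) := by
    have hmul := ((continuous_ofReal.tendsto 0).mono_left nhdsWithin_le_nhds).mul
      (tendsto_uniformizedWeyl_div (J := J))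
    rw [ofReal_zero, zero_mul] at hmul
    refine hmul.congr' ?_
    filter_upwards [self_mem_nhdsWithin] with y hy
    exact mul_div_cancel₀ _ (ofReal_ne_zero.2 (ne_of_gt hy))
  have hc_lim : Tendsto (fun y : ℝ => J.uniformizedWeyl (y * I)) (𝓝[>] 0) (𝓝 c) := by
    refine (((tendsto_add_mul_I 0).add_const c).congr' ?_).trans (by rw [zero_add])
    filter_upwards [Ioo_mem_nhdsGT one_pos] with y ⟨hy₀, hy₁⟩
    rw [hc y hy₀ hy₁.ne, zero_add]
  obtain rfl := tendsto_nhds_unique hc_lim hzero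
  have hinv : Tendsto (fun y : ℝ => (1 / y : ℝ) * I) atTop (𝓝 (J.b 0)) := by
    refine (tendsto_uniformizedWeyl_sub (J := J)).congr' ?_
    filter_upwards [eventually_gt_atTop 1] with y hy
    rw [hc y (by linarith) hy.ne', ha]
    push_cast
    ring
  have hinv_zero : Tendsto (fun y : ℝ => (1 / y : ℝ) * I) atTop (𝓝 0) := by
    simpa [Function.comp_def] using
      ((continuous_ofReal.tendsto 0).comp tendsto_inv_atTop_zero).mul_const I
  exact_mod_cast tendsto_nhds_unique hinv hinv_zero

theorem eventually_differentiableAt_uniformizedWeyl {t : ℝ} (hr : 0 < r) (hr1 : r ≤ 1)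
    (hop : ‖J.op‖ ≤ r + 1 / r) (ht : t ∈ gapSet r) :
    ∀ᶠ z in 𝓝 (t : ℂ), ‖z‖ ≠ 1 ∧ DifferentiableAt ℂ J.uniformizedWeyl z := by
  have ht₀ : (t : ℂ) ≠ 0 := ofReal_ne_zero.2 ht.1
  have hreg := (differentiableAt_joukowsky ht₀).continuousAt.eventually
    (J.isOpen_regularSet.mem_nhds (joukowsky_mem_regularSet hr hr1 hop ht))
  filter_upwards [isOpen_ne.mem_nhds ht₀, hreg, continuous_norm.continuousAt.eventually_ne
    (norm_ofReal_ne_one_of_mem_gapSet hr hr1 ht)] with z hz₀ hzreg hz₁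
  exact ⟨hz₁, differentiableAt_uniformizedWeyl hz₀ hz₁ hzreg⟩

theorem IsReflectionlessOn.uniformizedWeyl_moment_ratio
    (hJ : J.IsReflectionlessOn (Ioo (-2) 2)) (hr : 0 < r) (hr1 : r ≤ 1)
    (hop : ‖J.op‖ ≤ r + 1 / r) {B s : ℝ}
    (hmoment : Tendsto (fun y : ℝ => y * ((J.uniformizedWeyl (y * I)).im - B * y)) atTop (𝓝 s)) :
    (B = 1 ∧ s = 0 ∧ ∃ c : ℂ, ∀ y : ℝ, 0 < y → y ≠ 1 → J.uniformizedWeyl (y * I) = y * I + c) ∨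
      (B < 1 ∧ r ^ 2 * (1 - B) < s ∧ s < (1 - B) / r ^ 2) := by
  obtain ⟨M, hM⟩ := hJ.exists_uniformization
  have hM_mul_I : ∀ y : ℝ, 0 < y → y ≠ 1 → M (y * I) = J.uniformizedWeyl (y * I) :=
    fun y hy hy₁ => (hM _ (by simpa using hy)).2.2 (by simpa [abs_of_pos hy] using hy₁)
  have hzero : Tendsto (fun y : ℝ => (M (y * I)).im / y) (𝓝[>] 0) (𝓝 1) := by
    refine ((continuous_im.tendsto _).comp (tendsto_uniformizedWeyl_div (J := J))).congr' ?_
    filter_upwards [Ioo_mem_nhdsGT one_pos] with y ⟨hy₀, hy₁⟩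
    rw [hM_mul_I y hy₀ hy₁.ne, Function.comp_apply, div_ofReal_im]
  have hmomentM : Tendsto (fun y : ℝ => y * ((M (y * I)).im - B * y)) atTop (𝓝 s) := by
    refine hmoment.congr' ?_
    filter_upwards [eventually_gt_atTop 1] with y hy
    rw [hM_mul_I y (by linarith) hy.ne']
  have hgap : ∀ t ∈ gapSet r, ∀ᶠ z in 𝓝 (t : ℂ),
      DifferentiableAt ℂ J.uniformizedWeyl z ∧ (0 < z.im → M z = J.uniformizedWeyl z) :=
    fun t ht => (eventually_differentiableAt_uniformizedWeyl hr hr1 hop ht).mono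
      fun z hz => ⟨hz.2, fun hz_im => (hM z hz_im).2.2 hz.1⟩
  have hreal : ∀ t ∈ gapSet r, (J.uniformizedWeyl t).im = 0 := fun t ht =>
    im_uniformizedWeyl_ofReal (joukowsky_mem_regularSet hr hr1 hop ht)
  have hN : ∀ t ∈ gapSet r, Tendsto (fun y : ℝ => M (t + y * I)) (𝓝[>] 0)
      (𝓝 ((J.uniformizedWeyl t).re : ℝ)) := fun t ht => by
    have hre : ((J.uniformizedWeyl t).re : ℂ) = J.uniformizedWeyl t :=
      Complex.ext (by simp) (by simp [hreal t ht])
    rw [hre]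
    refine ((hgap t ht).self_of_nhds.1.continuousAt.tendsto.comp (tendsto_add_mul_I t)).congr' ?_
    filter_upwards [(tendsto_add_mul_I t).eventually (hgap t ht), self_mem_nhdsWithin] with y hy hy₀
    exact (hy.2 (by simpa using hy₀)).symm
  refine (herglotz_moment_ratio hr hr1 (fun z hz => (hM z hz).1) (fun z hz => (hM z hz).2.1.le)
    (fun t ht => exists_im_le_of_eventually_differentiableAt ((hgap t ht).mono fun z hz => hz.1)
      (by filter_upwards [(isOpen_gapSet r).mem_nhds ht] using hreal)
      ((hgap t ht).mono fun z hz => hz.2)) hzero hmomentM hN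
    (fun x hx => (re_uniformizedWeyl_lt_of_pos hr1 hop hx).le)
    (fun x hx => (re_uniformizedWeyl_lt_of_neg hr1 hop hx).le)).imp_left ?_
  rintro ⟨hB, hs, c, hc⟩
  exact ⟨hB, hs, c, fun y hy hy₁ => by rw [← hM_mul_I y hy hy₁, hc _ (by simpa using hy)]⟩

theorem IsReflectionlessOn.coeff_bounds (hJ : J.IsReflectionlessOn (Ioo (-2) 2)) (hr : 0 < r)
    (hr1 : r ≤ 1) (hop : ‖J.op‖ ≤ r + 1 / r) :
    (J.a 0 = 1 ∧ J.a (-1) = 1 ∧ J.b 0 = 0) ∨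
      (1 < J.a 0 ∧ r ^ 2 * (J.a 0 ^ 2 - 1) < J.a (-1) ^ 2 - 1 ∧
        J.a (-1) ^ 2 - 1 < (J.a 0 ^ 2 - 1) / r ^ 2) := by
  have ha₀ := J.a_pos 0
  have hsq : 0 < J.a 0 ^ 2 := pow_pos ha₀ 2
  rcases hJ.uniformizedWeyl_moment_ratio hr hr1 hop tendsto_mul_im_uniformizedWeyl_sub with
    ⟨hB, hs, c, hc⟩ | ⟨hB, hlow, hhigh⟩
  · rw [div_eq_one_iff_eq hsq.ne', eq_comm, pow_eq_one_iff_of_nonneg ha₀.le two_ne_zero] at hB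
    rw [div_eq_zero_iff, or_iff_left hsq.ne', sub_eq_zero,
      pow_eq_one_iff_of_nonneg (J.a_pos (-1)).le two_ne_zero] at hs
    exact .inl ⟨hB, hs, b_zero_eq_zero_of_uniformizedWeyl_eq_add hB hc⟩
  · rw [div_lt_one hsq, one_lt_sq_iff₀ ha₀.le] at hB
    have hB_sub : 1 - 1 / J.a 0 ^ 2 = (J.a 0 ^ 2 - 1) / J.a 0 ^ 2 := by field_simp
    rw [hB_sub, ← mul_div_assoc, div_lt_div_iff_of_pos_right hsq] at hlow
    rw [hB_sub, div_right_comm, div_lt_div_iff_of_pos_right hsq] at hhigh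
    exact .inr ⟨hB, hlow, hhigh⟩

end JacobiMatrix

end Joukowsky

noncomputable section Darboux

open Complex Set

theorem norm_sub_mul_im_le {l ω : ℂ} (hl : 0 < l.im) (hlt : ‖l‖ < 1) (hω : 0 < ω.im)
    (hnorm : ‖ω‖ = 1) : ‖l - ω‖ * ω.im ≤ ‖joukowsky l - joukowsky ω‖ := by
  have hconj : (starRingEnd ℂ) ω = ω⁻¹ := (inv_eq_conj hnorm).symm
  have hfactor : (l - ω) * (l - (starRingEnd ℂ) ω) = -(joukowsky l - joukowsky ω) * l := by
    have := ne_zero_of_im_pos hl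
    have := ne_zero_of_im_pos hω
    rw [hconj, joukowsky, joukowsky]
    field_simp
    ring
  have him : ω.im ≤ ‖l - (starRingEnd ℂ) ω‖ := by
    refine le_trans ?_ (im_le_norm _)
    rw [sub_im, conj_im, sub_neg_eq_add]
    exact le_add_of_nonneg_left hl.le
  calc ‖l - ω‖ * ω.im ≤ ‖l - ω‖ * ‖l - (starRingEnd ℂ) ω‖ := by gcongr
    _ = ‖joukowsky l - joukowsky ω‖ * ‖l‖ := by rw [← norm_mul, hfactor, norm_mul, norm_neg]
    _ ≤ ‖joukowsky l - joukowsky ω‖ := mul_le_of_le_one_right (norm_nonneg _) hlt.le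

theorem exists_joukowsky_eq (z : ℂ) : ∃ l : ℂ, l ≠ 0 ∧ joukowsky l = z := by
  obtain ⟨q, hq⟩ := IsAlgClosed.exists_pow_nat_eq (z ^ 2 - 4) two_pos
  have hroot : (q - z) / 2 * (-(q + z) / 2) = 1 := by linear_combination (-1 / 4) * hq
  refine ⟨(q - z) / 2, left_ne_zero_of_mul_eq_one hroot, ?_⟩
  rw [joukowsky, inv_eq_of_mul_eq_one_right hroot]
  ring

theorem exists_joukowsky_eq_of_im_pos {z : ℂ} (hz : 0 < z.im) :
    ∃ l : ℂ, 0 < l.im ∧ ‖l‖ < 1 ∧ joukowsky l = z := by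
  have im_pos {l : ℂ} (hl₀ : l ≠ 0) (hlt : ‖l‖ < 1) (hl : joukowsky l = z) : 0 < l.im := by
    rw [← hl, im_joukowsky, normSq_eq_norm_sq] at hz
    refine pos_of_mul_pos_left hz (sub_nonneg.2 ?_)
    exact (one_le_inv₀ (pow_pos (norm_pos_iff.2 hl₀) 2)).2 (pow_le_one₀ (norm_nonneg l) hlt.le)
  obtain ⟨l, hl₀, hl⟩ := exists_joukowsky_eq z
  rcases lt_trichotomy ‖l‖ 1 with hlt | heq | hgt
  · exact ⟨l, im_pos hl₀ hlt hl, hlt, hl⟩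
  · rw [← hl, im_joukowsky, normSq_eq_norm_sq, heq] at hz
    simp at hz
  · have hlt : ‖l⁻¹‖ < 1 := by
      rw [norm_inv]
      exact inv_lt_one_of_one_lt₀ hgt
    rw [← joukowsky_inv] at hl
    exact ⟨l⁻¹, im_pos (inv_ne_zero hl₀) hlt hl, hlt, hl⟩

theorem exists_norm_eq_one_joukowsky_eq {x : ℝ} (hx : x ∈ Ioo (-2 : ℝ) 2) :
    ∃ ω : ℂ, 0 < ω.im ∧ ‖ω‖ = 1 ∧ joukowsky ω = x := by
  have hpos : 0 < 1 - x ^ 2 / 4 := by nlinarith [hx.1, hx.2]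
  let ω : ℂ := ⟨-x / 2, √(1 - x ^ 2 / 4)⟩
  have hnorm : ‖ω‖ = 1 := by
    rw [← pow_eq_one_iff_of_nonneg (norm_nonneg ω) two_ne_zero, ← normSq_eq_norm_sq,
      normSq_apply, ← sq (√_), Real.sq_sqrt hpos.le]
    ring
  refine ⟨ω, Real.sqrt_pos.2 hpos, hnorm, ?_⟩
  rw [joukowsky, inv_eq_conj hnorm, add_conj, ← ofReal_neg]
  congr 1
  ring

theorem exists_tendsto_joukowsky_eq {x : ℝ} (hx : x ∈ Ioo (-2 : ℝ) 2) :
    ∃ ω : ℂ, 0 < ω.im ∧ ‖ω‖ = 1 ∧ ∃ l : ℝ → ℂ, Tendsto l (𝓝[>] 0) (𝓝 ω) ∧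
      ∀ᶠ y in 𝓝[>] (0 : ℝ), 0 < (l y).im ∧ ‖l y‖ < 1 ∧ joukowsky (l y) = x + y * I := by
  obtain ⟨ω, hω, hnorm, hωx⟩ := exists_norm_eq_one_joukowsky_eq hx
  choose! l hl using fun (y : ℝ) (hy : 0 < y) =>
    exists_joukowsky_eq_of_im_pos (z := x + y * I) (by simpa using hy)
  have hev : ∀ᶠ y in 𝓝[>] (0 : ℝ),
      0 < (l y).im ∧ ‖l y‖ < 1 ∧ joukowsky (l y) = x + y * I :=
    eventually_mem_nhdsWithin.mono hl
  refine ⟨ω, hω, hnorm, l, ?_, hev⟩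
  have hzero : Tendsto (fun y : ℝ => ‖y * I‖ / ω.im) (𝓝[>] 0) (𝓝 0) := by
    refine Tendsto.mono_left ?_ nhdsWithin_le_nhds
    exact Continuous.tendsto' (by fun_prop) _ _ (by simp)
  refine tendsto_iff_norm_sub_tendsto_zero.2
    (squeeze_zero' (.of_forall fun y => norm_nonneg _) ?_ hzero)
  filter_upwards [hev] with y ⟨him, hlt, hly⟩
  rw [le_div_iff₀ hω]
  simpa only [hly, hωx, add_sub_cancel_left] using norm_sub_mul_im_le him hlt hω hnorm

/-- A positive solution of the free equation `φ(n+1) + φ(n-1) = R φ(n)`, the datum of a Darboux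
transformation of the free Jacobi matrix at the energy `R`. -/
structure PositiveFreeSolution (R : ℝ) where
  φ : ℤ → ℝ
  pos : ∀ n, 0 < φ n
  rec_eq : ∀ n, φ (n + 1) + φ (n - 1) = R * φ n

namespace PositiveFreeSolution

variable {R : ℝ} (P : PositiveFreeSolution R)

/-- The diagonal entries `(φ(n+1) / φ(n))^{1/2}` of the Darboux factor of `R - J₀`, where `J₀` is
the free Jacobi matrix. -/
def w (n : ℤ) : ℝ := √(P.φ (n + 1) / P.φ n)

theorem w_pos (n : ℤ) : 0 < P.w n := Real.sqrt_pos.2 (div_pos (P.pos _) (P.pos _))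

theorem ofReal_w_ne_zero (n : ℤ) : (P.w n : ℂ) ≠ 0 := ofReal_ne_zero.2 (P.w_pos n).ne'

theorem w_sq (n : ℤ) : P.w n ^ 2 = P.φ (n + 1) / P.φ n :=
  Real.sq_sqrt (div_pos (P.pos _) (P.pos _)).le

theorem w_sq_add (n : ℤ) : P.w n ^ 2 + (1 / P.w (n - 1)) ^ 2 = R := by
  rw [div_pow, w_sq, w_sq, sub_add_cancel]
  have := (P.pos n).ne'
  have := (P.pos (n - 1)).ne'
  field_simp
  linarith [P.rec_eq n]

theorem w_sq_le (n : ℤ) : P.w n ^ 2 ≤ R := by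
  linarith [P.w_sq_add n, sq_nonneg (1 / P.w (n - 1))]

theorem inv_w_sq_le (n : ℤ) : (1 / P.w n) ^ 2 ≤ R := by
  have hadd := P.w_sq_add (n + 1)
  rw [add_sub_cancel_right] at hadd
  linarith [sq_nonneg (P.w (n + 1))]

theorem w_le (n : ℤ) : P.w n ≤ √R := Real.le_sqrt_of_sq_le (P.w_sq_le n)

theorem inv_w_le (n : ℤ) : 1 / P.w n ≤ √R := Real.le_sqrt_of_sq_le (P.inv_w_sq_le n)

theorem w_bdd : ∃ C, ∀ n, |P.w n| ≤ C :=
  ⟨√R, fun n => (abs_of_pos (P.w_pos n)).trans_le (P.w_le n)⟩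

theorem inv_w_bdd : ∃ C, ∀ n, |1 / P.w n| ≤ C :=
  ⟨√R, fun n => (abs_of_pos (one_div_pos.2 (P.w_pos n))).trans_le (P.inv_w_le n)⟩

/-- The Darboux transform `R - A A*` of the free Jacobi matrix `J₀ = R - A* A` by the positive
solution `P`, where `(A v)(n) = w(n) v(n) - v(n+1) / w(n)`. -/
def darboux : JacobiMatrix where
  a n := P.w (n + 1) / P.w n
  b n := R - (P.w n ^ 2 + (1 / P.w n) ^ 2)
  a_pos n := div_pos (P.w_pos _) (P.w_pos _)
  a_bdd := ⟨√R * √R, fun n => by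
    rw [abs_of_pos (div_pos (P.w_pos _) (P.w_pos _)), div_eq_mul_one_div]
    exact mul_le_mul (P.w_le _) (P.inv_w_le n) (one_div_pos.2 (P.w_pos n)).le (Real.sqrt_nonneg _)⟩
  b_bdd := ⟨R, fun n => abs_le.2 (by
    constructor <;>
      linarith [P.w_sq_le n, P.inv_w_sq_le n, sq_nonneg (1 / P.w n), sq_nonneg (P.w n)])⟩

theorem darboux_a (n : ℤ) : P.darboux.a n = P.w (n + 1) / P.w n := rfl

theorem darboux_b (n : ℤ) : P.darboux.b n = R - (P.w n ^ 2 + (1 / P.w n) ^ 2) := rfl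

theorem darboux_a_sq (n : ℤ) :
    P.darboux.a n ^ 2 = P.φ (n + 2) * P.φ n / P.φ (n + 1) ^ 2 := by
  rw [darboux_a, div_pow, w_sq, w_sq, add_assoc, one_add_one_eq_two, div_div_div_eq,
    ← sq]

section Sequences

variable (u v : ℤ → ℂ) (n : ℤ)

/-- The Darboux factor `A`, acting on arbitrary sequences. -/
def transform (v : ℤ → ℂ) (n : ℤ) : ℂ := P.w n * v n - 1 / P.w n * v (n + 1)

/-- The formal adjoint `A*` of the Darboux factor, acting on arbitrary sequences. -/
def cotransform (u : ℤ → ℂ) (n : ℤ) : ℂ := P.w n * u n - 1 / P.w (n - 1) * u (n - 1)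

theorem transform_smul (c : ℂ) : P.transform (c • v) = c • P.transform v := by
  ext n
  simp only [transform, Pi.smul_apply, smul_eq_mul]
  ring

theorem transform_cotransform :
    P.transform (P.cotransform u) n = R * u n -
      (P.darboux.a n * u (n + 1) + P.darboux.a (n - 1) * u (n - 1) + P.darboux.b n * u n) := by
  simp only [transform, cotransform, darboux_a, darboux_b, add_sub_cancel_right, sub_add_cancel]
  push_cast
  ring

theorem cotransform_transform :
    P.cotransform (P.transform v) n = R * v n - (v (n + 1) + v (n - 1)) := by
  have hsum : (P.w n : ℂ) ^ 2 + (1 / P.w (n - 1)) ^ 2 = R := by exact_mod_cast P.w_sq_add n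
  simp only [transform, cotransform, sub_add_cancel]
  linear_combination v n * hsum - v (n + 1) * mul_one_div_cancel (P.ofReal_w_ne_zero n) -
    v (n - 1) * mul_one_div_cancel (P.ofReal_w_ne_zero (n - 1))

variable {v}

theorem isSolution_transform {z : ℂ} (hv : ∀ n, v (n + 1) + v (n - 1) = z * v n) :
    P.darboux.IsSolution z (P.transform v) := by
  intro n
  have hcotransform : P.cotransform (P.transform v) = (R - z) • v := by
    ext m
    rw [cotransform_transform, hv, Pi.smul_apply, smul_eq_mul]
    ring
  have hop := P.transform_cotransform (P.transform v) n
  rw [hcotransform, transform_smul, Pi.smul_apply, smul_eq_mul] at hop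
  linear_combination hop

end Sequences

section Operators

/-- The Darboux factor `A` on `ℓ²(ℤ)`; see `factor_apply`. -/
def factor : EllTwo →L[ℂ] EllTwo :=
  mulCLM P.w P.w_bdd - mulCLM (fun n => 1 / P.w n) P.inv_w_bdd ∘L permCLM (Equiv.addRight 1)

/-- The adjoint `A*` of the Darboux factor on `ℓ²(ℤ)`; see `cofactor_apply`. -/
def cofactor : EllTwo →L[ℂ] EllTwo :=
  mulCLM P.w P.w_bdd - permCLM (Equiv.subRight 1) ∘L mulCLM (fun n => 1 / P.w n) P.inv_w_bdd

theorem factor_apply (v : EllTwo) (n : ℤ) : P.factor v n = P.transform v n := by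
  simp [factor, transform, mulCLM_apply, permCLM_apply]

theorem cofactor_apply (u : EllTwo) (n : ℤ) : P.cofactor u n = P.cotransform u n := by
  simp [cofactor, cotransform, mulCLM_apply, permCLM_apply]

theorem inner_factor_left (v u : EllTwo) :
    inner ℂ (P.factor v) u = inner ℂ v (P.cofactor u) := by
  simp only [factor, cofactor, sub_apply, ContinuousLinearMap.comp_apply,
    inner_sub_left, inner_sub_right, inner_mulCLM_left, inner_permCLM_left]
  rfl

theorem factor_cofactor (u : EllTwo) :
    P.factor (P.cofactor u) = (R : ℂ) • u - P.darboux.op u := by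
  ext n
  rw [factor_apply, funext (P.cofactor_apply u), transform_cotransform]
  rfl

theorem cofactor_factor (v : EllTwo) :
    P.cofactor (P.factor v) = (R : ℂ) • v -
      (permCLM (Equiv.addRight 1) v + permCLM (Equiv.subRight 1) v) := by
  ext n
  rw [cofactor_apply, funext (P.factor_apply v), cotransform_transform]
  rfl

theorem norm_sq_factor_le (v : EllTwo) : ‖P.factor v‖ ^ 2 ≤ (R + 2) * ‖v‖ ^ 2 := by
  set s := permCLM (Equiv.addRight 1) v + permCLM (Equiv.subRight 1) v
  have hs : ‖s‖ ≤ 2 * ‖v‖ := by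
    have hperm (e : ℤ ≃ ℤ) : ‖permCLM e v‖ ≤ ‖v‖ := by
      simpa using (permCLM e).le_of_opNorm_le (norm_permCLM_le e) v
    linarith [norm_add_le_of_le (hperm (Equiv.addRight 1)) (hperm (Equiv.subRight 1))]
  have hre : -(‖v‖ * ‖s‖) ≤ (inner ℂ v s).re :=
    neg_le_of_abs_le ((abs_re_le_norm _).trans (norm_inner_le_norm v s))
  calc ‖P.factor v‖ ^ 2 = (inner ℂ (P.factor v) (P.factor v)).re :=
        (inner_self_eq_norm_sq (𝕜 := ℂ) _).symm
    _ = R * ‖v‖ ^ 2 - (inner ℂ v s).re := by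
        rw [inner_factor_left, cofactor_factor, inner_sub_right, inner_smul_right,
          sub_re, re_ofReal_mul, ← inner_self_eq_norm_sq (𝕜 := ℂ) v]
        rfl
    _ ≤ (R + 2) * ‖v‖ ^ 2 := by nlinarith [norm_nonneg v]

theorem norm_op_darboux_le (hR : 2 ≤ R) : ‖P.darboux.op‖ ≤ R := by
  have hR₀ : 0 ≤ R := zero_le_two.trans hR
  refine ContinuousLinearMap.opNorm_le_bound _ hR₀ fun u => ?_
  refine (sq_le_sq₀ (norm_nonneg _) (by positivity)).1 ?_
  have hre : (inner ℂ ((R : ℂ) • u) (P.factor (P.cofactor u))).re = R * ‖P.cofactor u‖ ^ 2 := by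
    rw [inner_smul_left, conj_ofReal, re_ofReal_mul, ← inner_conj_symm, inner_factor_left,
      conj_re, ← inner_self_eq_norm_sq (𝕜 := ℂ) (P.cofactor u)]
    rfl
  calc ‖P.darboux.op u‖ ^ 2 = ‖(R : ℂ) • u - P.factor (P.cofactor u)‖ ^ 2 := by
        rw [factor_cofactor, sub_sub_cancel]
    _ = (R * ‖u‖) ^ 2 - 2 * (R * ‖P.cofactor u‖ ^ 2) + ‖P.factor (P.cofactor u)‖ ^ 2 := by
        rw [@norm_sub_sq ℂ, norm_smul, norm_real, Real.norm_of_nonneg hR₀, ← hre]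
        rfl
    _ ≤ (R * ‖u‖) ^ 2 := by
        nlinarith [P.norm_sq_factor_le (P.cofactor u), sq_nonneg ‖P.cofactor u‖]

end Operators

section WeylFunctions

variable {l : ℂ}

/-- The quotient `f(1) / (a(0) f(0))` for the Darboux transform `f` of the sequence `(-l)^n`. -/
def weylQuotient (l : ℂ) : ℂ :=
  -l * (P.w 1 + l / P.w 1) / (P.darboux.a 0 * (P.w 0 + l / P.w 0))

theorem w_add_div_ne_zero (hl : l.im ≠ 0) (n : ℤ) : (P.w n + l / P.w n : ℂ) ≠ 0 := fun h => by
  apply_fun im at h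
  rw [add_im, ofReal_im, zero_add, div_ofReal_im, zero_im] at h
  exact div_ne_zero hl (P.w_pos n).ne' h

theorem continuousAt_weylQuotient (hl : l.im ≠ 0) : ContinuousAt P.weylQuotient l :=
  ContinuousAt.div (by fun_prop) (by fun_prop)
    (mul_ne_zero (JacobiMatrix.a_ne_zero 0) (P.w_add_div_ne_zero hl 0))

theorem weylQuotient_conj (l : ℂ) :
    P.weylQuotient ((starRingEnd ℂ) l) = (starRingEnd ℂ) (P.weylQuotient l) := by
  simp [weylQuotient]

theorem transform_zpow (hl : l ≠ 0) (n : ℤ) :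
    P.transform (fun m => (-l) ^ m) n = (-l) ^ n * (P.w n + l / P.w n) := by
  simp only [transform, zpow_add_one₀ (neg_ne_zero.2 hl)]
  ring

theorem isSolution_transform_zpow (hl : l ≠ 0) :
    P.darboux.IsSolution (joukowsky l) (P.transform fun n => (-l) ^ n) :=
  P.isSolution_transform fun n => by
    rw [zpow_add_one₀ (neg_ne_zero.2 hl), zpow_sub_one₀ (neg_ne_zero.2 hl), joukowsky, inv_neg]
    ring

theorem transform_zpow_ne_zero (hl : l.im ≠ 0) : (P.transform fun n => (-l) ^ n) ≠ 0 := fun h => by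
  have hl₀ : l ≠ 0 := by
    rintro rfl
    exact hl zero_im
  have hzero := congrFun h 0
  rw [transform_zpow _ hl₀, zpow_zero, one_mul] at hzero
  exact P.w_add_div_ne_zero hl 0 hzero

theorem norm_w_add_div_le (l : ℂ) (n : ℤ) : ‖(P.w n + l / P.w n : ℂ)‖ ≤ (1 + ‖l‖) * √R := by
  refine (norm_add_le _ _).trans ?_
  rw [norm_div, norm_real, Real.norm_of_nonneg (P.w_pos n).le, div_eq_mul_one_div]
  nlinarith [norm_nonneg l, P.w_le n, P.inv_w_le n]

theorem summable_norm_sq_pow_mul {η : ℂ} (hη : ‖η‖ < 1) (e : ℕ → ℤ) :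
    Summable fun n : ℕ => ‖η ^ n * (P.w (e n) + l / P.w (e n))‖ ^ 2 := by
  have hgeom : Summable fun n : ℕ => (‖η‖ ^ 2) ^ n * ((1 + ‖l‖) * √R) ^ 2 :=
    (summable_geometric_of_lt_one (by positivity)
      (pow_lt_one₀ (norm_nonneg _) hη two_ne_zero)).mul_right _
  refine Summable.of_nonneg_of_le (fun n => by positivity) (fun n => ?_) hgeom
  rw [norm_mul, norm_pow, mul_pow, pow_right_comm]
  gcongr
  exact P.norm_w_add_div_le l _

theorem transform_zpow_one_div (hl : l ≠ 0) :
    P.transform (fun n => (-l) ^ n) 1 / (P.darboux.a 0 * P.transform (fun n => (-l) ^ n) 0) =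
      P.weylQuotient l := by
  rw [transform_zpow _ hl, transform_zpow _ hl, zpow_one, zpow_zero, one_mul, weylQuotient]

theorem mPlus_darboux (hl : 0 < l.im) (hlt : ‖l‖ < 1) :
    P.darboux.mPlus (joukowsky l) = -P.weylQuotient l := by
  have hl₀ := ne_zero_of_im_pos hl
  rw [JacobiMatrix.mPlus_eq ⟨P.transform_zpow_ne_zero hl.ne', P.isSolution_transform_zpow hl₀, ?_⟩,
    transform_zpow_one_div _ hl₀]
  simp only [transform_zpow _ hl₀, zpow_natCast]
  exact P.summable_norm_sq_pow_mul (by rwa [norm_neg]) _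

theorem mMinus_darboux (hl : 0 < l.im) (hlt : ‖l‖ < 1) :
    P.darboux.mMinus (joukowsky l) = P.weylQuotient l⁻¹ := by
  have hl₀ := inv_ne_zero (ne_zero_of_im_pos hl)
  have him : l⁻¹.im ≠ 0 := by
    rw [inv_im]
    exact div_ne_zero (neg_ne_zero.2 hl.ne') (normSq_pos.2 (ne_zero_of_im_pos hl)).ne'
  have hpow (n : ℕ) : (-l⁻¹) ^ (-(n : ℤ)) = (-l) ^ n := by
    rw [zpow_neg, zpow_natCast, ← inv_pow, inv_neg, inv_inv]
  rw [← joukowsky_inv,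
    JacobiMatrix.mMinus_eq ⟨P.transform_zpow_ne_zero him, P.isSolution_transform_zpow hl₀, ?_⟩,
    transform_zpow_one_div _ hl₀]
  simp only [transform_zpow _ hl₀, hpow]
  exact P.summable_norm_sq_pow_mul (by rwa [norm_neg]) _

theorem isReflectionlessOn_darboux : P.darboux.IsReflectionlessOn (Ioo (-2) 2) := by
  refine .of_forall fun x hx => ?_
  obtain ⟨ω, hω, hnorm, l, hlω, hl⟩ := exists_tendsto_joukowsky_eq hx
  have hinv : ω⁻¹ = (starRingEnd ℂ) ω := inv_eq_conj hnorm
  have him : ω⁻¹.im ≠ 0 := by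
    rw [hinv, conj_im]
    exact neg_ne_zero.2 hω.ne'
  refine ⟨-P.weylQuotient ω, P.weylQuotient ω⁻¹, ?_, ?_, ?_⟩
  · refine ((P.continuousAt_weylQuotient hω.ne').tendsto.comp hlω).neg.congr' ?_
    filter_upwards [hl] with y ⟨hy, hlt, heq⟩
    exact heq ▸ (P.mPlus_darboux hy hlt).symm
  · refine ((P.continuousAt_weylQuotient him).tendsto.comp
      (hlω.inv₀ (ne_zero_of_im_pos hω))).congr' ?_
    filter_upwards [hl] with y ⟨hy, hlt, heq⟩
    exact heq ▸ (P.mMinus_darboux hy hlt).symm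
  · rw [hinv, weylQuotient_conj, conj_conj]

theorem darboux_mem_marchenkoClass (hR : 2 ≤ R) : P.darboux ∈ JacobiMatrix.marchenkoClass R :=
  ⟨P.isReflectionlessOn_darboux, P.norm_op_darboux_le hR⟩

end WeylFunctions

section Soliton

variable {q t : ℝ}

/-- The free solution `φ(n) = q^{-n} + t q^n`, whose Darboux transform has one soliton. -/
def exponential (hq : 0 < q) (ht : 0 < t) : PositiveFreeSolution (q + 1 / q) where
  φ n := q⁻¹ ^ n + t * q ^ n
  pos n := by positivity
  rec_eq n := by
    rw [zpow_add_one₀ hq.ne', zpow_sub_one₀ hq.ne', zpow_add_one₀ (inv_ne_zero hq.ne'),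
      zpow_sub_one₀ (inv_ne_zero hq.ne'), inv_inv, one_div]
    ring

theorem exponential_φ (hq : 0 < q) (ht : 0 < t) (n : ℤ) :
    (exponential hq ht).φ n = q⁻¹ ^ n + t * q ^ n := rfl

theorem darboux_exponential_a_sq_sub_one (hq : 0 < q) (ht : 0 < t) (n : ℤ) :
    (exponential hq ht).darboux.a n ^ 2 - 1 =
      t * (q⁻¹ - q) ^ 2 / (exponential hq ht).φ (n + 1) ^ 2 := by
  have hφ := pow_ne_zero 2 ((exponential hq ht).pos (n + 1)).ne'
  have hinv : q⁻¹ ^ n * q ^ n = 1 := by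
    rw [← mul_zpow, inv_mul_cancel₀ hq.ne', one_zpow]
  rw [darboux_a_sq, div_sub_one hφ]
  congr 1
  simp only [exponential_φ, zpow_add₀ hq.ne', zpow_add₀ (inv_ne_zero hq.ne'), zpow_ofNat]
  linear_combination t * (q⁻¹ - q) ^ 2 * hinv

theorem inv_sub_self_ne_zero (hq : 0 < q) (hq₁ : q ≠ 1) : q⁻¹ - q ≠ 0 := fun h => by
  have hsq : q * q = 1 := by rw [← mul_inv_cancel₀ hq.ne', sub_eq_zero.1 h]
  exact hq₁ ((mul_self_eq_one_iff.1 hsq).resolve_right (by linarith))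

theorem not_isFree_darboux_exponential (hq : 0 < q) (hq₁ : q ≠ 1) (ht : 0 < t) :
    ¬ (exponential hq ht).darboux.IsFree := fun hfree => by
  have ha := darboux_exponential_a_sq_sub_one hq ht 0
  rw [(hfree 0).1, one_pow, sub_self] at ha
  exact div_ne_zero (mul_ne_zero ht.ne' (pow_ne_zero 2 (inv_sub_self_ne_zero hq hq₁)))
    (pow_ne_zero 2 ((exponential hq ht).pos _).ne') ha.symm

theorem darboux_exponential_ratio (hq : 0 < q) (hq₁ : q ≠ 1) (ht : 0 < t) (n : ℤ) :
    ((exponential hq ht).darboux.a (n + 1) ^ 2 - 1) / ((exponential hq ht).darboux.a n ^ 2 - 1) =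
      ((q⁻¹ ^ (n + 1) + t * q ^ (n + 1)) / (q⁻¹ ^ (n + 2) + t * q ^ (n + 2))) ^ 2 := by
  rw [darboux_exponential_a_sq_sub_one, darboux_exponential_a_sq_sub_one,
    div_div_div_cancel_left', add_assoc, one_add_one_eq_two, div_pow]
  · rfl
  · exact mul_ne_zero ht.ne' (pow_ne_zero 2 (inv_sub_self_ne_zero hq hq₁))

theorem two_le_add_one_div (hq : 0 < q) : 2 ≤ q + 1 / q := by
  have hsq : q + 1 / q - 2 = (q - 1) ^ 2 / q := by
    field_simp
    ring
  exact sub_nonneg.1 (hsq ▸ by positivity)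

theorem tendsto_exponential_ratio (hq : 0 < q) (n : ℤ) :
    Tendsto (fun t => ((q⁻¹ ^ (n + 1) + t * q ^ (n + 1)) / (q⁻¹ ^ (n + 2) + t * q ^ (n + 2))) ^ 2)
      (𝓝[>] 0) (𝓝 (q ^ 2)) := by
  have hquot : q⁻¹ ^ (n + 1) / q⁻¹ ^ (n + 2) = q := by
    rw [← zpow_sub₀ (inv_ne_zero hq.ne'), add_sub_add_left_eq_sub]
    norm_num
  have hcont : ContinuousAt (fun t =>
      ((q⁻¹ ^ (n + 1) + t * q ^ (n + 1)) / (q⁻¹ ^ (n + 2) + t * q ^ (n + 2))) ^ 2) 0 := by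
    refine (ContinuousAt.div (by fun_prop) (by fun_prop) ?_).pow 2
    rw [zero_mul, add_zero]
    positivity
  have hlim := hcont.tendsto.mono_left (nhdsWithin_le_nhds (s := Ioi 0))
  rwa [zero_mul, zero_mul, add_zero, add_zero, hquot] at hlim

theorem exists_soliton_ratio_mem (hq : 0 < q) (hq₁ : q ≠ 1) (n : ℤ) {U : Set ℝ}
    (hU : U ∈ 𝓝 (q ^ 2)) : ∃ J ∈ JacobiMatrix.marchenkoClass (q + 1 / q), ¬ J.IsFree ∧
      (J.a (n + 1) ^ 2 - 1) / (J.a n ^ 2 - 1) ∈ U := by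
  obtain ⟨t, htU, ht⟩ :=
    ((tendsto_exponential_ratio hq n).eventually_mem hU |>.and self_mem_nhdsWithin).exists
  exact ⟨_, (exponential hq ht).darboux_mem_marchenkoClass (two_le_add_one_div hq),
    not_isFree_darboux_exponential hq hq₁ ht, (darboux_exponential_ratio hq hq₁ ht n).symm ▸ htU⟩

end Soliton

end PositiveFreeSolution

end Darboux

noncomputable section CoefficientBounds

open Set

theorem exists_add_one_div_eq {R : ℝ} (hR : 2 ≤ R) : ∃ r : ℝ, 0 < r ∧ r ≤ 1 ∧ r + 1 / r = R := by
  have hdisc : 0 ≤ R ^ 2 - 4 := by nlinarith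
  have hsq := Real.sq_sqrt hdisc
  have hsqrt := Real.sqrt_nonneg (R ^ 2 - 4)
  set q := √(R ^ 2 - 4)
  have hqR : q < R := by nlinarith
  refine ⟨(R - q) / 2, by linarith, by nlinarith, ?_⟩
  have := sub_ne_zero.2 hqR.ne'
  field_simp
  linear_combination hsq

namespace JacobiMatrix

variable {J : JacobiMatrix} {r : ℝ}

theorem IsReflectionlessOn.coeff_bounds_at (hJ : J.IsReflectionlessOn (Ioo (-2) 2)) (hr : 0 < r)
    (hr1 : r ≤ 1) (hop : ‖J.op‖ ≤ r + 1 / r) (n : ℤ) :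
    (J.a n = 1 ∧ J.a (n - 1) = 1 ∧ J.b n = 0) ∨
      (1 < J.a n ∧ r ^ 2 * (J.a n ^ 2 - 1) < J.a (n - 1) ^ 2 - 1 ∧
        J.a (n - 1) ^ 2 - 1 < (J.a n ^ 2 - 1) / r ^ 2) := by
  simpa only [JacobiMatrix.shift, zero_add, neg_add_eq_sub] using
    (hJ.shift n).coeff_bounds hr hr1 ((J.norm_op_shift_le n).trans hop)

theorem IsReflectionlessOn.one_le_a (hJ : J.IsReflectionlessOn (Ioo (-2) 2)) (n : ℤ) :
    1 ≤ J.a n := by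
  obtain ⟨r, hr, hr1, hR⟩ := exists_add_one_div_eq (le_max_left 2 ‖J.op‖)
  rcases hJ.coeff_bounds_at hr hr1 (hR ▸ le_max_right _ _) n with ⟨ha, -⟩ | ⟨ha, -⟩
  · exact ha.ge
  · exact ha.le

theorem IsReflectionlessOn.isFree_of_a_eq_one (hJ : J.IsReflectionlessOn (Ioo (-2) 2))
    {m : ℤ} (hm : J.a m = 1) : J.IsFree := by
  obtain ⟨r, hr, hr1, hR⟩ := exists_add_one_div_eq (le_max_left 2 ‖J.op‖)
  have hbounds := hJ.coeff_bounds_at hr hr1 (hR ▸ le_max_right _ _)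
  have hdown (n : ℤ) (hn : J.a n = 1) : J.a (n - 1) = 1 ∧ J.b n = 0 :=
    ((hbounds n).resolve_right fun h => h.1.ne' hn).2
  have hup (n : ℤ) (hn : J.a n = 1) : J.a (n + 1) = 1 := by
    refine ((hbounds (n + 1)).resolve_right fun ⟨hgt, hlow, _⟩ => ?_).1
    rw [add_sub_cancel_right, hn, one_pow, sub_self] at hlow
    exact hlow.not_ge (mul_nonneg (sq_nonneg r) (sub_nonneg.2 (one_le_pow₀ hgt.le)))
  have hall (n : ℤ) : J.a n = 1 :=
    Int.inductionOn' n m hm (fun k _ => hup k) fun k _ hk => (hdown k hk).1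
  exact fun n => ⟨hall n, (hdown n (hall n)).2⟩

theorem IsReflectionlessOn.one_lt_a (hJ : J.IsReflectionlessOn (Ioo (-2) 2))
    (hfree : ¬ J.IsFree) (n : ℤ) : 1 < J.a n :=
  (hJ.one_le_a n).lt_of_ne' fun ha => hfree (hJ.isFree_of_a_eq_one ha)

theorem IsReflectionlessOn.ratio_mem_Ioo (hJ : J.IsReflectionlessOn (Ioo (-2) 2))
    (hr : 0 < r) (hr1 : r ≤ 1) (hop : ‖J.op‖ ≤ r + 1 / r) (hfree : ¬ J.IsFree) (n : ℤ) :
    (J.a (n + 1) ^ 2 - 1) / (J.a n ^ 2 - 1) ∈ Ioo (r ^ 2) (1 / r ^ 2) := by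
  have hpos : 0 < J.a n ^ 2 - 1 :=
    sub_pos.2 (one_lt_pow₀ (hJ.one_lt_a hfree n) two_ne_zero)
  have hr2 : 0 < r ^ 2 := pow_pos hr 2
  obtain ⟨-, hlow, hhigh⟩ := (hJ.coeff_bounds_at hr hr1 hop (n + 1)).resolve_left
    fun h => (hJ.one_lt_a hfree (n + 1)).ne' h.1
  rw [add_sub_cancel_right] at hlow hhigh
  rw [lt_div_iff₀ hr2] at hhigh
  rw [mem_Ioo, lt_div_iff₀ hpos, div_lt_div_iff₀ hpos hr2]
  constructor <;> linarith

end JacobiMatrix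

end CoefficientBounds

theorem mainTheorem7 :
    (∀ J : JacobiMatrix, J.IsReflectionlessOn (Set.Ioo (-2) 2) →
      (∀ n, 1 ≤ J.a n) ∧ ((∃ n, J.a n = 1) → J.IsFree)) ∧
    ∀ R r : ℝ, 2 ≤ R → 0 < r → r ≤ 1 → r + 1 / r = R →
      (∀ J ∈ JacobiMatrix.marchenkoClass R, ¬ J.IsFree → ∀ n : ℤ,
        1 < J.a n ∧
        r ^ 2 < (J.a (n + 1) ^ 2 - 1) / (J.a n ^ 2 - 1) ∧
        (J.a (n + 1) ^ 2 - 1) / (J.a n ^ 2 - 1) < 1 / r ^ 2) ∧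
      (2 < R → ∀ n : ℤ,
        (∀ c : ℝ, r ^ 2 < c → ∃ J ∈ JacobiMatrix.marchenkoClass R, ¬ J.IsFree ∧
          (J.a (n + 1) ^ 2 - 1) / (J.a n ^ 2 - 1) < c) ∧
        (∀ c : ℝ, c < 1 / r ^ 2 → ∃ J ∈ JacobiMatrix.marchenkoClass R, ¬ J.IsFree ∧
          c < (J.a (n + 1) ^ 2 - 1) / (J.a n ^ 2 - 1))) := by
  refine ⟨fun J hJ => ⟨hJ.one_le_a, fun ⟨_, hn⟩ => hJ.isFree_of_a_eq_one hn⟩, ?_⟩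
  rintro R r - hr hr1 rfl
  refine ⟨fun J ⟨hJ, hop⟩ hfree n =>
    ⟨hJ.one_lt_a hfree n, hJ.ratio_mem_Ioo hr hr1 hop hfree n⟩, fun hR n => ?_⟩
  have hne : r ≠ 1 := by
    rintro rfl
    norm_num at hR
  have hinv : r⁻¹ + 1 / r⁻¹ = r + 1 / r := by rw [one_div, inv_inv, one_div, add_comm]
  refine ⟨fun c hc =>
    PositiveFreeSolution.exists_soliton_ratio_mem hr hne n (Iio_mem_nhds hc), fun c hc => ?_⟩
  rw [one_div, ← inv_pow] at hc
  exact hinv ▸ PositiveFreeSolution.exists_soliton_ratio_mem (inv_pos.2 hr)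
    (inv_ne_one.2 hne) n (Ioi_mem_nhds hc)
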